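/- **Setting.** A Bernstein function is $g(x)=a_g+b_g x+\int_0^\infty(1-e^{-xs})\,\overline\nu_g(ds)$, $x>0$, with $a_g,b_g\ge 0$ and a measure $\overline\nu_g$ on $(0,\infty)$ such that $\int_0^\infty (s\wedge 1)\,\overline\nu_g(ds)<\infty$; its tail is $\nu_g(s)=a_g+\overline\nu_g(s,\infty)$. A subordinator $H^g$ with Laplace exponent $g$ is a nondecreasing Lévy process with $\mathbb E e^{-xH^g(t)}=e^{-tg(x)}$, $x>0$ (killed, i.e. sent to $+\infty$, at rate $a_g$ if $a_g>0$, with $e^{-\infty}=0$). Let $f,\psi_1,\dots,\psi_n$ be Bernstein functions, where $f$ satisfies Condition I: $\overline\nu_f(0,\infty)=\infty$ and the tail $\nu_f$ is absolutely continuous on compact subintervals of $(0,\infty)$. Let $N$ be a Poisson process with intensity $\lambda>0$, let $H^{\psi_1},\dots,H^{\psi_n},H^f$ be subordinators with Laplace exponents $\psi_1,\dots,\psi_n,f$, and let $N,H^{\psi_1},\dots,H^{\psi_n},H^f$ be independent. Let $Y^f(t)=\inf\{s\ge 0: H^f(s)>t\}$ be the inverse of $H^f$, and put, for $k=0,1,2,\dots$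 and $t\ge 0$, $$p_k(t)=\mathbb P\Big\{N\Big(\sum_{j=1}^n H^{\psi_j}(Y^f(t))\Big)=k\Big\},$$ where the event includes that $\sum_{j=1}^n H^{\psi_j}(Y^f(t))$ is finite. **Theorem.** (1) For every $t>0$, $Y^f(t)$ has a density $\ell_f(t,\cdot)$ with respect to Lebesgue measure. Let $\tilde\ell_f(t,\mu)=\int_0^\infty e^{-\mu x}\ell_f(t,x)\,dx$. Then $\mu\mapsto\tilde\ell_f\big(t,\sum_{j=1}^n\psi_j(\mu)\big)$ is infinitely differentiable on $(0,\infty)$, and for all $k\ge 0$ $$p_k(t)=\frac{(-\lambda)^k}{k!}\,\frac{\partial^k}{\partial\lambda^k}\,\tilde\ell_f\Big(t,\sum_{j=1}^n\psi_j(\lambda)\Big).$$ (2) For every $k\ge 0$, $p_k$ is absolutely continuous on $[0,T]$ for every $T>0$, and for every $t>0$ $$\mathcal D^f_t p_k(t)=-\sum_{j=1}^n\psi_j(\lambda(I-B))\,p_k(t).$$ Here $$\mathcal D^f_t u(t)=b_f\,u'(t)+\int_0^t u'(t-s)\,\nu_f(s)\,ds ,$$ where for $u=p_k$ and every $t>0$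 the integral converges absolutely and, if $b_f\neq0$, $u'(t)$ exists; and, with the backshift $Bp_k=p_{k-1}$, $p_{-1}=0$, $$\psi_j(\lambda(I-B))\,p_k(t)=\sum_{m=0}^k\psi_j^{(m)}(\lambda)\,\frac{(-\lambda)^m}{m!}\,p_{k-m}(t).$$ (3) $p_0(0)=1$ and $p_k(0)=0$ for $k\ge 1$. -/

import Mathlib

open MeasureTheory ProbabilityTheory Set
open scoped NNReal ENNReal

noncomputable section

/-- The data `(a, b, ν̄)` of a Bernstein function: `a, b ≥ 0` and a Lévy measure `ν̄` on `(0, ∞)`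
with `∫ (s ∧ 1) ν̄(ds) < ∞`. -/
structure LevyTriple where
  a : ℝ≥0
  b : ℝ≥0
  levy : Measure ℝ
  levy_Iic : levy (Iic 0) = 0
  lintegral_min_lt_top : ∫⁻ s, ENNReal.ofReal (min s 1) ∂levy < ∞

namespace LevyTriple

/-- The Bernstein function `f(x) = a + b x + ∫_{(0,∞)} (1 - e^{-xs}) ν̄(ds)`, for `x > 0`. -/
def bernstein (F : LevyTriple) (x : ℝ) : ℝ :=
  F.a + F.b * x + ∫ s in Ioi (0 : ℝ), (1 - Real.exp (-(x * s))) ∂F.levy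

/-- The tail `ν(s) = a + ν̄(s, ∞)`, for `s > 0`. -/
def tail (F : LevyTriple) (s : ℝ) : ℝ :=
  F.a + (F.levy (Ioi s)).toReal

/-- Condition I: `ν̄(0, ∞) = ∞`, and the tail `ν` is absolutely continuous on `(0, ∞)`, that is,
on each compact subinterval (the tail is unbounded at `0`). -/
def ConditionI (F : LevyTriple) : Prop :=
  F.levy (Ioi 0) = ∞ ∧
    ∀ x y : ℝ, 0 < x → x ≤ y → AbsolutelyContinuousOnInterval F.tail x y

/-- The generalized Caputo-Djrbashian (convolution-type) derivative
`𝒟^f u (t) = b u'(t) + ∫_0^t u'(t - s) ν(s) ds`. -/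
def cdDeriv (F : LevyTriple) (u : ℝ → ℝ) (t : ℝ) : ℝ :=
  F.b * deriv u t + ∫ s in (0 : ℝ)..t, deriv u (t - s) * F.tail s

/-- All terms in `cdDeriv F u t` are meaningful: `u` is absolutely continuous on compact
subintervals of `[0, ∞)`, the convolution integral converges absolutely, and `u` is
differentiable at `t` if the term `b u'(t)` is present. -/
def CDDifferentiableAt (F : LevyTriple) (u : ℝ → ℝ) (t : ℝ) : Prop :=
  (∀ T : ℝ, 0 < T → AbsolutelyContinuousOnInterval u 0 T) ∧
    (F.b ≠ 0 → DifferentiableAt ℝ u t) ∧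
    IntervalIntegrable (fun s => deriv u (t - s) * F.tail s) volume 0 t

end LevyTriple

/-- The operator `ψ(λ(I - B))` on sequences, `B` being the backshift `(B p)_k = p_{k-1}`, with
`p_{-1} = 0`:
`(ψ(λ(I - B)) p)_k = ∑_{m=0}^k ψ^{(m)}(λ) (-λ)^m / m! · p_{k-m}`. -/
def shiftOperator (ψ : ℝ → ℝ) (lam : ℝ) (p : ℕ → ℝ) (k : ℕ) : ℝ :=
  ∑ m ∈ Finset.range (k + 1),
    iteratedDeriv m ψ lam * (-lam) ^ m / (m.factorial : ℝ) * p (k - m)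

section Processes

variable {Ω : Type*} [MeasurableSpace Ω]

/-- A (possibly killed) subordinator: a nondecreasing right-continuous process started from `0`
with values in `[0, ∞]`, where `∞` is the cemetery state, such that, on the event that the process
is still alive at time `s`, the increment over `[s, s + t]` is independent of the past up to time
`s` and distributed as `X_t`. If `X` is finite, this is a nondecreasing Lévy process. -/
structure IsSubordinator (X : ℝ≥0 → Ω → ℝ≥0∞) (P : Measure Ω) : Prop where
  measurable : ∀ t, Measurable (X t)
  zero : ∀ᵐ ω ∂P, X 0 ω = 0
  mono : ∀ᵐ ω ∂P, Monotone (fun t => X t ω)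
  rightCont : ∀ᵐ ω ∂P, ∀ t, ContinuousWithinAt (fun s => X s ω) (Ici t) t
  increments : ∀ (s t : ℝ≥0) (A : Set Ω) (B : Set ℝ≥0∞),
    MeasurableSet[⨆ u : Iic s, MeasurableSpace.comap (X u) inferInstance] A → MeasurableSet B →
      P (A ∩ {ω | X s ω < ∞} ∩ {ω | X (s + t) ω - X s ω ∈ B}) =
        P (A ∩ {ω | X s ω < ∞}) * P {ω | X t ω ∈ B}

/-- `X` has Laplace exponent `φ`: `E e^{-x X_t} = e^{-t φ(x)}` for `x > 0`, with `e^{-∞} = 0`. -/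
def HasLaplaceExponent (X : ℝ≥0 → Ω → ℝ≥0∞) (φ : ℝ → ℝ) (P : Measure Ω) : Prop :=
  ∀ (t : ℝ≥0) (x : ℝ), 0 < x →
    ∫ ω in {ω | X t ω < ∞}, Real.exp (-(x * (X t ω).toReal)) ∂P = Real.exp (-(t * φ x))

/-- A Poisson process with intensity `lam`. Paths are nondecreasing, so that the truncated
subtraction of natural numbers gives the increments. -/
structure IsPoissonProcess (N : ℝ≥0 → Ω → ℕ) (lam : ℝ≥0) (P : Measure Ω) : Prop where
  measurable : ∀ t, Measurable (N t)
  zero : ∀ᵐ ω ∂P, N 0 ω = 0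
  mono : ∀ᵐ ω ∂P, Monotone (fun t => N t ω)
  rightCont : ∀ᵐ ω ∂P, ∀ t, ContinuousWithinAt (fun s => N s ω) (Ici t) t
  indep : HasIndepIncrements N P
  law : ∀ s t : ℝ≥0, s ≤ t →
    P.map (fun ω => N t ω - N s ω) = poissonMeasure (lam * (t - s))

/-- The inverse `Y(t) = inf {s ≥ 0 : X(s) > t}`, for `t ≥ 0`, with `inf ∅ = ∞`. -/
def inverseProcess (X : ℝ≥0 → Ω → ℝ≥0∞) (t : ℝ) (ω : Ω) : ℝ≥0∞ :=
  ⨅ (s : ℝ≥0) (_ : ENNReal.ofReal t < X s ω), (s : ℝ≥0∞)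

/-- The law of `Y(t)`, the inverse of `X`, on the real line. -/
def inverseLaw (X : ℝ≥0 → Ω → ℝ≥0∞) (P : Measure Ω) (t : ℝ) : Measure ℝ :=
  P.map (fun ω => (inverseProcess X t ω).toReal)

/-- The density `ℓ(t, x) = P(Y(t) ∈ dx) / dx` of the inverse of `X`. -/
def inverseDensity (X : ℝ≥0 → Ω → ℝ≥0∞) (P : Measure Ω) (t x : ℝ) : ℝ :=
  ((inverseLaw X P t).rnDeriv volume x).toReal

/-- The space Laplace transform `ℓ̃(t, μ) = ∫_0^∞ e^{-μ x} ℓ(t, x) dx`. -/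
def inverseDensityLaplace (X : ℝ≥0 → Ω → ℝ≥0∞) (P : Measure Ω) (t μ : ℝ) : ℝ :=
  ∫ x in Ioi (0 : ℝ), Real.exp (-(μ * x)) * inverseDensity X P t x

/-- `p_k(t) = P(N(∑_j H_j(Y(t))) = k)`, where `Y` is the inverse of `X`; the event includes that
`Y(t)` and `∑_j H_j(Y(t))` are finite. -/
def timeChangedProb {n : ℕ} (N : ℝ≥0 → Ω → ℕ) (H : Fin n → ℝ≥0 → Ω → ℝ≥0∞)
    (X : ℝ≥0 → Ω → ℝ≥0∞) (P : Measure Ω) (k : ℕ) (t : ℝ) : ℝ :=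
  P.real {ω | ∃ y s : ℝ≥0,
    inverseProcess X t ω = y ∧ ∑ j, H j y ω = s ∧ N s ω = k}

end Processes

end

/-! Write κ_x for the law of H^f(x) on survival, η_t for the law of Y^f(t), ψ = ∑ ψ_j, and π_k(y)
for the probability that N, taken at the independent time ∑ H^{ψ_j}(y), equals k. Two facts drive
everything: the duality η_t(x, ∞) = κ_x[0, t], and the uniqueness of Laplace transforms
(`ext_of_laplace`).

Absolute continuity and part (1). Let α be κ_x with its drift removed. Differentiating its transform
gives z α(dz) = x (α ∗ r ν̄(dr)), so α inherits absolute continuity from ν̄ off 0; it has no atom at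
0 because ν̄ is infinite (`LevyTriple.absolutelyContinuous_of_laplace_jumpExponent`). At an
exponential time of rate σ the inverse is exponential of rate f(σ) (`IsInverseLaw.bind_exp_eq`), so
a null set is charged by η_t for almost no t. The Markov property (`IsInverseLaw.restrict_Ioi_eq`)
averages η_{t-z} over κ_δ(dz) and so removes the exceptional times. A Poisson process at an
independent time has probabilities given by the derivatives of the transform of that time
(`integral_poissonWeight`), and here this transform is that of η_t evaluated at ψ.

Governing equation. For a weight 0 ≤ χ ≤ 1 let U = ∫ χ(x) κ_x dx. The transform in t of ∫ χ dη_t is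
f(σ)/σ times that of U, and f(σ)/σ is b plus the transform of the tail ν. Hence the density u of U
satisfies b u + ν ∗ u = ∫ χ dη_t for almost every t (`IsInverseLaw.ae_eq`).
`IsInverseLaw.exists_density` gives it at every t > 0: without drift by the Markov property again;
with drift because U ≤ volume / b makes ν ∗ u continuous, so that the equation itself defines a
continuous version of u.

On the other side the Leibniz rule gives π_k' = -∑ c_m π_{k-m} with c_m = ψ^{(m)}(λ) (-λ)^m / m!.
Integrating over [0, Y^f(t)] and averaging, p_k(t) = π_k(0) - ∑ c_m U_{k-m}[0, t], where U_i is the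
potential with weight π_i. So p_k is absolutely continuous with derivative -∑ c_m u_{k-m} almost
everywhere, and the convolution equation for each u_{k-m} yields 𝒟^f p_k = -∑ c_m p_{k-m}
(`IsInverseLaw.cdDeriv_eq`). -/

/-! ### Laplace transforms of measures on the line and their uniqueness. -/

/-- The Laplace transform `∫ e^{-sz} α(dz)` of a measure on the real line. -/
noncomputable def laplace (α : Measure ℝ) (s : ℝ) : ℝ≥0∞ :=
  ∫⁻ z, ENNReal.ofReal (Real.exp (-(s * z))) ∂α

theorem measurable_ofReal_exp (s : ℝ) :
    Measurable (fun z : ℝ => ENNReal.ofReal (Real.exp (-(s * z)))) := by fun_prop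

/-- Tilting by e^{-z} makes the measure finite and shifts the domain of its moment generating
function so that 0 becomes an interior point; the complex transform is then analytic across the
imaginary axis. -/
theorem mgf_id_withDensity_exp {α : Measure ℝ} (hfin : ∀ s > 0, laplace α s ≠ ∞) {t : ℝ}
    (ht : t < 1) :
    Integrable (fun z => Real.exp (t * z))
      (α.withDensity fun z => ENNReal.ofReal (Real.exp (-(1 * z)))) ∧
    mgf id (α.withDensity fun z => ENNReal.ofReal (Real.exp (-(1 * z)))) t =
      (laplace α (1 - t)).toReal := by
  have key : ∫⁻ z, ENNReal.ofReal (Real.exp (t * z))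
      ∂(α.withDensity fun z => ENNReal.ofReal (Real.exp (-(1 * z)))) = laplace α (1 - t) := by
    rw [lintegral_withDensity_eq_lintegral_mul _ (measurable_ofReal_exp 1) (by fun_prop), laplace]
    refine lintegral_congr fun z => ?_
    rw [Pi.mul_apply, ← ENNReal.ofReal_mul (Real.exp_pos _).le, ← Real.exp_add]
    ring_nf
  constructor
  · refine ⟨by fun_prop, ?_⟩
    rw [hasFiniteIntegral_iff_ofReal (ae_of_all _ fun _ => (Real.exp_pos _).le), key]
    exact (hfin _ (by linarith)).lt_top
  · rw [mgf, integral_eq_lintegral_of_nonneg_ae (ae_of_all _ fun _ => (Real.exp_pos _).le)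
      (by fun_prop)]
    simp only [id]
    rw [key]

/-- A measure on the line is determined by its Laplace transform on `(0, ∞)`. -/
theorem ext_of_laplace {α β : Measure ℝ} (hfin : ∀ s > 0, laplace α s ≠ ∞)
    (h : ∀ s > 0, laplace α s = laplace β s) : α = β := by
  have hfin' : ∀ s > 0, laplace β s ≠ ∞ := fun s hs => h s hs ▸ hfin s hs
  set w : ℝ → ℝ≥0∞ := fun z => ENNReal.ofReal (Real.exp (-(1 * z))) with hw
  have hwm : Measurable w := measurable_ofReal_exp 1
  suffices H : α.withDensity w = β.withDensity w by
    have hinv : ∀ γ : Measure ℝ, (γ.withDensity w).withDensity w⁻¹ = γ := fun γ =>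
      withDensity_inv_same hwm (ae_of_all _ fun z => by simp [hw, Real.exp_pos])
        (ae_of_all _ fun z => by simp [hw])
    rw [← hinv α, H, hinv β]
  have : IsFiniteMeasure (α.withDensity w) := isFiniteMeasure_withDensity (hfin 1 one_pos)
  have : IsFiniteMeasure (β.withDensity w) := isFiniteMeasure_withDensity (hfin' 1 one_pos)
  have hint : ∀ γ : Measure ℝ, (∀ s > 0, laplace γ s ≠ ∞) → {z : ℂ | z.re < 1} ⊆
      {z | z.re ∈ interior (integrableExpSet id (γ.withDensity w))} := by
    intro γ hγ z hz
    refine mem_interior.2 ⟨Iio 1, fun t ht => ?_, isOpen_Iio, hz⟩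
    exact (mgf_id_withDensity_exp hγ ht).1
  -- Identity theorem on a half-plane: the two analytic transforms agree at real points accumulating
  -- at 0. The half-plane contains the imaginary axis, so the characteristic functions coincide.
  have hE : EqOn (complexMGF id (α.withDensity w)) (complexMGF id (β.withDensity w))
      {z : ℂ | z.re < 1} := by
    refine AnalyticOnNhd.eqOn_of_preconnected_of_frequently_eq
      (analyticOnNhd_complexMGF.mono (hint α hfin)) (analyticOnNhd_complexMGF.mono (hint β hfin'))
      (convex_halfSpace_re_lt 1).isPreconnected (z₀ := 0) (by simp) ?_
    have hreal : ∃ᶠ x : ℝ in nhdsWithin 0 {0}ᶜ,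
        complexMGF id (α.withDensity w) x = complexMGF id (β.withDensity w) x := by
      refine Filter.Eventually.frequently ?_
      filter_upwards [nhdsWithin_le_nhds (Iio_mem_nhds (zero_lt_one' ℝ))] with x hx
      rw [complexMGF_ofReal, complexMGF_ofReal, (mgf_id_withDensity_exp hfin hx).2,
        (mgf_id_withDensity_exp hfin' hx).2, h _ (by linarith [mem_Iio.1 hx])]
    rw [Filter.frequently_iff_seq_forall] at hreal ⊢
    obtain ⟨xs, hx, hxe⟩ := hreal
    refine ⟨fun n => xs n, ?_, fun n => by simp [hxe]⟩
    rw [tendsto_nhdsWithin_iff] at hx ⊢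
    refine ⟨?_, by simpa using hx.2⟩
    exact_mod_cast (Complex.continuous_ofReal.tendsto 0).comp hx.1
  refine Measure.ext_of_charFun ?_
  ext t
  rw [← complexMGF_id_mul_I, ← complexMGF_id_mul_I]
  exact hE (by simp)

theorem laplace_conv {α β : Measure ℝ} [SFinite β] (s : ℝ) :
    laplace (α ∗ β) s = laplace α s * laplace β s := by
  rw [laplace, Measure.lintegral_conv (measurable_ofReal_exp s)]
  simp_rw [mul_add, neg_add, Real.exp_add, ENNReal.ofReal_mul (Real.exp_pos _).le]
  simp_rw [lintegral_const_mul _ (measurable_ofReal_exp s)]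
  rw [lintegral_mul_const _ (measurable_ofReal_exp s)]
  rfl

/-! ### Bernstein functions, tails and Lévy measures. -/

namespace LevyTriple

variable (F : LevyTriple)

theorem levy_Ioi_lt_top {s : ℝ} (hs : 0 < s) : F.levy (Ioi s) < ∞ := by
  have h0 : 0 < ENNReal.ofReal (min s 1) := by simpa using hs
  have h : ENNReal.ofReal (min s 1) * F.levy (Ioi s) < ∞ := by
    refine lt_of_le_of_lt ?_ F.lintegral_min_lt_top
    rw [← setLIntegral_const]
    refine (setLIntegral_mono' measurableSet_Ioi fun x hx => ?_).trans
      (setLIntegral_le_lintegral _ _)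
    exact ENNReal.ofReal_le_ofReal (min_le_min_right _ (mem_Ioi.1 hx).le)
  exact ENNReal.lt_top_of_mul_ne_top_right h.ne h0.ne'

instance : SigmaFinite F.levy := by
  refine ⟨⟨⟨fun n => Iic 0 ∪ Ioi (1 / ((n : ℝ) + 1)), fun _ => trivial, fun n => ?_, ?_⟩⟩⟩
  · refine (measure_union_le _ _).trans_lt ?_
    rw [F.levy_Iic, zero_add]
    exact F.levy_Ioi_lt_top (by positivity)
  · refine eq_univ_of_forall fun x => mem_iUnion.2 ?_
    rcases le_or_gt x 0 with hx | hx
    · exact ⟨0, Or.inl hx⟩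
    · obtain ⟨n, hn⟩ := exists_nat_one_div_lt hx
      exact ⟨n, Or.inr hn⟩

theorem ae_pos : ∀ᵐ s ∂F.levy, 0 < s := by
  rw [ae_iff]
  simpa [not_lt, Iic_def] using F.levy_Iic

theorem levy_restrict_Ioi_zero : F.levy.restrict (Ioi 0) = F.levy :=
  Measure.restrict_eq_self_of_ae_mem F.ae_pos

/-- The tail as a function with values in `[0, ∞]`, extended by zero to `(-∞, 0]`. -/
noncomputable def etail (t : ℝ) : ℝ≥0∞ := (Ioi (0 : ℝ)).indicator (fun t => F.a + F.levy (Ioi t)) t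

theorem measurable_levy_Ioi : Measurable fun t => F.levy (Ioi t) :=
  Antitone.measurable fun _ _ h => measure_mono (Ioi_subset_Ioi h)

theorem measurable_etail : Measurable F.etail :=
  (measurable_const.add F.measurable_levy_Ioi).indicator measurableSet_Ioi

theorem etail_of_pos {t : ℝ} (ht : 0 < t) : F.etail t = F.a + F.levy (Ioi t) :=
  indicator_of_mem (mem_Ioi.2 ht) _

theorem etail_of_nonpos {t : ℝ} (ht : t ≤ 0) : F.etail t = 0 :=
  indicator_of_notMem (by simpa using ht) _

theorem toReal_etail {t : ℝ} (ht : 0 < t) : (F.etail t).toReal = F.tail t := by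
  rw [F.etail_of_pos ht, ENNReal.toReal_add ENNReal.coe_ne_top (F.levy_Ioi_lt_top ht).ne, tail,
    ENNReal.coe_toReal]

theorem antitoneOn_tail : AntitoneOn F.tail (Ioi 0) := by
  intro _ hx _ _ hxy
  unfold tail
  gcongr
  exact (F.levy_Ioi_lt_top hx).ne

/-- The part of the Bernstein function coming from the jumps. -/
noncomputable def jumpExponent (x : ℝ) : ℝ := ∫ s in Ioi (0 : ℝ), (1 - Real.exp (-(x * s))) ∂F.levy

theorem bernstein_eq (x : ℝ) : F.bernstein x = F.a + F.b * x + F.jumpExponent x := rfl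

theorem one_sub_exp_le {x s : ℝ} (hs : 0 ≤ s) :
    1 - Real.exp (-(x * s)) ≤ max x 1 * min s 1 := by
  have h1 := Real.add_one_le_exp (-(x * s))
  have h2 := Real.exp_pos (-(x * s))
  rcases le_total s 1 with h | h
  · rw [min_eq_left h]
    nlinarith [le_max_left x 1]
  · rw [min_eq_right h]
    linarith [le_max_right x 1]

theorem one_sub_exp_nonneg {x s : ℝ} (hx : 0 ≤ x) (hs : 0 ≤ s) :
    0 ≤ 1 - Real.exp (-(x * s)) := by
  have : Real.exp (-(x * s)) ≤ 1 := Real.exp_le_one_iff.2 (by nlinarith)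
  linarith

theorem integrable_min : Integrable (fun s => min s 1) F.levy := by
  refine ⟨by fun_prop, ?_⟩
  rw [hasFiniteIntegral_iff_ofReal]
  · exact F.lintegral_min_lt_top
  · filter_upwards [F.ae_pos] with s hs
    exact le_min hs.le zero_le_one

theorem integrable_one_sub_exp {x : ℝ} (hx : 0 ≤ x) :
    Integrable (fun s => 1 - Real.exp (-(x * s))) F.levy := by
  refine (F.integrable_min.const_mul (max x 1)).mono' (by fun_prop) ?_
  filter_upwards [F.ae_pos] with s hs
  rw [Real.norm_of_nonneg (one_sub_exp_nonneg hx hs.le)]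
  exact one_sub_exp_le hs.le

theorem jumpExponent_nonneg {x : ℝ} (hx : 0 ≤ x) : 0 ≤ F.jumpExponent x :=
  setIntegral_nonneg measurableSet_Ioi fun _ hs => one_sub_exp_nonneg hx (mem_Ioi.1 hs).le

theorem ofReal_jumpExponent {x : ℝ} (hx : 0 ≤ x) : ENNReal.ofReal (F.jumpExponent x) =
    ∫⁻ s, ENNReal.ofReal (1 - Real.exp (-(x * s))) ∂F.levy := by
  rw [jumpExponent, levy_restrict_Ioi_zero,
    ofReal_integral_eq_lintegral_ofReal (F.integrable_one_sub_exp hx)]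
  filter_upwards [F.ae_pos] with s hs using one_sub_exp_nonneg hx hs.le

theorem bernstein_nonneg {x : ℝ} (hx : 0 ≤ x) : 0 ≤ F.bernstein x := by
  have := F.jumpExponent_nonneg hx
  rw [bernstein_eq]; positivity

theorem jumpExponent_le_bernstein {x : ℝ} (hx : 0 ≤ x) : F.jumpExponent x ≤ F.bernstein x := by
  rw [bernstein_eq]
  have : 0 ≤ (F.a : ℝ) + F.b * x := by positivity
  linarith

/-- Along the integers the integrand increases to 1 on (0, ∞), so monotone convergence gives the
total mass of the Lévy measure, which is infinite; monotonicity in x covers the remaining arguments.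
-/
theorem tendsto_jumpExponent (hF : F.levy (Ioi 0) = ∞) :
    Filter.Tendsto F.jumpExponent Filter.atTop Filter.atTop := by
  have h : Filter.Tendsto (fun n : ℕ => ENNReal.ofReal (F.jumpExponent n)) Filter.atTop
      (nhds ∞) := by
    simp_rw [F.ofReal_jumpExponent (Nat.cast_nonneg _)]
    have := lintegral_tendsto_of_tendsto_of_monotone (μ := F.levy)
      (f := fun (n : ℕ) s => ENNReal.ofReal (1 - Real.exp (-((n : ℝ) * s)))) (F := fun _ => 1)
      (fun n => by fun_prop) ?_ ?_
    · rwa [lintegral_one, ← F.levy_restrict_Ioi_zero, Measure.restrict_apply_univ, hF,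
        F.levy_restrict_Ioi_zero] at this
    · filter_upwards [F.ae_pos] with s hs n m hnm
      have : (n : ℝ) ≤ m := Nat.cast_le.2 hnm
      dsimp only
      gcongr
    · filter_upwards [F.ae_pos] with s hs
      rw [← ENNReal.ofReal_one]
      refine ENNReal.tendsto_ofReal ?_
      have h1 : Filter.Tendsto (fun n : ℕ => (n : ℝ) * s) Filter.atTop Filter.atTop :=
        tendsto_natCast_atTop_atTop.atTop_mul_const hs
      simpa using (Real.tendsto_exp_neg_atTop_nhds_zero.comp h1).const_sub 1
  have hmono : MonotoneOn F.jumpExponent (Ici 0) := by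
    intro x hx y hy hxy
    unfold jumpExponent
    refine setIntegral_mono_on ?_ ?_ measurableSet_Ioi fun s hs => ?_
    · exact (F.integrable_one_sub_exp hx).integrableOn
    · exact (F.integrable_one_sub_exp hy).integrableOn
    · have := (mem_Ioi.1 hs).le
      gcongr
  rw [Filter.tendsto_atTop]
  intro c
  have h2 := (ENNReal.tendsto_nhds_top_iff_nnreal.1 h) c.toNNReal
  obtain ⟨n, hn⟩ := h2.exists
  filter_upwards [Filter.eventually_ge_atTop (n : ℝ)] with x hx
  have h3 := hmono (mem_Ici.2 (Nat.cast_nonneg n)) (mem_Ici.2 ((Nat.cast_nonneg n).trans hx)) hx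
  refine le_trans ?_ h3
  have h4 := ENNReal.toReal_mono ENNReal.ofReal_ne_top hn.le
  rw [ENNReal.toReal_ofReal (F.jumpExponent_nonneg (Nat.cast_nonneg _)), ENNReal.coe_toReal] at h4
  exact (Real.le_coe_toNNReal c).trans h4

theorem jumpExponent_pos (hF : F.levy (Ioi 0) = ∞) {x : ℝ} (hx : 0 < x) :
    0 < F.jumpExponent x := by
  refine lt_of_le_of_ne (F.jumpExponent_nonneg hx.le) fun h => ?_
  have h1 := F.ofReal_jumpExponent hx.le
  rw [← h, ENNReal.ofReal_zero, eq_comm, lintegral_eq_zero_iff (by fun_prop)] at h1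
  have h2 : ∀ᵐ s ∂F.levy, False := by
    filter_upwards [h1, F.ae_pos] with s h3 hs
    simp only [Pi.zero_apply, ENNReal.ofReal_eq_zero, tsub_le_iff_right, zero_add,
      Real.one_le_exp_iff] at h3
    nlinarith [mul_pos hx hs]
  have h3 : F.levy = 0 := by simpa using h2
  simp [h3] at hF

theorem bernstein_pos (hF : F.levy (Ioi 0) = ∞) {x : ℝ} (hx : 0 < x) : 0 < F.bernstein x :=
  (F.jumpExponent_pos hF hx).trans_le (F.jumpExponent_le_bernstein hx.le)

theorem hasDerivAt_exp_neg_mul (σ t : ℝ) :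
    HasDerivAt (fun t => Real.exp (-(σ * t))) (-(σ * Real.exp (-(σ * t)))) t := by
  have h : HasDerivAt (fun t => -(σ * t)) (-(σ * 1)) t := ((hasDerivAt_id t).const_mul σ).neg
  exact h.exp.congr_deriv (by ring)

theorem lintegral_exp_Ioo {σ r : ℝ} (hσ : 0 < σ) (hr : 0 < r) :
    ∫⁻ t in Ioo 0 r, ENNReal.ofReal (Real.exp (-(σ * t))) =
      ENNReal.ofReal ((1 - Real.exp (-(σ * r))) / σ) := by
  rw [setLIntegral_congr Ioo_ae_eq_Ioc, ← ofReal_integral_eq_lintegral_ofReal,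
    ← intervalIntegral.integral_of_le hr.le]
  · congr 1
    have h : ∀ t ∈ uIcc 0 r, HasDerivAt (fun t => -(Real.exp (-(σ * t)) / σ))
        (Real.exp (-(σ * t))) t := by
      intro t _
      refine ((hasDerivAt_exp_neg_mul σ t).div_const σ).neg.congr_deriv ?_
      field_simp
    rw [intervalIntegral.integral_eq_sub_of_hasDerivAt h
      (Continuous.intervalIntegrable (by fun_prop) _ _)]
    simp only [mul_zero, neg_zero, Real.exp_zero]
    ring
  · exact (Continuous.intervalIntegrable (by fun_prop) 0 r).1
  · exact ae_of_all _ fun _ => (Real.exp_pos _).le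

theorem lintegral_exp_Ioi_zero {σ : ℝ} (hσ : 0 < σ) :
    ∫⁻ t in Ioi 0, ENNReal.ofReal (Real.exp (-(σ * t))) = ENNReal.ofReal (1 / σ) := by
  have h := integrableOn_exp_mul_Ioi (a := -σ) (by linarith) 0
  have h2 := integral_exp_mul_Ioi (a := -σ) (by linarith) 0
  simp_rw [neg_mul] at h h2
  rw [← ofReal_integral_eq_lintegral_ofReal h (ae_of_all _ fun _ => (Real.exp_pos _).le), h2]
  simp

/-- The Laplace transform of the tail is `(f(σ) - b σ) / σ`. -/
theorem laplace_etail {σ : ℝ} (hσ : 0 < σ) :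
    laplace (volume.withDensity F.etail) σ = ENNReal.ofReal ((F.a + F.jumpExponent σ) / σ) := by
  have hm := measurable_ofReal_exp σ
  rw [laplace, lintegral_withDensity_eq_lintegral_mul _ F.measurable_etail hm]
  have h1 : ∀ t, (F.etail * fun z => ENNReal.ofReal (Real.exp (-(σ * z)))) t =
      (Ioi (0 : ℝ)).indicator (fun t => F.a * ENNReal.ofReal (Real.exp (-(σ * t))) +
        ∫⁻ r, (Ioi t).indicator (fun _ => ENNReal.ofReal (Real.exp (-(σ * t)))) r ∂F.levy) t := by
    intro t
    rcases le_or_gt t 0 with ht | ht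
    · simp [F.etail_of_nonpos ht, ht]
    · rw [indicator_of_mem (mem_Ioi.2 ht), Pi.mul_apply, F.etail_of_pos ht,
        lintegral_indicator_const measurableSet_Ioi, add_mul, mul_comm (F.levy _)]
  simp_rw [h1]
  -- Fubini: the tail at t counts the jumps r > t, and integrating e^{-σt} over 0 < t < r leaves (1
  -- - e^{-σr})/σ.
  rw [lintegral_indicator measurableSet_Ioi, lintegral_add_left (hm.const_mul _),
    lintegral_const_mul _ hm, lintegral_exp_Ioi_zero hσ, lintegral_lintegral_swap]
  · have h2 : ∀ᵐ r ∂F.levy, ∫⁻ t in Ioi (0 : ℝ),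
        (Ioi t).indicator (fun _ => ENNReal.ofReal (Real.exp (-(σ * t)))) r =
        ENNReal.ofReal (1 / σ) * ENNReal.ofReal (1 - Real.exp (-(σ * r))) := by
      filter_upwards [F.ae_pos] with r hr
      have h3 : (fun t => (Ioi t).indicator (fun _ => ENNReal.ofReal (Real.exp (-(σ * t)))) r) =
          (Iio r).indicator (fun t => ENNReal.ofReal (Real.exp (-(σ * t)))) := by
        ext t
        simp [indicator]
      rw [h3, setLIntegral_indicator measurableSet_Iio, Iio_inter_Ioi, lintegral_exp_Ioo hσ hr,
        ← ENNReal.ofReal_mul (by positivity)]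
      congr 1
      ring
    rw [lintegral_congr_ae h2, lintegral_const_mul _ (by fun_prop), ← F.ofReal_jumpExponent hσ.le,
      mul_comm (F.a : ℝ≥0∞), ← mul_add, add_div,
      show (F.a : ℝ≥0∞) = ENNReal.ofReal F.a from (ENNReal.ofReal_coe_nnreal).symm,
      ← ENNReal.ofReal_add F.a.coe_nonneg (F.jumpExponent_nonneg hσ.le),
      ← ENNReal.ofReal_mul (by positivity)]
    congr 1
    ring
  · refine Measurable.aemeasurable ?_
    have : Function.uncurry (fun t r : ℝ => (Ioi t).indicator
        (fun _ => ENNReal.ofReal (Real.exp (-(σ * t)))) r) =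
        {p : ℝ × ℝ | p.1 < p.2}.indicator fun p => ENNReal.ofReal (Real.exp (-(σ * p.1))) := by
      ext p
      simp [indicator, Function.uncurry]
    rw [this]
    exact (hm.comp measurable_fst).indicator (measurableSet_lt measurable_fst measurable_snd)

/-- On compact intervals of (0, ∞) the tail is the integral of its derivative, so the Lévy measure
and the measure with density -ν' agree on half-open intervals. Both are finite on (x, ∞) for x > 0,
hence agree there, and these half-lines exhaust (0, ∞). -/
theorem levy_absolutelyContinuous (hF : F.ConditionI) : F.levy ≪ volume := by
  set ρ : ℝ → ℝ≥0∞ := fun t => ENNReal.ofReal (-deriv F.tail t) with hρ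
  have hρm : Measurable ρ := (measurable_deriv F.tail).neg.ennreal_ofReal
  have hneg : ∀ t, 0 < t → 0 ≤ -deriv F.tail t := by
    intro t ht
    rw [neg_nonneg, ← derivWithin_of_isOpen isOpen_Ioi (mem_Ioi.2 ht)]
    exact F.antitoneOn_tail.derivWithin_nonpos
  have hIoc : ∀ x y : ℝ, 0 < x → x ≤ y → F.levy (Ioc x y) = ∫⁻ t in Ioc x y, ρ t := by
    intro x y hx hxy
    have hAC := hF.2 x y hx hxy
    have h1 := hAC.integral_deriv_eq_sub
    rw [intervalIntegral.integral_of_le hxy] at h1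
    have h2 : ∫⁻ t in Ioc x y, ρ t = ENNReal.ofReal (∫ t in Ioc x y, -deriv F.tail t) :=
      (ofReal_integral_eq_lintegral_ofReal hAC.intervalIntegrable_deriv.1.neg
        ((ae_restrict_iff' measurableSet_Ioc).2
          (ae_of_all _ fun t ht => hneg t (hx.trans ht.1)))).symm
    rw [h2, integral_neg, h1]
    have hy := hx.trans_le hxy
    rw [← Ioi_sdiff_Ioi, measure_sdiff (Ioi_subset_Ioi hxy) measurableSet_Ioi.nullMeasurableSet
      (F.levy_Ioi_lt_top hy).ne, tail, tail, ← ENNReal.ofReal_toReal (F.levy_Ioi_lt_top hx).ne,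
      ← ENNReal.ofReal_toReal (F.levy_Ioi_lt_top hy).ne, ← ENNReal.ofReal_sub _ (by positivity),
      ENNReal.toReal_ofReal (by positivity), ENNReal.toReal_ofReal (by positivity)]
    congr 1
    ring
  have hres : ∀ x : ℝ, 0 < x → F.levy.restrict (Ioi x) =
      (volume.withDensity ρ).restrict (Ioi x) := by
    intro x hx
    have : IsFiniteMeasure (F.levy.restrict (Ioi x)) :=
      ⟨by simpa using F.levy_Ioi_lt_top hx⟩
    refine Measure.ext_of_Ioc _ _ fun a b _ => ?_
    rw [Measure.restrict_apply measurableSet_Ioc, Measure.restrict_apply measurableSet_Ioc,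
      Ioc_inter_Ioi]
    rcases le_total (a ⊔ x) b with h | h
    · rw [hIoc _ _ (hx.trans_le le_sup_right) h, withDensity_apply _ measurableSet_Ioc]
    · simp [Ioc_eq_empty_of_le h]
  refine Measure.AbsolutelyContinuous.mk fun E hE h0 => ?_
  have h1 : E ⊆ Iic 0 ∪ ⋃ n : ℕ, E ∩ Ioi (1 / ((n : ℝ) + 1)) := by
    intro x hx
    rcases le_or_gt x 0 with h | h
    · exact Or.inl h
    · obtain ⟨n, hn⟩ := exists_nat_one_div_lt h
      exact Or.inr (mem_iUnion.2 ⟨n, hx, hn⟩)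
  refine measure_mono_null h1 (measure_union_null F.levy_Iic (measure_iUnion_null fun n => ?_))
  rw [← Measure.restrict_apply hE, hres _ (by positivity), Measure.restrict_apply hE]
  exact measure_mono_null inter_subset_left (withDensity_absolutelyContinuous _ _ h0)

/-- The derivative of the jump part of a Bernstein function is the Laplace transform of the measure
`r ν̄(dr)`. -/
theorem hasDerivAt_jumpExponent {σ : ℝ} (hσ : 0 < σ) : ∃ d : ℝ, 0 ≤ d ∧
    HasDerivAt F.jumpExponent d σ ∧
    laplace (F.levy.withDensity ENNReal.ofReal) σ = ENNReal.ofReal d := by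
  -- Domination uniform in x > σ/2: the factor s suffices for small jumps, and e^{xs} ≥ sσ/2 bounds
  -- s e^{-xs} by 2/σ for large ones.
  have hbound : ∀ x ∈ Ioi (σ / 2), ∀ s, 0 < s → s * Real.exp (-(x * s)) ≤
      max 1 (2 / σ) * min s 1 := by
    intro x hx s hs
    have hx' : σ / 2 < x := hx
    have h1 : Real.exp (-(x * s)) ≤ 1 := Real.exp_le_one_iff.2 (by nlinarith)
    rcases le_total s 1 with h | h
    · rw [min_eq_left h]
      nlinarith [le_max_left 1 (2 / σ)]
    · rw [min_eq_right h, mul_one]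
      refine le_trans ?_ (le_max_right _ _)
      have h2 : s * (σ / 2) ≤ Real.exp (x * s) := by
        nlinarith [Real.add_one_le_exp (x * s)]
      rw [Real.exp_neg, ← div_eq_mul_inv, div_le_div_iff₀ (Real.exp_pos _) hσ]
      linarith
  have hd := hasDerivAt_integral_of_dominated_loc_of_deriv_le (μ := F.levy)
    (F := fun x s => 1 - Real.exp (-(x * s))) (F' := fun x s => s * Real.exp (-(x * s)))
    (x₀ := σ) (bound := fun s => max 1 (2 / σ) * min s 1) (s := Ioi (σ / 2))
    (Ioi_mem_nhds (by linarith)) (Filter.Eventually.of_forall fun x => by fun_prop)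
    (F.integrable_one_sub_exp hσ.le) (by fun_prop)
    (by
      filter_upwards [F.ae_pos] with s hs x hx
      rw [Real.norm_of_nonneg (by positivity)]
      exact hbound x hx s hs)
    (F.integrable_min.const_mul _)
    (ae_of_all _ fun s x _ => by
      have h : HasDerivAt (fun x => 1 - Real.exp (-(s * x))) (s * Real.exp (-(s * x))) x :=
        ((hasDerivAt_exp_neg_mul s x).const_sub 1).congr_deriv (neg_neg _)
      simpa only [mul_comm s] using h)
  refine ⟨∫ s, s * Real.exp (-(σ * s)) ∂F.levy, ?_, ?_, ?_⟩
  · refine integral_nonneg_of_ae ?_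
    filter_upwards [F.ae_pos] with s hs
    positivity
  · have h := hd.2
    unfold jumpExponent
    rwa [F.levy_restrict_Ioi_zero]
  · rw [laplace, lintegral_withDensity_eq_lintegral_mul _ (by fun_prop) (measurable_ofReal_exp σ),
      ofReal_integral_eq_lintegral_ofReal hd.1]
    · refine lintegral_congr_ae ?_
      filter_upwards [F.ae_pos] with s hs
      rw [Pi.mul_apply, ENNReal.ofReal_mul hs.le]
    · filter_upwards [F.ae_pos] with s hs
      positivity

end LevyTriple

/-! ### Absolute continuity of the driftless laws. -/

theorem integrable_exp_of_laplace {α : Measure ℝ} {s : ℝ} (h : laplace α s ≠ ∞) :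
    Integrable (fun z => Real.exp (-(s * z))) α := by
  refine ⟨by fun_prop, ?_⟩
  rw [hasFiniteIntegral_iff_ofReal (ae_of_all _ fun _ => (Real.exp_pos _).le)]
  exact h.lt_top

theorem integral_exp_eq_laplace {α : Measure ℝ} (s : ℝ) :
    ∫ z, Real.exp (-(s * z)) ∂α = (laplace α s).toReal := by
  rw [integral_eq_lintegral_of_nonneg_ae (ae_of_all _ fun _ => (Real.exp_pos _).le) (by fun_prop)]
  rfl

theorem mgf_id_neg_eq_laplace (α : Measure ℝ) (s : ℝ) : mgf id α (-s) = (laplace α s).toReal := by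
  rw [← integral_exp_eq_laplace, mgf]
  simp [neg_mul]

theorem neg_mem_interior_integrableExpSet {α : Measure ℝ} (h : ∀ s > 0, laplace α s ≠ ∞) {s : ℝ}
    (hs : 0 < s) : -s ∈ interior (integrableExpSet id α) := by
  refine mem_interior.2 ⟨Iio 0, fun t ht => ?_, isOpen_Iio, by simpa using hs⟩
  have := integrable_exp_of_laplace (h (-t) (by simpa using ht))
  simpa [integrableExpSet] using this

/-- A measure whose Laplace transform is bounded by `1` lives on `[0, ∞)`. -/
theorem measure_Iio_zero_of_laplace_le_one {α : Measure ℝ} (h : ∀ s > 0, laplace α s ≤ 1) :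
    α (Iio 0) = 0 := by
  have h1 : ∀ η : ℝ, 0 < η → α (Iio (-η)) = 0 := by
    intro η hη
    -- Mass to the left of -η would make the transform grow at least like e^{sη}.
    have h2 : ∀ s > 0, ENNReal.ofReal (Real.exp (s * η)) * α (Iio (-η)) ≤ 1 := by
      intro s hs
      refine le_trans ?_ (h s hs)
      rw [← setLIntegral_const, laplace]
      refine (setLIntegral_mono' measurableSet_Iio fun z hz => ?_).trans
        (setLIntegral_le_lintegral _ _)
      have : z < -η := hz
      refine ENNReal.ofReal_le_ofReal (Real.exp_le_exp.2 ?_)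
      nlinarith
    by_contra h0
    have h3 : Filter.Tendsto (fun s : ℝ => ENNReal.ofReal (Real.exp (s * η)) * α (Iio (-η)))
        Filter.atTop (nhds (∞ * α (Iio (-η)))) := by
      refine ENNReal.Tendsto.mul_const ?_ (Or.inl ENNReal.top_ne_zero)
      exact ENNReal.tendsto_ofReal_atTop.comp
        (Real.tendsto_exp_atTop.comp (Filter.tendsto_id.atTop_mul_const hη))
    rw [ENNReal.top_mul h0] at h3
    have h4 := le_of_tendsto h3 (Filter.eventually_atTop.2 ⟨1, fun s hs => h2 s (by linarith)⟩)
    simp at h4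
  have h2 : Iio (0 : ℝ) ⊆ ⋃ n : ℕ, Iio (-(1 / ((n : ℝ) + 1))) := by
    intro x hx
    obtain ⟨n, hn⟩ := exists_nat_one_div_lt (neg_pos.2 (mem_Iio.1 hx))
    exact mem_iUnion.2 ⟨n, by simp only [mem_Iio]; linarith⟩
  exact measure_mono_null h2 (measure_iUnion_null fun n => h1 _ (by positivity))

theorem measure_singleton_zero_le_laplace (α : Measure ℝ) (s : ℝ) : α {0} ≤ laplace α s := by
  calc α {0} = ∫⁻ z in {0}, ENNReal.ofReal (Real.exp (-(s * z))) ∂α := by simp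
    _ ≤ laplace α s := setLIntegral_le_lintegral _ _

namespace LevyTriple

variable {F : LevyTriple}

/-- The law at time `x > 0` of a subordinator without drift whose Lévy measure is infinite and
absolutely continuous is absolutely continuous. -/
theorem absolutelyContinuous_of_laplace_jumpExponent (hF : F.ConditionI) {α : Measure ℝ}
    [SFinite α] {x : ℝ} (hx : 0 < x)
    (h : ∀ s > 0, laplace α s = ENNReal.ofReal (Real.exp (-(x * (F.a + F.jumpExponent s))))) :
    α ≪ volume := by
  have hfin : ∀ s > 0, laplace α s ≠ ∞ := fun s hs => by rw [h s hs]; exact ENNReal.ofReal_ne_top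
  have hsupp : α (Iio 0) = 0 := by
    refine measure_Iio_zero_of_laplace_le_one fun s hs => ?_
    rw [h s hs, ENNReal.ofReal_le_one, Real.exp_le_one_iff, neg_nonpos]
    have := F.jumpExponent_nonneg hs.le
    positivity
  have hae : ∀ᵐ z ∂α, 0 ≤ z := by
    rw [ae_iff]; simpa [not_le, Iio_def] using hsupp
  -- The transform at every s dominates the atom at 0, and it tends to 0 because an infinite Lévy
  -- measure makes the exponent diverge.
  have hzero : α {0} = 0 := by
    have h1 : Filter.Tendsto (fun s => ENNReal.ofReal
        (Real.exp (-(x * (F.a + F.jumpExponent s))))) Filter.atTop (nhds 0) := by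
      rw [← ENNReal.ofReal_zero]
      refine ENNReal.tendsto_ofReal (Real.tendsto_exp_neg_atTop_nhds_zero.comp ?_)
      exact (Filter.tendsto_atTop_add_const_left _ _
        (F.tendsto_jumpExponent hF.1)).const_mul_atTop hx
    refine le_antisymm (ge_of_tendsto h1 ?_) (by positivity)
    filter_upwards [Filter.eventually_gt_atTop 0] with s hs
    exact (measure_singleton_zero_le_laplace α s).trans (h s hs).le
  -- Differentiating exp(-x φ(s)), φ = a + the jump exponent, produces the factor x φ'(s), and φ' is
  -- the transform of r ν̄(dr). Read backwards this is the identity z α(dz) = x (α ∗ r ν̄(dr)).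
  have hid : α.withDensity ENNReal.ofReal =
      ENNReal.ofReal x • ((α ∗ F.levy.withDensity ENNReal.ofReal) : Measure ℝ) := by
    have key : ∀ s > 0, laplace (α.withDensity ENNReal.ofReal) s =
        laplace (ENNReal.ofReal x • ((α ∗ F.levy.withDensity ENNReal.ofReal) : Measure ℝ)) s ∧
        laplace (α.withDensity ENNReal.ofReal) s ≠ ∞ := by
      intro s hs
      obtain ⟨d, hd0, hd, hdl⟩ := F.hasDerivAt_jumpExponent hs
      have hint := neg_mem_interior_integrableExpSet hfin hs
      have h1 : HasDerivAt (fun s => mgf id α (-s)) (-(∫ z, z * Real.exp (-s * z) ∂α)) s := by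
        refine ((hasDerivAt_mgf hint).comp s (hasDerivAt_neg s)).congr_deriv ?_
        simp
      have h2 : HasDerivAt (fun s => mgf id α (-s))
          (Real.exp (-(x * (F.a + F.jumpExponent s))) * -(x * d)) s := by
        have h3 : HasDerivAt (fun s => Real.exp (-(x * (F.a + F.jumpExponent s))))
          (Real.exp (-(x * (F.a + F.jumpExponent s))) * -(x * d)) s :=
          (((hd.const_add _).const_mul x).neg).exp
        refine h3.congr_of_eventuallyEq ?_
        filter_upwards [Ioi_mem_nhds hs] with r hr
        rw [mgf_id_neg_eq_laplace, h r hr, ENNReal.toReal_ofReal (Real.exp_pos _).le]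
      have h3 := h1.unique h2
      have hI : Integrable (fun z => z * Real.exp (-s * z)) α := by
        simpa using integrable_pow_mul_exp_of_mem_interior_integrableExpSet hint 1
      have h4 : laplace (α.withDensity ENNReal.ofReal) s =
          ENNReal.ofReal (∫ z, z * Real.exp (-s * z) ∂α) := by
        rw [laplace, lintegral_withDensity_eq_lintegral_mul _ (by fun_prop)
          (measurable_ofReal_exp s), ofReal_integral_eq_lintegral_ofReal hI]
        · refine lintegral_congr_ae ?_
          filter_upwards [hae] with z hz
          rw [Pi.mul_apply, ENNReal.ofReal_mul hz, neg_mul]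
        · filter_upwards [hae] with z hz
          positivity
      refine ⟨?_, by rw [h4]; exact ENNReal.ofReal_ne_top⟩
      rw [h4, laplace, lintegral_smul_measure, ← laplace, laplace_conv, h s hs, hdl,
        ← ENNReal.ofReal_mul (Real.exp_pos _).le, smul_eq_mul, ← ENNReal.ofReal_mul hx.le]
      congr 1
      linarith
    exact ext_of_laplace (fun s hs => (key s hs).2) fun s hs => (key s hs).1
  have hac : α.withDensity ENNReal.ofReal ≪ volume := by
    rw [hid]
    refine Measure.AbsolutelyContinuous.smul_left ?_ _
    exact Measure.conv_absolutelyContinuous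
      ((withDensity_absolutelyContinuous _ _).trans (F.levy_absolutelyContinuous hF))
  refine Measure.AbsolutelyContinuous.mk fun E hE h0 => ?_
  have h1 := hac h0
  rw [withDensity_apply_eq_zero ENNReal.measurable_ofReal] at h1
  -- The weight z is positive on (0, ∞), so there z α(dz) and α have the same null sets; the rest of
  -- the line is already known to be null.
  have h2 : E ⊆ Iio 0 ∪ ({0} ∪ ({z | ENNReal.ofReal z ≠ 0} ∩ E)) := by
    intro z hz
    rcases lt_trichotomy z 0 with hz0 | hz0 | hz0
    · exact Or.inl hz0
    · exact Or.inr (Or.inl hz0)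
    · exact Or.inr (Or.inr ⟨by simpa using hz0, hz⟩)
  exact measure_mono_null h2 (measure_union_null hsupp (measure_union_null hzero h1))

end LevyTriple

/-! ### Convolution semigroups of subordinator laws. -/

/-- The one-dimensional laws, on the event of survival, of a subordinator with Laplace exponent
`f`. -/
structure IsLaplaceSemigroup (κ : Kernel ℝ ℝ) (f : ℝ → ℝ) : Prop where
  measure_Iio_zero : ∀ x, κ x (Iio 0) = 0
  le_one : ∀ x, κ x univ ≤ 1
  laplace_eq : ∀ x, 0 ≤ x → ∀ s, 0 < s →
    laplace (κ x) s = ENNReal.ofReal (Real.exp (-(x * f s)))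

namespace IsLaplaceSemigroup

variable {κ : Kernel ℝ ℝ} {f : ℝ → ℝ} {F : LevyTriple}

theorem isFiniteKernel (h : IsLaplaceSemigroup κ f) : IsFiniteKernel κ :=
  ⟨⟨1, ENNReal.one_lt_top, h.le_one⟩⟩

theorem ae_nonneg (h : IsLaplaceSemigroup κ f) (x : ℝ) : ∀ᵐ z ∂κ x, 0 ≤ z := by
  rw [ae_iff]; simpa [not_le, Iio_def] using h.measure_Iio_zero x

theorem conv_eq (h : IsLaplaceSemigroup κ f) {x y : ℝ} (hx : 0 ≤ x) (hy : 0 ≤ y) :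
    κ x ∗ κ y = κ (x + y) := by
  have := h.isFiniteKernel
  have key : ∀ s > 0, laplace (κ x ∗ κ y) s = laplace (κ (x + y)) s := by
    intro s hs
    rw [laplace_conv, h.laplace_eq x hx s hs, h.laplace_eq y hy s hs,
      h.laplace_eq _ (add_nonneg hx hy) s hs, ← ENNReal.ofReal_mul (Real.exp_pos _).le,
      ← Real.exp_add]
    ring_nf
  refine ext_of_laplace (fun s hs => ?_) key
  rw [key s hs, h.laplace_eq _ (add_nonneg hx hy) s hs]
  exact ENNReal.ofReal_ne_top

/-- The drift only translates the law by b x, and translations preserve null sets, so the driftless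
case applies. -/
theorem absolutelyContinuous (h : IsLaplaceSemigroup κ F.bernstein) (hF : F.ConditionI) {x : ℝ}
    (hx : 0 < x) : κ x ≪ volume := by
  have := h.isFiniteKernel
  have h1 : (κ x).map (fun z => z - F.b * x) ≪ volume := by
    refine F.absolutelyContinuous_of_laplace_jumpExponent hF hx fun s hs => ?_
    rw [laplace, lintegral_map (measurable_ofReal_exp s) (by fun_prop)]
    have h2 : ∀ z, ENNReal.ofReal (Real.exp (-(s * (z - F.b * x)))) =
        ENNReal.ofReal (Real.exp (s * (F.b * x))) * ENNReal.ofReal (Real.exp (-(s * z))) := by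
      intro z
      rw [← ENNReal.ofReal_mul (Real.exp_pos _).le, ← Real.exp_add]
      ring_nf
    simp_rw [h2]
    rw [lintegral_const_mul _ (measurable_ofReal_exp s), ← laplace, h.laplace_eq x hx.le s hs,
      ← ENNReal.ofReal_mul (Real.exp_pos _).le, ← Real.exp_add, F.bernstein_eq]
    ring_nf
  have h2 := h1.map (f := fun z => z + F.b * x) (by fun_prop)
  rw [Measure.map_map (by fun_prop) (by fun_prop)] at h2
  have h3 : (fun z => z + F.b * x) ∘ (fun z => z - F.b * x) = id := by ext z; simp
  rwa [h3, Measure.map_id, map_add_right_eq_self] at h2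

end IsLaplaceSemigroup

/-! ### Laws of the inverse: exponential times, Markov property, absolute continuity. -/

/-- Measures concentrated on `(0, ∞)` are determined by their tails. -/
theorem ext_of_Ioi_of_measure_Iic_zero {α β : Measure ℝ} (hα : α (Iic 0) = 0) (hβ : β (Iic 0) = 0)
    (hfin : α (Ioi 0) ≠ ∞) (h : ∀ x, 0 ≤ x → α (Ioi x) = β (Ioi x)) : α = β := by
  have huniv : ∀ γ : Measure ℝ, γ (Iic 0) = 0 → γ univ = γ (Ioi 0) := by
    intro γ hγ
    rw [← Iic_union_Ioi (a := (0 : ℝ)), measure_union (Iic_disjoint_Ioi le_rfl) measurableSet_Ioi,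
      hγ, zero_add]
  have hun : α univ = β univ := by rw [huniv α hα, huniv β hβ, h 0 le_rfl]
  have hf : IsFiniteMeasure α := ⟨by rw [huniv α hα]; exact hfin.lt_top⟩
  have hf' : IsFiniteMeasure β := ⟨by rw [← hun]; exact hf.1⟩
  refine Measure.ext_of_Iic _ _ fun x => ?_
  rcases le_total 0 x with hx | hx
  · rw [← compl_Ioi, measure_compl measurableSet_Ioi (measure_ne_top _ _),
      measure_compl measurableSet_Ioi (measure_ne_top _ _), hun, h x hx]
  · rw [measure_mono_null (Iic_subset_Iic.2 hx) hα, measure_mono_null (Iic_subset_Iic.2 hx) hβ]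

theorem lintegral_exp_Ioi {σ : ℝ} (hσ : 0 < σ) (z : ℝ) :
    ∫⁻ t in Ioi z, ENNReal.ofReal (Real.exp (-(σ * t))) =
      ENNReal.ofReal (Real.exp (-(σ * z)) / σ) := by
  have h := integrableOn_exp_mul_Ioi (a := -σ) (by linarith) z
  have h2 := integral_exp_mul_Ioi (a := -σ) (by linarith) z
  simp_rw [neg_mul] at h h2
  rw [← ofReal_integral_eq_lintegral_ofReal h (ae_of_all _ fun _ => (Real.exp_pos _).le), h2,
    neg_div_neg_eq]

/-- `η t` is the law of the inverse at time `t` of a process with one-dimensional laws `κ`. -/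
structure IsInverseLaw (η κ : Kernel ℝ ℝ) : Prop where
  le_one : ∀ t, η t univ ≤ 1
  measure_Iic_zero : ∀ t, 0 < t → η t (Iic 0) = 0
  measure_Ioi : ∀ t, 0 < t → ∀ x, 0 ≤ x → η t (Ioi x) = κ x (Iic t)

namespace IsInverseLaw

variable {η κ : Kernel ℝ ℝ} {f : ℝ → ℝ} {F : LevyTriple}

theorem isFiniteKernel (h : IsInverseLaw η κ) : IsFiniteKernel η :=
  ⟨⟨1, ENNReal.one_lt_top, h.le_one⟩⟩

theorem ae_pos (h : IsInverseLaw η κ) {t : ℝ} (ht : 0 < t) : ∀ᵐ x ∂η t, 0 < x := by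
  rw [ae_iff]; simpa [not_lt, Iic_def] using h.measure_Iic_zero t ht

/-- Taken at an independent exponential time with rate `σ`, the inverse is exponentially
distributed with rate `f(σ)`. -/
theorem bind_exp_eq (h : IsInverseLaw η κ) (hκ : IsLaplaceSemigroup κ f) {σ : ℝ} (hσ : 0 < σ)
    (hf : 0 < f σ) :
    ((volume.restrict (Ioi 0)).withDensity fun t => ENNReal.ofReal (Real.exp (-(σ * t)))).bind η =
      (volume.restrict (Ioi 0)).withDensity fun x =>
        ENNReal.ofReal (f σ / σ) * ENNReal.ofReal (Real.exp (-(f σ * x))) := by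
  have := hκ.isFiniteKernel
  have hm := measurable_ofReal_exp σ
  have hA : ∀ E, MeasurableSet E →
      ((volume.restrict (Ioi 0)).withDensity fun t =>
        ENNReal.ofReal (Real.exp (-(σ * t)))).bind η E =
      ∫⁻ t in Ioi 0, ENNReal.ofReal (Real.exp (-(σ * t))) * η t E := by
    intro E hE
    rw [Measure.bind_apply hE η.measurable.aemeasurable,
      lintegral_withDensity_eq_lintegral_mul _ hm (η.measurable_coe hE)]
    rfl
  have hAI : ∀ x, 0 ≤ x → ((volume.restrict (Ioi 0)).withDensity fun t =>
        ENNReal.ofReal (Real.exp (-(σ * t)))).bind η (Ioi x) =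
        ENNReal.ofReal (Real.exp (-(f σ * x)) / σ) := by
    intro x hx
    rw [hA _ measurableSet_Ioi]
    have h1 : ∀ t ∈ Ioi (0 : ℝ), ENNReal.ofReal (Real.exp (-(σ * t))) * η t (Ioi x) =
        ∫⁻ z, (Iic t).indicator (fun _ => ENNReal.ofReal (Real.exp (-(σ * t)))) z ∂κ x := by
      intro t ht
      rw [lintegral_indicator_const measurableSet_Iic, h.measure_Ioi t ht x hx]
    -- Duality replaces η_t(x, ∞) by κ_x(-∞, t]; after Fubini the time integral over t ≥ z is
    -- e^{-σz}/σ, and the transform of κ_x at σ remains.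
    rw [setLIntegral_congr_fun measurableSet_Ioi h1, lintegral_lintegral_swap]
    · have h2 : ∀ᵐ z ∂κ x, ∫⁻ t in Ioi (0 : ℝ),
          (Iic t).indicator (fun _ => ENNReal.ofReal (Real.exp (-(σ * t)))) z =
          ENNReal.ofReal (1 / σ) * ENNReal.ofReal (Real.exp (-(σ * z))) := by
        filter_upwards [hκ.ae_nonneg x] with z hz
        have h3 : (fun t => (Iic t).indicator (fun _ => ENNReal.ofReal (Real.exp (-(σ * t)))) z) =
            (Ici z).indicator (fun t => ENNReal.ofReal (Real.exp (-(σ * t)))) := by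
          ext t
          simp [indicator]
        rw [h3, lintegral_indicator measurableSet_Ici, Measure.restrict_restrict measurableSet_Ici,
          ← ENNReal.ofReal_mul (by positivity), one_div, inv_mul_eq_div, ← lintegral_exp_Ioi hσ z]
        refine setLIntegral_congr ?_
        have h4 : (Ici z ∩ Ioi 0 : Set ℝ) =ᵐ[volume] (Ioi z ∩ Ioi 0 : Set ℝ) :=
          Ioi_ae_eq_Ici.symm.inter (ae_eq_refl _)
        rwa [Ioi_inter_Ioi, sup_eq_left.2 hz] at h4
      rw [lintegral_congr_ae h2, lintegral_const_mul _ hm, ← laplace, hκ.laplace_eq x hx σ hσ,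
        ← ENNReal.ofReal_mul (by positivity)]
      congr 1
      ring_nf
    · refine Measurable.aemeasurable ?_
      have : Function.uncurry (fun t z : ℝ => (Iic t).indicator
          (fun _ => ENNReal.ofReal (Real.exp (-(σ * t)))) z) =
          {p : ℝ × ℝ | p.2 ≤ p.1}.indicator fun p => ENNReal.ofReal (Real.exp (-(σ * p.1))) := by
        ext p
        simp [indicator, Function.uncurry]
      rw [this]
      exact (hm.comp measurable_fst).indicator (measurableSet_le measurable_snd measurable_fst)
  refine ext_of_Ioi_of_measure_Iic_zero ?_ ?_ ?_ fun x hx => ?_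
  · rw [hA _ measurableSet_Iic, setLIntegral_congr_fun (g := fun _ => 0) measurableSet_Ioi,
      lintegral_zero]
    intro t ht
    dsimp only
    rw [h.measure_Iic_zero t ht, mul_zero]
  · rw [withDensity_apply _ measurableSet_Iic, Measure.restrict_restrict measurableSet_Iic,
      inter_comm, Ioi_inter_Iic, Ioc_self, Measure.restrict_empty, lintegral_zero_measure]
  · rw [hAI 0 le_rfl]
    exact ENNReal.ofReal_ne_top
  · rw [hAI x hx, withDensity_apply _ measurableSet_Ioi, Measure.restrict_restrict measurableSet_Ioi,
      Ioi_inter_Ioi, sup_eq_left.2 hx, lintegral_const_mul _ (measurable_ofReal_exp _),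
      lintegral_exp_Ioi hf, ← ENNReal.ofReal_mul (by positivity)]
    congr 1
    field_simp

/-- `bind_exp_eq` tested against a weight. The right-hand integral is also the transform of the
weighted potential at σ, which is how the two objects get compared in `withDensity_eq`. -/
theorem lintegral_exp_mul_lintegral (h : IsInverseLaw η κ) (hκ : IsLaplaceSemigroup κ f) {σ : ℝ}
    (hσ : 0 < σ) (hf : 0 < f σ) {χ : ℝ → ℝ≥0∞} (hχ : Measurable χ) :
    ∫⁻ t in Ioi 0, ENNReal.ofReal (Real.exp (-(σ * t))) * ∫⁻ x, χ x ∂η t =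
      ENNReal.ofReal (f σ / σ) *
        ∫⁻ x in Ioi 0, χ x * ENNReal.ofReal (Real.exp (-(f σ * x))) := by
  have h1 := congrArg (fun α : Measure ℝ => ∫⁻ x, χ x ∂α) (h.bind_exp_eq hκ hσ hf)
  rw [Measure.lintegral_bind η.measurable.aemeasurable hχ.aemeasurable,
    lintegral_withDensity_eq_lintegral_mul _ (measurable_ofReal_exp σ) hχ.lintegral_kernel,
    lintegral_withDensity_eq_lintegral_mul _ ((measurable_ofReal_exp _).const_mul _) hχ] at h1
  refine h1.trans ?_
  rw [← lintegral_const_mul _ (by fun_prop)]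
  refine lintegral_congr fun x => ?_
  simp only [Pi.mul_apply]
  ring

/-- A null set is not charged by the inverse at almost every time. -/
theorem ae_measure_eq_zero (h : IsInverseLaw η κ) (hκ : IsLaplaceSemigroup κ f) (hf : 0 < f 1)
    {E : Set ℝ} (hE : MeasurableSet E) (h0 : volume E = 0) :
    ∀ᵐ t ∂(volume.restrict (Ioi (0 : ℝ))), η t E = 0 := by
  have h1 := h.lintegral_exp_mul_lintegral hκ one_pos hf (measurable_one.indicator hE)
  have h2 : ∫⁻ x in Ioi 0, E.indicator 1 x * ENNReal.ofReal (Real.exp (-(f 1 * x))) = 0 := by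
    have : (fun x => E.indicator (1 : ℝ → ℝ≥0∞) x * ENNReal.ofReal (Real.exp (-(f 1 * x)))) =
        E.indicator fun x => ENNReal.ofReal (Real.exp (-(f 1 * x))) := by
      ext x; by_cases hx : x ∈ E <;> simp [hx]
    rw [this, setLIntegral_indicator hE]
    exact setLIntegral_measure_zero _ _ (measure_mono_null inter_subset_left h0)
  rw [h2, mul_zero, lintegral_eq_zero_iff] at h1
  · filter_upwards [h1] with t ht
    simpa [lintegral_indicator_one hE, (Real.exp_pos _).not_ge] using ht
  · exact (measurable_ofReal_exp 1).mul (measurable_one.indicator hE).lintegral_kernel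

/-- The Markov property at time `δ`. -/
theorem restrict_Ioi_eq (h : IsInverseLaw η κ) (hκ : IsLaplaceSemigroup κ f)
    (hac : ∀ x, 0 < x → κ x ≪ volume) {t δ : ℝ} (ht : 0 < t) (hδ : 0 < δ) :
    (η t).restrict (Ioi δ) =
      (((κ δ).restrict (Iio t)).bind (fun z => η (t - z))).map (fun x => δ + x) := by
  have := hκ.isFiniteKernel
  have := h.isFiniteKernel
  have hm : Measurable fun z => η (t - z) := η.measurable.comp (by fun_prop)
  have hB : ∀ E, MeasurableSet E →
      (((κ δ).restrict (Iio t)).bind (fun z => η (t - z))).map (fun x => δ + x) E =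
      ∫⁻ z in Iio t, η (t - z) ((fun x => δ + x) ⁻¹' E) ∂κ δ := by
    intro E hE
    rw [Measure.map_apply (by fun_prop) hE,
      Measure.bind_apply (hE.preimage (by fun_prop)) hm.aemeasurable]
  -- For x ≥ δ the duality turns the tail into κ_x(-∞, t], and κ_x = κ_δ ∗ κ_{x-δ} conditions on the
  -- level z reached at time δ.
  have hpos : ∀ x, δ ≤ x → η t (Ioi x) =
      ∫⁻ z in Iio t, η (t - z) ((fun y => δ + y) ⁻¹' (Ioi x)) ∂κ δ := by
    intro x hx
    have h1 : ∀ z ∈ Iio t, η (t - z) ((fun y => δ + y) ⁻¹' (Ioi x)) = κ (x - δ) (Iic (t - z)) := by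
      intro z hz
      rw [← h.measure_Ioi (t - z) (sub_pos.2 hz) (x - δ) (sub_nonneg.2 hx)]
      congr 1
      ext y
      simp [sub_lt_iff_lt_add']
    rw [setLIntegral_congr_fun measurableSet_Iio h1, h.measure_Ioi t ht x (hδ.le.trans hx),
      ← add_sub_cancel δ x, ← hκ.conv_eq hδ.le (sub_nonneg.2 hx), add_sub_cancel,
      ← lintegral_indicator_one measurableSet_Iic,
      Measure.lintegral_conv (measurable_one.indicator measurableSet_Iic),
      ← lintegral_indicator measurableSet_Iio]
    refine lintegral_congr_ae ?_
    -- The convolution involves all z ≤ t but the statement only z < t; the absolute continuity of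
    -- κ_δ removes the boundary level.
    have h2 : ∀ᵐ z ∂κ δ, z ≠ t :=
      measure_mono_null (fun z hz => by simpa using hz) (hac δ hδ (Real.volume_singleton (a := t)))
    filter_upwards [h2] with z hz
    rcases lt_or_gt_of_ne hz with hz | hz
    · rw [indicator_of_mem (mem_Iio.2 hz), ← lintegral_indicator_one measurableSet_Iic]
      refine lintegral_congr fun y => ?_
      simp [indicator, le_sub_iff_add_le']
    · rw [indicator_of_notMem (by simpa using hz.le)]
      refine (lintegral_congr_ae ?_).trans lintegral_zero
      filter_upwards [hκ.ae_nonneg (x - δ)] with y hy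
      refine indicator_of_notMem ?_ _
      simp only [mem_Iic, not_le]
      linarith
  refine ext_of_Ioi_of_measure_Iic_zero ?_ ?_ ?_ fun x _ => ?_
  · rw [Measure.restrict_apply measurableSet_Iic]
    exact measure_mono_null inter_subset_left (h.measure_Iic_zero t ht)
  · rw [hB _ measurableSet_Iic, setLIntegral_congr_fun (g := fun _ => 0) measurableSet_Iio,
      lintegral_zero]
    intro z hz
    refine measure_mono_null (fun y hy => ?_) (h.measure_Iic_zero (t - z) (sub_pos.2 hz))
    simp only [mem_preimage, mem_Iic] at hy ⊢
    linarith
  · exact measure_ne_top _ _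
  · rw [Measure.restrict_apply measurableSet_Ioi, Ioi_inter_Ioi, hpos _ le_sup_right,
      hB _ measurableSet_Ioi]
    refine setLIntegral_congr_fun measurableSet_Iio fun z hz => ?_
    -- Below δ both sides keep their value at δ, since η_{t-z} lives on (0, ∞).
    rcases le_total δ x with hx | hx
    · rw [sup_eq_left.2 hx]
    · rw [sup_eq_right.2 hx]
      refine le_antisymm (measure_mono fun y hy => lt_of_le_of_lt hx hy) ?_
      refine measure_mono_ae ?_
      filter_upwards [h.ae_pos (sub_pos.2 (mem_Iio.1 hz))] with y hy _
      exact lt_add_of_pos_right δ hy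

/-- By the Markov property the part of η_t beyond δ is an average of translates of η_{t-z} over the
absolutely continuous law κ_δ(dz), so the almost-every-time statement `ae_measure_eq_zero` is enough
at the fixed time t. Then δ tends to 0. -/
theorem absolutelyContinuous (h : IsInverseLaw η κ) (hκ : IsLaplaceSemigroup κ f)
    (hac : ∀ x, 0 < x → κ x ≪ volume) (hf : 0 < f 1) {t : ℝ} (ht : 0 < t) : η t ≪ volume := by
  refine Measure.AbsolutelyContinuous.mk fun E hE h0 => ?_
  have h1 : ∀ δ, 0 < δ → η t (E ∩ Ioi δ) = 0 := by
    intro δ hδ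
    have hm : Measurable fun z => η (t - z) := η.measurable.comp (by fun_prop)
    have hE' : MeasurableSet ((fun x => δ + x) ⁻¹' E) := hE.preimage (by fun_prop)
    rw [← Measure.restrict_apply hE, h.restrict_Ioi_eq hκ hac ht hδ,
      Measure.map_apply (by fun_prop) hE, Measure.bind_apply hE' hm.aemeasurable]
    have h0' : volume ((fun x => δ + x) ⁻¹' E) = 0 := by rw [measure_preimage_add, h0]
    have h2 := h.ae_measure_eq_zero hκ hf hE' h0'
    rw [ae_restrict_iff' measurableSet_Ioi] at h2
    have h3 : ∀ᵐ z : ℝ, t - z ∈ Ioi 0 → η (t - z) ((fun x => δ + x) ⁻¹' E) = 0 :=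
      (Measure.measurePreserving_sub_left volume t).quasiMeasurePreserving.ae h2
    rw [lintegral_eq_zero_iff (hf := ?_)]
    · rw [Filter.EventuallyEq, ae_restrict_iff' measurableSet_Iio]
      filter_upwards [(hac δ hδ).ae_le h3] with z hz hzt
      exact hz (sub_pos.2 (mem_Iio.1 hzt))
    · exact (Measure.measurable_coe hE').comp hm
  have h2 : E ⊆ Iic 0 ∪ ⋃ n : ℕ, E ∩ Ioi (1 / ((n : ℝ) + 1)) := by
    intro x hx
    rcases le_or_gt x 0 with h | h
    · exact Or.inl h
    · obtain ⟨n, hn⟩ := exists_nat_one_div_lt h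
      exact Or.inr (mem_iUnion.2 ⟨n, hx, hn⟩)
  exact measure_mono_null h2 (measure_union_null (h.measure_Iic_zero t ht)
    (measure_iUnion_null fun n => h1 _ (by positivity)))

end IsInverseLaw

/-! ### Weighted potentials and the convolution equation. -/

/-- The weighted potential measure `∫_0^∞ χ(x) κ_x dx`. -/
noncomputable def potential (κ : Kernel ℝ ℝ) (χ : ℝ → ℝ≥0∞) : Measure ℝ :=
  ((volume.restrict (Ioi 0)).withDensity χ).bind κ

instance (κ : Kernel ℝ ℝ) [IsFiniteKernel κ] (χ : ℝ → ℝ≥0∞) : SFinite (potential κ χ) := by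
  unfold potential; infer_instance

theorem lintegral_potential {κ : Kernel ℝ ℝ} {χ g : ℝ → ℝ≥0∞} (hχ : Measurable χ)
    (hg : Measurable g) :
    ∫⁻ z, g z ∂potential κ χ = ∫⁻ x in Ioi 0, χ x * ∫⁻ z, g z ∂κ x := by
  rw [potential, Measure.lintegral_bind κ.measurable.aemeasurable hg.aemeasurable,
    lintegral_withDensity_eq_lintegral_mul _ hχ hg.lintegral_kernel]
  rfl

theorem potential_apply {κ : Kernel ℝ ℝ} {χ : ℝ → ℝ≥0∞} (hχ : Measurable χ) {E : Set ℝ}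
    (hE : MeasurableSet E) : potential κ χ E = ∫⁻ x in Ioi 0, χ x * κ x E := by
  rw [← lintegral_indicator_one hE, lintegral_potential hχ (measurable_one.indicator hE)]
  simp_rw [lintegral_indicator_one hE]

theorem potential_absolutelyContinuous {κ : Kernel ℝ ℝ} (hac : ∀ x, 0 < x → κ x ≪ volume)
    {χ : ℝ → ℝ≥0∞} (hχ : Measurable χ) : potential κ χ ≪ volume := by
  refine Measure.AbsolutelyContinuous.mk fun E hE h0 => ?_
  rw [potential_apply hχ hE, setLIntegral_congr_fun (g := fun _ => 0) measurableSet_Ioi,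
    lintegral_zero]
  intro x hx
  dsimp only
  rw [hac x hx h0, mul_zero]

/-- The convolution of the tail with a measure. -/
noncomputable def LevyTriple.tailConv (F : LevyTriple) (U : Measure ℝ) (t : ℝ) : ℝ≥0∞ :=
  ∫⁻ z, F.etail (t - z) ∂U

theorem LevyTriple.measurable_tailConv (F : LevyTriple) (U : Measure ℝ) [SFinite U] :
    Measurable (F.tailConv U) :=
  Measurable.lintegral_prod_right' (f := fun p : ℝ × ℝ => F.etail (p.1 - p.2))
    (F.measurable_etail.comp (by fun_prop))

theorem LevyTriple.laplace_tailConv (F : LevyTriple) (U : Measure ℝ) [SFinite U] (σ : ℝ) :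
    laplace (volume.withDensity (F.tailConv U)) σ =
      laplace (volume.withDensity F.etail) σ * laplace U σ := by
  have hm := measurable_ofReal_exp σ
  rw [laplace, laplace, laplace, lintegral_withDensity_eq_lintegral_mul _ F.measurable_etail hm,
    lintegral_withDensity_eq_lintegral_mul _ (F.measurable_tailConv U) hm,
    ← lintegral_const_mul _ hm]
  have h1 : ∀ t, (F.tailConv U * fun z => ENNReal.ofReal (Real.exp (-(σ * z)))) t =
      ∫⁻ z, F.etail (t - z) * ENNReal.ofReal (Real.exp (-(σ * t))) ∂U := by
    intro t
    have h2 : Measurable fun z => F.etail (t - z) := F.measurable_etail.comp (by fun_prop)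
    rw [lintegral_mul_const _ h2]
    rfl
  simp_rw [h1]
  rw [lintegral_lintegral_swap]
  · refine lintegral_congr fun z => ?_
    rw [← lintegral_mul_const _ (F.measurable_etail.mul hm)]
    refine Eq.trans (lintegral_congr fun t => ?_) (lintegral_sub_right_eq_self _ z)
    rw [Pi.mul_apply, mul_assoc, ← ENNReal.ofReal_mul (Real.exp_pos _).le, ← Real.exp_add]
    ring_nf
  · exact ((F.measurable_etail.comp (by fun_prop)).mul (by fun_prop)).aemeasurable

theorem laplace_add_measure (α β : Measure ℝ) (s : ℝ) :
    laplace (α + β) s = laplace α s + laplace β s := lintegral_add_measure _ _ _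

theorem laplace_smul_measure (c : ℝ≥0∞) (α : Measure ℝ) (s : ℝ) :
    laplace (c • α) s = c * laplace α s := by
  rw [laplace, lintegral_smul_measure]; rfl

namespace IsInverseLaw

variable {η κ : Kernel ℝ ℝ} {F : LevyTriple} {χ : ℝ → ℝ≥0∞}

theorem laplace_potential {f : ℝ → ℝ} (hκ : IsLaplaceSemigroup κ f) (hχ : Measurable χ)
    {σ : ℝ} (hσ : 0 < σ) : laplace (potential κ χ) σ =
      ∫⁻ x in Ioi 0, χ x * ENNReal.ofReal (Real.exp (-(f σ * x))) := by
  rw [laplace, lintegral_potential hχ (measurable_ofReal_exp σ)]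
  refine setLIntegral_congr_fun measurableSet_Ioi fun x hx => ?_
  rw [← laplace, hκ.laplace_eq x (mem_Ioi.1 hx).le σ hσ, mul_comm x]

theorem laplace_potential_ne_top {f : ℝ → ℝ} (hκ : IsLaplaceSemigroup κ f) (hχ : Measurable χ)
    (hχ1 : ∀ x, χ x ≤ 1) {σ : ℝ} (hσ : 0 < σ) (hf : 0 < f σ) :
    laplace (potential κ χ) σ ≠ ∞ := by
  rw [laplace_potential hκ hχ hσ]
  refine ne_top_of_le_ne_top ?_ (lintegral_mono fun x => mul_le_mul_left (hχ1 x) _)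
  simp_rw [one_mul]
  rw [lintegral_exp_Ioi hf]
  exact ENNReal.ofReal_ne_top

/-- Chebyshev with the exponential weight: e^{-t} times the mass of (-∞, t] is at most the transform
at 1. The potential is thus locally finite even if its total mass is infinite. -/
theorem potential_Iic_ne_top {f : ℝ → ℝ} (hκ : IsLaplaceSemigroup κ f) (hf : 0 < f 1)
    (hχ : Measurable χ) (hχ1 : ∀ x, χ x ≤ 1) (t : ℝ) : potential κ χ (Iic t) ≠ ∞ := by
  have h1 : ENNReal.ofReal (Real.exp (-(1 * t))) * potential κ χ (Iic t) ≠ ∞ := by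
    refine ne_top_of_le_ne_top (laplace_potential_ne_top hκ hχ hχ1 one_pos hf) ?_
    rw [← setLIntegral_const, laplace]
    refine (setLIntegral_mono' measurableSet_Iic fun z hz => ?_).trans
      (setLIntegral_le_lintegral _ _)
    have : z ≤ t := hz
    gcongr
  exact (ENNReal.lt_top_of_mul_ne_top_right h1 (by simp [Real.exp_pos])).ne

theorem isLocallyFiniteMeasure_potential {f : ℝ → ℝ} (hκ : IsLaplaceSemigroup κ f) (hf : 0 < f 1)
    (hχ : Measurable χ) (hχ1 : ∀ x, χ x ≤ 1) : IsLocallyFiniteMeasure (potential κ χ) :=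
  ⟨fun x => ⟨Iic (x + 1), Iic_mem_nhds (by linarith),
    (potential_Iic_ne_top hκ hf hχ hχ1 _).lt_top⟩⟩

/-- The convolution equation between the inverse and the potential, as an identity of measures in
the time variable. -/
theorem withDensity_eq (h : IsInverseLaw η κ) (hκ : IsLaplaceSemigroup κ F.bernstein)
    (hF : F.ConditionI) (hχ : Measurable χ) (hχ1 : ∀ x, χ x ≤ 1) :
    (volume.restrict (Ioi 0)).withDensity (fun t => ∫⁻ x, χ x ∂η t) =
      (F.b : ℝ≥0∞) • potential κ χ + volume.withDensity (F.tailConv (potential κ χ)) := by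
  have := hκ.isFiniteKernel
  have key : ∀ σ > 0, laplace ((volume.restrict (Ioi 0)).withDensity (fun t => ∫⁻ x, χ x ∂η t)) σ =
      ENNReal.ofReal (F.bernstein σ / σ) * laplace (potential κ χ) σ := by
    intro σ hσ
    rw [laplace_potential hκ hχ hσ,
      ← h.lintegral_exp_mul_lintegral hκ hσ (F.bernstein_pos hF.1 hσ) hχ, laplace,
      lintegral_withDensity_eq_lintegral_mul _ hχ.lintegral_kernel (measurable_ofReal_exp σ)]
    simp_rw [Pi.mul_apply, mul_comm]
  refine ext_of_laplace (fun σ hσ => ?_) fun σ hσ => ?_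
  · rw [key σ hσ]
    exact ENNReal.mul_ne_top ENNReal.ofReal_ne_top
      (laplace_potential_ne_top hκ hχ hχ1 hσ (F.bernstein_pos hF.1 hσ))
  -- The algebra behind the equation: f(σ)/σ = b + (a + jump exponent)/σ, whose last term is the
  -- transform of the tail.
  · rw [key σ hσ, laplace_add_measure, laplace_smul_measure, F.laplace_tailConv, F.laplace_etail hσ,
      ← add_mul, show (F.b : ℝ≥0∞) = ENNReal.ofReal F.b from (ENNReal.ofReal_coe_nnreal).symm,
      ← ENNReal.ofReal_add F.b.coe_nonneg
        (div_nonneg (add_nonneg F.a.coe_nonneg (F.jumpExponent_nonneg hσ.le)) hσ.le)]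
    congr 2
    rw [F.bernstein_eq]
    field_simp
    ring

/-- The convolution equation at almost every time. -/
theorem ae_eq (h : IsInverseLaw η κ) (hκ : IsLaplaceSemigroup κ F.bernstein)
    (hF : F.ConditionI) (hχ : Measurable χ) (hχ1 : ∀ x, χ x ≤ 1) :
    ∀ᵐ t, (Ioi (0 : ℝ)).indicator (fun t => ∫⁻ x, χ x ∂η t) t =
      F.b * (potential κ χ).rnDeriv volume t + F.tailConv (potential κ χ) t := by
  have := hκ.isFiniteKernel
  have h1 := h.withDensity_eq hκ hF hχ hχ1
  have h2 : (F.b : ℝ≥0∞) • potential κ χ =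
      volume.withDensity (fun t => F.b * (potential κ χ).rnDeriv volume t) := by
    have h3 := withDensity_smul (μ := (volume : Measure ℝ)) (F.b : ℝ≥0∞)
      ((potential κ χ).measurable_rnDeriv volume)
    rw [Measure.withDensity_rnDeriv_eq _ _ (potential_absolutelyContinuous
      (fun x hx => hκ.absolutelyContinuous hF hx) hχ)] at h3
    rw [← h3]
    rfl
  rw [h2, ← withDensity_add_left (by fun_prop), ← withDensity_indicator measurableSet_Ioi] at h1
  refine (withDensity_eq_iff_of_sigmaFinite (hχ.lintegral_kernel.indicator
    measurableSet_Ioi).aemeasurable ?_).1 h1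
  exact ((by fun_prop : Measurable fun t => F.b * (potential κ χ).rnDeriv volume t).add
    (F.measurable_tailConv _)).aemeasurable

theorem ae_eq_tailConv_of_drift_eq_zero (h : IsInverseLaw η κ)
    (hκ : IsLaplaceSemigroup κ F.bernstein) (hF : F.ConditionI) (hb : F.b = 0) (hχ : Measurable χ)
    (hχ1 : ∀ x, χ x ≤ 1) :
    ∀ᵐ t, t ∈ Ioi (0 : ℝ) → ∫⁻ x, χ x ∂η t = F.tailConv (potential κ χ) t := by
  filter_upwards [h.ae_eq hκ hF hχ hχ1] with t ht ht0
  rwa [indicator_of_mem ht0, hb, ENNReal.coe_zero, zero_mul, zero_add] at ht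

theorem tailConv_potential (hχ : Measurable χ) (r : ℝ) : F.tailConv (potential κ χ) r =
    ∫⁻ x in Ioi 0, χ x * ∫⁻ w, F.etail (r - w) ∂κ x :=
  lintegral_potential hχ (F.measurable_etail.comp (by fun_prop))

theorem measure_Ioi_zero_congr {α β : Measure ℝ} (h : ∀ δ, 0 < δ → α (Ioi δ) = β (Ioi δ)) :
    α (Ioi 0) = β (Ioi 0) := by
  have h1 : Ioi (0 : ℝ) = ⋃ n : ℕ, Ioi (1 / ((n : ℝ) + 1)) := by
    ext x
    refine ⟨fun hx => ?_, fun hx => ?_⟩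
    · obtain ⟨n, hn⟩ := exists_nat_one_div_lt (mem_Ioi.1 hx)
      exact mem_iUnion.2 ⟨n, hn⟩
    · obtain ⟨n, hn⟩ := mem_iUnion.1 hx
      exact lt_trans (by positivity) (mem_Ioi.1 hn)
  have hmono : Monotone fun n : ℕ => Ioi (1 / ((n : ℝ) + 1)) := by
    intro n m hnm
    refine Ioi_subset_Ioi ?_
    have : (n : ℝ) ≤ m := Nat.cast_le.2 hnm
    gcongr
  rw [h1, hmono.measure_iUnion, hmono.measure_iUnion]
  exact iSup_congr fun n => h _ (by positivity)

/-- Without drift, the convolution equation holds at every time. -/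
theorem lintegral_eq_tailConv_of_drift_eq_zero (h : IsInverseLaw η κ)
    (hκ : IsLaplaceSemigroup κ F.bernstein) (hF : F.ConditionI) (hb : F.b = 0) (hχ : Measurable χ)
    (hχ1 : ∀ x, χ x ≤ 1) {t : ℝ} (ht : 0 < t) :
    ∫⁻ x, χ x ∂η t = F.tailConv (potential κ χ) t := by
  have := hκ.isFiniteKernel
  have := h.isFiniteKernel
  have hac : ∀ x, 0 < x → κ x ≪ volume := fun x hx => hκ.absolutelyContinuous hF hx
  have hem : ∀ r : ℝ, Measurable fun w => F.etail (r - w) :=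
    fun r => F.measurable_etail.comp (by fun_prop)
  have hG : Measurable fun x => ∫⁻ v, F.etail (t - v) ∂κ x := (hem t).lintegral_kernel
  -- Beyond δ the Markov property averages over κ_δ(dz), so the almost-everywhere identity for the
  -- shifted weight χ(δ + ·) may be used at time t - z; κ_δ ∗ κ_x = κ_{δ+x} then reassembles the
  -- right-hand side.
  have key : ∀ δ, 0 < δ → ∫⁻ x in Ioi δ, χ x ∂η t =
      ∫⁻ x in Ioi δ, χ x * ∫⁻ v, F.etail (t - v) ∂κ x := by
    intro δ hδ
    have hm : Measurable fun z => η (t - z) := η.measurable.comp (by fun_prop)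
    have hχδ : Measurable fun x => χ (δ + x) := hχ.comp (by fun_prop)
    rw [h.restrict_Ioi_eq hκ hac ht hδ, lintegral_map hχ (by fun_prop),
      Measure.lintegral_bind hm.aemeasurable hχδ.aemeasurable]
    have h1 : ∀ᵐ z : ℝ, t - z ∈ Ioi 0 → ∫⁻ x, χ (δ + x) ∂η (t - z) =
        F.tailConv (potential κ fun x => χ (δ + x)) (t - z) :=
      (Measure.measurePreserving_sub_left volume t).quasiMeasurePreserving.ae
        (h.ae_eq_tailConv_of_drift_eq_zero hκ hF hb hχδ fun x => hχ1 _)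
    have h2 : ∫⁻ z in Iio t, ∫⁻ x, χ (δ + x) ∂η (t - z) ∂κ δ =
        ∫⁻ z, (∫⁻ x in Ioi 0, χ (δ + x) * ∫⁻ w, F.etail (t - z - w) ∂κ x) ∂κ δ := by
      rw [← lintegral_indicator measurableSet_Iio]
      refine lintegral_congr_ae ?_
      filter_upwards [(hac δ hδ).ae_le h1] with z hz
      rw [← tailConv_potential hχδ]
      rcases lt_or_ge z t with hzt | hzt
      · rw [indicator_of_mem (mem_Iio.2 hzt), hz (sub_pos.2 hzt)]
      · rw [indicator_of_notMem (by simpa using hzt), tailConv_potential hχδ, eq_comm]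
        refine (lintegral_congr fun x => ?_).trans lintegral_zero
        rw [(lintegral_congr_ae ?_).trans lintegral_zero, mul_zero]
        filter_upwards [hκ.ae_nonneg x] with w hw
        exact F.etail_of_nonpos (by linarith)
    have hjoint : Measurable fun p : ℝ × ℝ => ∫⁻ w, F.etail (t - p.1 - w) ∂κ p.2 :=
      Measurable.lintegral_kernel_prod_right' (κ := Kernel.prodMkLeft ℝ κ)
        (f := fun q : (ℝ × ℝ) × ℝ => F.etail (t - q.1.1 - q.2))
        (F.measurable_etail.comp (by fun_prop))
    rw [h2, lintegral_lintegral_swap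
      (((hχδ.comp measurable_snd).mul hjoint).aemeasurable)]
    have h3 : ∀ x ∈ Ioi (0 : ℝ), ∫⁻ z, χ (δ + x) * ∫⁻ w, F.etail (t - z - w) ∂κ x ∂κ δ =
        χ (δ + x) * ∫⁻ v, F.etail (t - v) ∂κ (δ + x) := by
      intro x hx
      have h0 : Measurable fun z => ∫⁻ w, F.etail (t - z - w) ∂κ x :=
        hjoint.comp (measurable_id.prodMk measurable_const)
      rw [lintegral_const_mul _ h0, ← hκ.conv_eq hδ.le (mem_Ioi.1 hx).le, Measure.lintegral_conv (hem t)]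
      simp_rw [sub_sub]
    refine (setLIntegral_congr_fun measurableSet_Ioi h3).trans ?_
    have h4 := (measurePreserving_add_left (volume : Measure ℝ) δ).setLIntegral_comp_preimage
      (measurableSet_Ioi (a := δ)) (hχ.mul hG)
    rw [preimage_const_add_Ioi, sub_self] at h4
    exact h4
  -- Let δ decrease to 0; nothing is lost because η_t charges only (0, ∞).
  have h5 := measure_Ioi_zero_congr (α := (η t).withDensity χ)
    (β := volume.withDensity fun x => χ x * ∫⁻ v, F.etail (t - v) ∂κ x) fun δ hδ => by
      rw [withDensity_apply _ measurableSet_Ioi, withDensity_apply _ measurableSet_Ioi, key δ hδ]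
  rw [withDensity_apply _ measurableSet_Ioi, withDensity_apply _ measurableSet_Ioi,
    ← tailConv_potential hχ, Measure.restrict_eq_self_of_ae_mem (s := Ioi 0) (h.ae_pos ht)] at h5
  exact h5

end IsInverseLaw

/-- Fubini over the jumps r > t - z. This form involves only increments of U over (t - r, t), which
a Lipschitz bound on U controls against the Lévy measure. -/
theorem LevyTriple.tailConv_eq (F : LevyTriple) (U : Measure ℝ) [SFinite U] (t : ℝ) :
    F.tailConv U t = F.a * U (Iio t) + ∫⁻ r, U (Ioo (t - r) t) ∂F.levy := by
  have h1 : ∀ z, F.etail (t - z) = (Iio t).indicator (fun _ => (F.a : ℝ≥0∞)) z +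
      ∫⁻ r, {p : ℝ × ℝ | p.1 < t ∧ t - p.1 < p.2}.indicator 1 (z, r) ∂F.levy := by
    intro z
    rcases lt_or_ge z t with hz | hz
    · rw [F.etail_of_pos (sub_pos.2 hz), indicator_of_mem (mem_Iio.2 hz),
        ← lintegral_indicator_one measurableSet_Ioi]
      congr 1
      refine lintegral_congr fun r => ?_
      simp [indicator, hz]
    · rw [F.etail_of_nonpos (sub_nonpos.2 hz), indicator_of_notMem (by simpa using hz)]
      simp [indicator, hz.not_gt]
  have hms : MeasurableSet {p : ℝ × ℝ | p.1 < t ∧ t - p.1 < p.2} :=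
    (measurableSet_lt measurable_fst measurable_const).inter
      (measurableSet_lt (by fun_prop) measurable_snd)
  rw [LevyTriple.tailConv]
  simp_rw [h1]
  have h2 : Measurable (Function.uncurry fun z r : ℝ =>
      {p : ℝ × ℝ | p.1 < t ∧ t - p.1 < p.2}.indicator (1 : ℝ × ℝ → ℝ≥0∞) (z, r)) :=
    measurable_one.indicator hms
  rw [lintegral_add_left (measurable_const.indicator measurableSet_Iio),
    lintegral_indicator_const measurableSet_Iio, lintegral_lintegral_swap h2.aemeasurable]
  congr 1
  refine lintegral_congr fun r => ?_
  rw [← lintegral_indicator_one measurableSet_Ioo]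
  refine lintegral_congr fun z => ?_
  simp [indicator, and_comm, sub_lt_comm]

/-! ### Densities of the potential, and the convolution equation at every time. -/

namespace IsInverseLaw

variable {η κ : Kernel ℝ ℝ} {F : LevyTriple} {χ : ℝ → ℝ≥0∞}

theorem potential_Iic_zero (hκ : IsLaplaceSemigroup κ F.bernstein) (hF : F.ConditionI)
    (hχ : Measurable χ) : potential κ χ (Iic 0) = 0 := by
  rw [← Iio_union_right]
  refine measure_union_null ?_ ?_
  rotate_left
  · exact potential_absolutelyContinuous (fun x hx => hκ.absolutelyContinuous hF hx) hχ
      (Real.volume_singleton)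
  · rw [potential_apply hχ measurableSet_Iio]
    simp [hκ.measure_Iio_zero]

/-- The density of the potential measure. -/
theorem potential_density (hκ : IsLaplaceSemigroup κ F.bernstein) (hF : F.ConditionI)
    (hχ : Measurable χ) (hχ1 : ∀ x, χ x ≤ 1) {u : ℝ → ℝ}
    (hu : u =ᵐ[volume] fun t => ((potential κ χ).rnDeriv volume t).toReal) {T : ℝ} (hT : 0 ≤ T) :
    IntervalIntegrable u volume 0 T ∧
      ∫ s in (0 : ℝ)..T, u s = (potential κ χ (Iic T)).toReal := by
  have := hκ.isFiniteKernel
  have hfin := potential_Iic_ne_top hκ (F.bernstein_pos hF.1 one_pos) hχ hχ1 T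
  have := isLocallyFiniteMeasure_potential hκ (F.bernstein_pos hF.1 one_pos) hχ hχ1
  have hac : potential κ χ ≪ volume :=
    potential_absolutelyContinuous (fun x hx => hκ.absolutelyContinuous hF hx) hχ
  have hIoc : potential κ χ (Ioc 0 T) ≠ ∞ := ne_top_of_le_ne_top hfin (measure_mono Ioc_subset_Iic_self)
  have h1 : IntegrableOn u (Ioc 0 T) volume :=
    (Measure.integrableOn_toReal_rnDeriv hIoc).congr (ae_restrict_of_ae hu.symm)
  refine ⟨(intervalIntegrable_iff_integrableOn_Ioc_of_le hT).2 h1, ?_⟩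
  rw [intervalIntegral.integral_of_le hT, integral_congr_ae (ae_restrict_of_ae hu),
    Measure.setIntegral_toReal_rnDeriv hac, measureReal_def, ← Iic_union_Ioc_eq_Iic hT,
    measure_union (Iic_disjoint_Ioc le_rfl) measurableSet_Ioc,
    potential_Iic_zero hκ hF hχ, zero_add]

/-- Substitute z = t - s; the density vanishes on (-∞, 0] and the tail is extended by zero there, so
the whole-line convolution reduces to [0, t]. Any version u of the density is allowed, in particular
a continuous one. -/
theorem tailConv_density (hκ : IsLaplaceSemigroup κ F.bernstein) (hF : F.ConditionI)
    (hχ : Measurable χ) (hχ1 : ∀ x, χ x ≤ 1) {u : ℝ → ℝ}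
    (hu : u =ᵐ[volume] fun t => ((potential κ χ).rnDeriv volume t).toReal) {t : ℝ} (ht : 0 ≤ t)
    (hfin : F.tailConv (potential κ χ) t ≠ ∞) :
    IntervalIntegrable (fun s => u (t - s) * F.tail s) volume 0 t ∧
      ∫ s in (0 : ℝ)..t, u (t - s) * F.tail s = (F.tailConv (potential κ χ) t).toReal := by
  have := hκ.isFiniteKernel
  have := isLocallyFiniteMeasure_potential hκ (F.bernstein_pos hF.1 one_pos) hχ hχ1
  have hac : potential κ χ ≪ volume :=
    potential_absolutelyContinuous (fun x hx => hκ.absolutelyContinuous hF hx) hχ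
  set U := potential κ χ with hU
  have hrm := U.measurable_rnDeriv volume
  have hem : Measurable fun z => F.etail (t - z) := F.measurable_etail.comp (by fun_prop)
  have hmp := Measure.measurePreserving_sub_left (volume : Measure ℝ) t
  have h0 : ∀ᵐ z : ℝ, z ≤ 0 → U.rnDeriv volume z = 0 := by
    have h1 : ∫⁻ z in Iic 0, U.rnDeriv volume z = 0 := by
      rw [Measure.setLIntegral_rnDeriv hac, hU, potential_Iic_zero hκ hF hχ]
    rw [lintegral_eq_zero_iff hrm, Filter.EventuallyEq, ae_restrict_iff' measurableSet_Iic] at h1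
    exact h1
  have h1 : F.tailConv U t = ∫⁻ s in Ioc 0 t, U.rnDeriv volume (t - s) * F.etail s := by
    rw [LevyTriple.tailConv, ← lintegral_rnDeriv_mul hac hem.aemeasurable,
      ← hmp.lintegral_comp (f := fun z => U.rnDeriv volume z * F.etail (t - z)) (hrm.mul hem), ← lintegral_indicator measurableSet_Ioc]
    refine lintegral_congr_ae ?_
    have h2 : ∀ᵐ s : ℝ, s ≠ t := by simp [ae_iff, measure_singleton]
    filter_upwards [hmp.quasiMeasurePreserving.ae h0] with s hs
    by_cases hs0 : s ∈ Ioc 0 t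
    · rw [indicator_of_mem hs0, sub_sub_cancel]
    · rw [indicator_of_notMem hs0, sub_sub_cancel]
      rcases le_or_gt s 0 with h | h
      · rw [F.etail_of_nonpos h, mul_zero]
      · rw [hs (by simp only [mem_Ioc, not_and, not_le] at hs0; linarith [hs0 h]), zero_mul]
  have hm : Measurable fun s => U.rnDeriv volume (t - s) * F.etail s :=
    (hrm.comp (by fun_prop)).mul F.measurable_etail
  rw [h1] at hfin ⊢
  have h2 : ∀ᵐ s ∂(volume.restrict (Ioc 0 t)),
      (U.rnDeriv volume (t - s) * F.etail s).toReal = u (t - s) * F.tail s := by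
    rw [ae_restrict_iff' measurableSet_Ioc]
    filter_upwards [hmp.quasiMeasurePreserving.ae hu] with s hs hs0
    rw [ENNReal.toReal_mul, F.toReal_etail hs0.1, hs]
  refine ⟨(intervalIntegrable_iff_integrableOn_Ioc_of_le ht).2
    ((integrable_toReal_of_lintegral_ne_top hm.aemeasurable hfin).congr h2), ?_⟩
  rw [intervalIntegral.integral_of_le ht, ← integral_congr_ae h2,
    integral_toReal hm.aemeasurable (ae_lt_top hm hfin)]

theorem continuousOn_potential_Iic (hκ : IsLaplaceSemigroup κ F.bernstein) (hF : F.ConditionI)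
    (hχ : Measurable χ) (hχ1 : ∀ x, χ x ≤ 1) :
    ContinuousOn (fun t => (potential κ χ (Iic t)).toReal) (Ioi 0) := by
  intro t ht
  refine ContinuousAt.continuousWithinAt ?_
  have ht0 : (0 : ℝ) < t := ht
  have h1 := (potential_density hκ hF hχ hχ1 (Filter.EventuallyEq.refl _ _)
    (T := t + 1) (by linarith)).1
  have h2 := intervalIntegral.continuousOn_primitive_interval'
    (h1.mono_set' (c := 0) (d := t + 1) subset_rfl) (left_mem_uIcc)
  rw [uIcc_of_le (by linarith)] at h2
  refine (h2.continuousAt (Icc_mem_nhds ht0 (by linarith))).congr ?_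
  filter_upwards [Ioi_mem_nhds ht0] with s hs
  exact (potential_density hκ hF hχ hχ1 (Filter.EventuallyEq.refl _ _) (mem_Ioi.1 hs).le).2

/-- With a drift `b > 0`, the potential measure has a density bounded by `1 / b`. -/
theorem mul_potential_le_volume (h : IsInverseLaw η κ) (hκ : IsLaplaceSemigroup κ F.bernstein)
    (hF : F.ConditionI) (hχ : Measurable χ) (hχ1 : ∀ x, χ x ≤ 1) (E : Set ℝ) :
    F.b * potential κ χ E ≤ volume E := by
  have h1 : (F.b : ℝ≥0∞) • potential κ χ ≤ volume := by
    calc (F.b : ℝ≥0∞) • potential κ χ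
        ≤ (volume.restrict (Ioi 0)).withDensity (fun t => ∫⁻ x, χ x ∂η t) := by
          rw [h.withDensity_eq hκ hF hχ hχ1]
          exact Measure.le_add_right le_rfl
      _ ≤ (volume.restrict (Ioi 0)).withDensity 1 := by
          refine withDensity_mono (ae_of_all _ fun t => ?_)
          refine (lintegral_mono hχ1).trans ?_
          rw [lintegral_one]
          exact h.le_one t
      _ ≤ volume := by
          rw [withDensity_one]
          exact Measure.restrict_le_self
  exact h1 E

/-- Short increments are bounded through the density bound 1/b, long ones by the mass up to T. The
profile min(r, 1) is exactly what a Lévy measure integrates, and a separate T keeps the constant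
uniform for t near a given point. -/
theorem potential_increment_le (h : IsInverseLaw η κ) (hκ : IsLaplaceSemigroup κ F.bernstein)
    (hF : F.ConditionI) (hb : F.b ≠ 0) (hχ : Measurable χ) (hχ1 : ∀ x, χ x ≤ 1) {s t T : ℝ}
    (hst : s ≤ t) (htT : t ≤ T) :
    0 ≤ (potential κ χ (Iic t)).toReal - (potential κ χ (Iic s)).toReal ∧
    (potential κ χ (Iic t)).toReal - (potential κ χ (Iic s)).toReal ≤
      max (1 / (F.b : ℝ)) (potential κ χ (Iic T)).toReal * min (t - s) 1 ∧
    potential κ χ (Ioo s t) = ENNReal.ofReal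
      ((potential κ χ (Iic t)).toReal - (potential κ χ (Iic s)).toReal) := by
  have hfin := fun t => potential_Iic_ne_top hκ (F.bernstein_pos hF.1 one_pos) hχ hχ1 t
  have hac : potential κ χ ≪ volume :=
    potential_absolutelyContinuous (fun x hx => hκ.absolutelyContinuous hF hx) hχ
  have h1 := ENNReal.toReal_mono (hfin t) (measure_mono (Iic_subset_Iic.2 hst))
  have h2 := ENNReal.toReal_mono (hfin T) (measure_mono (μ := potential κ χ)
    (Iic_subset_Iic.2 htT))
  have h3 : potential κ χ (Ioo s t) = ENNReal.ofReal
      ((potential κ χ (Iic t)).toReal - (potential κ χ (Iic s)).toReal) := by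
    rw [measure_congr (hac.ae_le Ioo_ae_eq_Ioc), ← Iic_sdiff_Iic,
      measure_sdiff (Iic_subset_Iic.2 hst) nullMeasurableSet_Iic (hfin s),
      ENNReal.ofReal_sub _ ENNReal.toReal_nonneg, ENNReal.ofReal_toReal (hfin t),
      ENNReal.ofReal_toReal (hfin s)]
  have hb0 : (0 : ℝ) < F.b := by positivity
  refine ⟨sub_nonneg.2 h1, ?_, h3⟩
  have h0 : 0 ≤ (potential κ χ (Iic s)).toReal := ENNReal.toReal_nonneg
  rcases le_total (t - s) 1 with hts | hts
  · rw [min_eq_left hts]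
    have h4 := h.mul_potential_le_volume hκ hF hχ hχ1 (Ioo s t)
    rw [h3, Real.volume_Ioo, show (F.b : ℝ≥0∞) = ENNReal.ofReal F.b from
      (ENNReal.ofReal_coe_nnreal).symm, ← ENNReal.ofReal_mul F.b.coe_nonneg,
      ENNReal.ofReal_le_ofReal_iff (sub_nonneg.2 hst), mul_comm, ← le_div_iff₀ hb0] at h4
    refine h4.trans ?_
    rw [div_eq_mul_one_div, mul_comm]
    gcongr
    exact le_max_left _ _
  · rw [min_eq_right hts, mul_one]
    exact le_trans (by linarith) (le_max_right _ _)

/-- The increment bound makes the jump integral converge, so with a drift the convolution is finite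
at every t and not merely at almost every t. -/
theorem tailConv_of_drift_ne_zero (h : IsInverseLaw η κ) (hκ : IsLaplaceSemigroup κ F.bernstein)
    (hF : F.ConditionI) (hb : F.b ≠ 0) (hχ : Measurable χ) (hχ1 : ∀ x, χ x ≤ 1) (t : ℝ) :
    Integrable (fun r => (potential κ χ (Iic t)).toReal -
      (potential κ χ (Iic (t - r))).toReal) F.levy ∧
    F.tailConv (potential κ χ) t = ENNReal.ofReal (F.a * (potential κ χ (Iic t)).toReal +
      ∫ r, ((potential κ χ (Iic t)).toReal - (potential κ χ (Iic (t - r))).toReal) ∂F.levy) := by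
  have := hκ.isFiniteKernel
  have hfin := potential_Iic_ne_top hκ (F.bernstein_pos hF.1 one_pos) hχ hχ1 t
  have hac : potential κ χ ≪ volume :=
    potential_absolutelyContinuous (fun x hx => hκ.absolutelyContinuous hF hx) hχ
  have hmono : Monotone fun s => (potential κ χ (Iic s)).toReal := fun s s' hss =>
    ENNReal.toReal_mono (potential_Iic_ne_top hκ (F.bernstein_pos hF.1 one_pos) hχ hχ1 s')
      (measure_mono (Iic_subset_Iic.2 hss))
  have hm : Measurable fun r => (potential κ χ (Iic t)).toReal -
      (potential κ χ (Iic (t - r))).toReal :=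
    measurable_const.sub (hmono.measurable.comp (measurable_const.sub measurable_id))
  have hnn : ∀ᵐ r ∂F.levy, 0 ≤ (potential κ χ (Iic t)).toReal -
      (potential κ χ (Iic (t - r))).toReal := by
    filter_upwards [F.ae_pos] with r hr
    exact (h.potential_increment_le hκ hF hb hχ hχ1 (by linarith) le_rfl).1
  have hint : Integrable (fun r => (potential κ χ (Iic t)).toReal -
      (potential κ χ (Iic (t - r))).toReal) F.levy := by
    refine (F.integrable_min.const_mul (max (1 / (F.b : ℝ)) (potential κ χ (Iic t)).toReal)).mono'
      hm.aestronglyMeasurable ?_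
    filter_upwards [F.ae_pos] with r hr
    have := h.potential_increment_le hκ hF hb hχ hχ1 (s := t - r) (by linarith) (le_refl t)
    rw [Real.norm_of_nonneg this.1]
    simpa using this.2.1
  refine ⟨hint, ?_⟩
  rw [F.tailConv_eq, ENNReal.ofReal_add (by positivity) (integral_nonneg_of_ae hnn),
    ofReal_integral_eq_lintegral_ofReal hint hnn, ENNReal.ofReal_mul F.a.coe_nonneg,
    ENNReal.ofReal_coe_nnreal, ENNReal.ofReal_toReal hfin,
    measure_congr (hac.ae_le Iio_ae_eq_Iic)]
  congr 1
  refine lintegral_congr_ae ?_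
  filter_upwards [F.ae_pos] with r hr
  exact (h.potential_increment_le hκ hF hb hχ hχ1 (by linarith) le_rfl).2.2

/-- The distribution function of the potential is locally Lipschitz; dominated convergence applies
to its increments, with the bound of `potential_increment_le` taken at T = t + 1 for all times near
t. -/
theorem continuousAt_tailConv (h : IsInverseLaw η κ) (hκ : IsLaplaceSemigroup κ F.bernstein)
    (hF : F.ConditionI) (hb : F.b ≠ 0) (hχ : Measurable χ) (hχ1 : ∀ x, χ x ≤ 1) (t : ℝ) :
    ContinuousAt (fun t => (F.tailConv (potential κ χ) t).toReal) t := by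
  have := hκ.isFiniteKernel
  set V : ℝ → ℝ := fun t => (potential κ χ (Iic t)).toReal with hV
  have hinc : ∀ s t T, s ≤ t → t ≤ T → 0 ≤ V t - V s ∧
      V t - V s ≤ max (1 / (F.b : ℝ)) (V T) * min (t - s) 1 := fun s t T hst htT =>
    have := h.potential_increment_le hκ hF hb hχ hχ1 hst htT
    ⟨this.1, this.2.1⟩
  have hVc : Continuous V := by
    refine continuous_iff_continuousAt.2 fun t => ?_
    have hlip : LipschitzOnWith (Real.toNNReal (max (1 / (F.b : ℝ)) (V (t + 1)))) V (Iic (t + 1)) := by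
      refine LipschitzOnWith.of_le_add_mul _ fun x hx y hy => ?_
      rcases le_total x y with hxy | hxy
      · have := (hinc x y _ hxy hy).1
        have h2 : 0 ≤ (Real.toNNReal (max (1 / (F.b : ℝ)) (V (t + 1))) : ℝ) * dist x y := by positivity
        linarith
      · have h2 := (hinc y x _ hxy hx).2
        rw [Real.coe_toNNReal _ (le_max_of_le_left (by positivity)), Real.dist_eq,
          abs_of_nonneg (sub_nonneg.2 hxy)]
        have h3 : max (1 / (F.b : ℝ)) (V (t + 1)) * min (x - y) 1 ≤
            max (1 / (F.b : ℝ)) (V (t + 1)) * (x - y) := by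
          have : 0 ≤ max (1 / (F.b : ℝ)) (V (t + 1)) := le_max_of_le_left (by positivity)
          gcongr
          exact min_le_left _ _
        linarith
    exact hlip.continuousOn.continuousAt (Iic_mem_nhds (by linarith))
  have heq : (fun t => (F.tailConv (potential κ χ) t).toReal) =
      fun t => F.a * V t + ∫ r, (V t - V (t - r)) ∂F.levy := by
    ext t
    rw [(h.tailConv_of_drift_ne_zero hκ hF hb hχ hχ1 t).2, ENNReal.toReal_ofReal]
    refine add_nonneg (by positivity) (integral_nonneg_of_ae ?_)
    filter_upwards [F.ae_pos] with r hr
    exact (hinc _ _ t (by linarith) le_rfl).1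
  rw [heq]
  refine (hVc.continuousAt.const_mul _).add ?_
  refine continuousAt_of_dominated (bound := fun r => max (1 / (F.b : ℝ)) (V (t + 1)) * min r 1)
    (Filter.Eventually.of_forall fun s => (by fun_prop : Continuous _).aestronglyMeasurable) ?_
    (F.integrable_min.const_mul _) (ae_of_all _ fun r => by fun_prop)
  filter_upwards [Iic_mem_nhds (lt_add_one t)] with s hs
  filter_upwards [F.ae_pos] with r hr
  have := hinc (s - r) s (t + 1) (by linarith) hs
  rw [Real.norm_of_nonneg this.1]
  simpa using this.2

/-- The potential measure has a density which solves the convolution equation at every positive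
time. -/
theorem exists_density (h : IsInverseLaw η κ) (hκ : IsLaplaceSemigroup κ F.bernstein)
    (hF : F.ConditionI) (hχ : Measurable χ) (hχ1 : ∀ x, χ x ≤ 1)
    (hcont : ContinuousOn (fun t => (∫⁻ x, χ x ∂η t).toReal) (Ioi 0)) :
    ∃ u : ℝ → ℝ, AEStronglyMeasurable u volume ∧
      (∀ T, 0 ≤ T → IntervalIntegrable u volume 0 T ∧
        ∫ s in (0 : ℝ)..T, u s = (potential κ χ (Iic T)).toReal) ∧
      ∀ t, 0 < t → IntervalIntegrable (fun s => u (t - s) * F.tail s) volume 0 t ∧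
        F.b * u t + ∫ s in (0 : ℝ)..t, u (t - s) * F.tail s = (∫⁻ x, χ x ∂η t).toReal ∧
        (F.b ≠ 0 → ContinuousAt u t) := by
  have := hκ.isFiniteKernel
  have hle : ∀ t, ∫⁻ x, χ x ∂η t ≤ 1 := fun t => by
    refine (lintegral_mono hχ1).trans ?_
    rw [lintegral_one]
    exact h.le_one t
  have hle' : ∀ t, ∫⁻ x, χ x ∂η t ≠ ∞ := fun t => ne_top_of_le_ne_top ENNReal.one_ne_top (hle t)
  have hρm : AEStronglyMeasurable (fun t => ((potential κ χ).rnDeriv volume t).toReal) volume :=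
    ((potential κ χ).measurable_rnDeriv volume).ennreal_toReal.aestronglyMeasurable
  by_cases hb : F.b = 0
  -- Without drift u(t) itself does not enter the equation, so the Radon–Nikodym derivative will do.
  · refine ⟨_, hρm, fun T hT => potential_density hκ hF hχ hχ1 (Filter.EventuallyEq.refl _ _) hT,
      fun t ht => ?_⟩
    have h1 := h.lintegral_eq_tailConv_of_drift_eq_zero hκ hF hb hχ hχ1 ht
    have h2 := tailConv_density hκ hF hχ hχ1 (Filter.EventuallyEq.refl _ _) ht.le
      (h1 ▸ hle' t)
    refine ⟨h2.1, ?_, fun h => absurd hb h⟩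
    rw [h2.2, h1, hb, NNReal.coe_zero, zero_mul, zero_add]
  · have hb0 : (F.b : ℝ) ≠ 0 := by simpa using hb
    have hTfin : ∀ t, F.tailConv (potential κ χ) t ≠ ∞ := fun t => by
      rw [(h.tailConv_of_drift_ne_zero hκ hF hb hχ hχ1 t).2]
      exact ENNReal.ofReal_ne_top
    -- Solve the equation for u pointwise. By `ae_eq` this is a version of the density, and it
    -- inherits continuity from both terms of the numerator.
    set u : ℝ → ℝ := (Ioi (0 : ℝ)).indicator fun t => ((∫⁻ x, χ x ∂η t).toReal -
      (F.tailConv (potential κ χ) t).toReal) / F.b with hu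
    have hue : u =ᵐ[volume] fun t => ((potential κ χ).rnDeriv volume t).toReal := by
      filter_upwards [h.ae_eq hκ hF hχ hχ1] with t ht
      rcases le_or_gt t 0 with h0 | h0
      · rw [indicator_of_notMem (by simpa using h0), eq_comm, add_eq_zero, mul_eq_zero] at ht
        rw [hu, indicator_of_notMem (by simpa using h0)]
        rcases ht.1 with h1 | h1
        · exact absurd (by simpa using h1) hb
        · rw [h1, ENNReal.toReal_zero]
      · rw [indicator_of_mem (mem_Ioi.2 h0)] at ht
        rw [hu, indicator_of_mem (mem_Ioi.2 h0)]
        have h1 : F.b * (potential κ χ).rnDeriv volume t ≠ ∞ := fun h1 => hle' t (by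
          rw [ht, h1, top_add])
        rw [ht, ENNReal.toReal_add h1 (hTfin t), ENNReal.toReal_mul, ENNReal.coe_toReal]
        field_simp
        ring
    refine ⟨u, hρm.congr hue.symm, fun T hT => potential_density hκ hF hχ hχ1 hue hT,
      fun t ht => ?_⟩
    have h2 := tailConv_density hκ hF hχ hχ1 hue ht.le (hTfin t)
    refine ⟨h2.1, ?_, fun _ => ?_⟩
    · rw [h2.2, hu, indicator_of_mem (mem_Ioi.2 ht)]
      field_simp
      ring
    · have h3 : ContinuousAt (fun t => ((∫⁻ x, χ x ∂η t).toReal -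
          (F.tailConv (potential κ χ) t).toReal) / F.b) t :=
        ((hcont.continuousAt (Ioi_mem_nhds ht)).sub
          (h.continuousAt_tailConv hκ hF hb hχ hχ1 t)).div_const _
      refine h3.congr ?_
      filter_upwards [Ioi_mem_nhds ht] with s hs
      rw [hu, indicator_of_mem hs]

end IsInverseLaw

/-! ### From the convolution equation to the governing equation. -/

theorem AbsolutelyContinuousOnInterval.congr {f g : ℝ → ℝ} {a b : ℝ}
    (hf : AbsolutelyContinuousOnInterval f a b) (h : EqOn f g (uIcc a b)) :
    AbsolutelyContinuousOnInterval g a b := by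
  rw [absolutelyContinuousOnInterval_iff] at hf ⊢
  intro ε hε
  obtain ⟨δ, hδ, H⟩ := hf ε hε
  refine ⟨δ, hδ, fun E hE hlt => ?_⟩
  have h1 := H E hE hlt
  rwa [Finset.sum_congr rfl fun i hi => by rw [h (hE.1 i hi).1, h (hE.1 i hi).2]] at h1

theorem IsLaplaceSemigroup.apply_zero {κ : Kernel ℝ ℝ} {f : ℝ → ℝ} (hκ : IsLaplaceSemigroup κ f) :
    κ 0 = Measure.dirac 0 := by
  have h1 : ∀ s > 0, laplace (κ 0) s = 1 := fun s hs => by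
    rw [hκ.laplace_eq 0 le_rfl s hs]; simp
  refine ext_of_laplace (fun s hs => by rw [h1 s hs]; exact ENNReal.one_ne_top) fun s hs => ?_
  rw [h1 s hs, laplace, lintegral_dirac' _ (measurable_ofReal_exp s)]
  simp

namespace IsInverseLaw

variable {η κ : Kernel ℝ ℝ} {f : ℝ → ℝ} {F : LevyTriple}

/-- Killing costs no mass, since a jump to the cemetery also passes the level t: the duality at x =
0 gives κ_0(-∞, t], and κ_0 is the unit mass at 0. -/
theorem isProbabilityMeasure (h : IsInverseLaw η κ) (hκ : IsLaplaceSemigroup κ f) {t : ℝ}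
    (ht : 0 < t) : IsProbabilityMeasure (η t) := by
  refine ⟨?_⟩
  rw [← Iic_union_Ioi (a := (0 : ℝ)), measure_union (Iic_disjoint_Ioi le_rfl) measurableSet_Ioi,
    h.measure_Iic_zero t ht, zero_add, h.measure_Ioi t ht 0 le_rfl, hκ.apply_zero,
    Measure.dirac_apply' _ measurableSet_Iic]
  exact indicator_of_mem (mem_Iic.2 ht.le) _

/-- Layer-cake: averaging ∫_0^Y π over Y gives ∫ π(x) P(Y > x) dx, and the duality replaces P(Y > x)
by κ_x(-∞, t]. -/
theorem integral_primitive (h : IsInverseLaw η κ) (hκ : IsLaplaceSemigroup κ f) (hf : 0 < f 1)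
    {π : ℝ → ℝ} (hm : Measurable π) (h0 : ∀ x, 0 ≤ π x) (h1 : ∀ x, π x ≤ 1) {t : ℝ} (ht : 0 < t) :
    Integrable (fun y => ∫ x in (0 : ℝ)..y, π x) (η t) ∧
      ∫ y, (∫ x in (0 : ℝ)..y, π x) ∂η t =
        (potential κ (fun x => ENNReal.ofReal (π x)) (Iic t)).toReal := by
  have := h.isFiniteKernel
  have hχ : Measurable fun x => ENNReal.ofReal (π x) := hm.ennreal_ofReal
  have hχ1 : ∀ x, ENNReal.ofReal (π x) ≤ 1 := fun x => ENNReal.ofReal_le_one.2 (h1 x)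
  have hint : ∀ a b, IntervalIntegrable π volume a b := fun a b =>
    (intervalIntegrable_const (c := (1 : ℝ))).mono_fun hm.aestronglyMeasurable
      (ae_of_all _ fun x => by
        dsimp only; rw [Real.norm_of_nonneg (h0 x)]; simpa using h1 x)
  have hnn : ∀ᵐ y ∂η t, 0 ≤ ∫ x in (0 : ℝ)..y, π x := by
    filter_upwards [h.ae_pos ht] with y hy
    exact intervalIntegral.integral_nonneg hy.le fun x _ => h0 x
  have hcont : Continuous fun y => ∫ x in (0 : ℝ)..y, π x :=
    intervalIntegral.continuous_primitive hint 0
  have key : ∫⁻ y, ENNReal.ofReal (∫ x in (0 : ℝ)..y, π x) ∂η t =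
      potential κ (fun x => ENNReal.ofReal (π x)) (Iic t) := by
    have h2 : ∀ᵐ y ∂η t, ENNReal.ofReal (∫ x in (0 : ℝ)..y, π x) =
        ∫⁻ x in Ioi 0, {p : ℝ × ℝ | p.2 < p.1}.indicator
          (fun p => ENNReal.ofReal (π p.2)) (y, x) := by
      filter_upwards [h.ae_pos ht] with y hy
      rw [intervalIntegral.integral_of_le hy.le, ofReal_integral_eq_lintegral_ofReal (hint 0 y).1
        (ae_of_all _ h0), setLIntegral_congr Ioo_ae_eq_Ioc.symm, ← Iio_inter_Ioi,
        ← Measure.restrict_restrict measurableSet_Iio, ← lintegral_indicator measurableSet_Iio]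
      rfl
    have h3 : Measurable (Function.uncurry fun y x : ℝ => {p : ℝ × ℝ | p.2 < p.1}.indicator
        (fun p => ENNReal.ofReal (π p.2)) (y, x)) :=
      (hχ.comp measurable_snd).indicator (measurableSet_lt measurable_snd measurable_fst)
    rw [lintegral_congr_ae h2, lintegral_lintegral_swap h3.aemeasurable,
      potential_apply hχ measurableSet_Iic]
    refine setLIntegral_congr_fun measurableSet_Ioi fun x hx => ?_
    rw [← h.measure_Ioi t ht x (mem_Ioi.1 hx).le, ← lintegral_indicator_const measurableSet_Ioi]
    rfl
  constructor
  · refine ⟨hcont.aestronglyMeasurable, ?_⟩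
    rw [hasFiniteIntegral_iff_ofReal hnn, key]
    exact (potential_Iic_ne_top hκ hf hχ hχ1 t).lt_top
  · rw [integral_eq_lintegral_of_nonneg_ae hnn hcont.aestronglyMeasurable, key]

/-- If `π_k(y) = π_k(0) - ∑_m c_m ∫_0^y π_{k-m}`, then `p_k(t) = ∫ π_k dη_t` solves the system
`𝒟^f p_k = -∑_m c_m p_{k-m}`. -/
theorem cdDeriv_eq (h : IsInverseLaw η κ) (hκ : IsLaplaceSemigroup κ F.bernstein)
    (hF : F.ConditionI) {π : ℕ → ℝ → ℝ} {c : ℕ → ℝ} {p : ℕ → ℝ → ℝ}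
    (hm : ∀ k, Measurable (π k)) (h0 : ∀ k x, 0 ≤ π k x) (h1 : ∀ k x, π k x ≤ 1)
    (hπ : ∀ k y, 0 ≤ y → π k y =
      π k 0 - ∑ m ∈ Finset.range (k + 1), c m * ∫ x in (0 : ℝ)..y, π (k - m) x)
    (hp0 : ∀ k, p k 0 = π k 0) (hp : ∀ k t, 0 < t → p k t = ∫ y, π k y ∂η t)
    (k : ℕ) {t : ℝ} (ht : 0 < t) :
    F.CDDifferentiableAt (p k) t ∧
      F.cdDeriv (p k) t = -∑ m ∈ Finset.range (k + 1), c m * p (k - m) t := by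
  have := hκ.isFiniteKernel
  have hf := F.bernstein_pos hF.1 one_pos
  set χ : ℕ → ℝ → ℝ≥0∞ := fun k x => ENNReal.ofReal (π k x) with hχdef
  have hχ : ∀ k, Measurable (χ k) := fun k => (hm k).ennreal_ofReal
  have hχ1 : ∀ k x, χ k x ≤ 1 := fun k x => ENNReal.ofReal_le_one.2 (h1 k x)
  have hpχ : ∀ k t, 0 < t → (∫⁻ x, χ k x ∂η t).toReal = p k t := by
    intro k t ht
    rw [hp k t ht, integral_eq_lintegral_of_nonneg_ae (ae_of_all _ (h0 k))
      (hm k).aestronglyMeasurable]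
  -- Average the integrated system over η_t. Besides the form of p_k this yields the continuity in t
  -- that `exists_density` requires.
  have hpV : ∀ k t, 0 < t → p k t = π k 0 - ∑ m ∈ Finset.range (k + 1),
      c m * (potential κ (χ (k - m)) (Iic t)).toReal := by
    intro k t ht
    have := h.isProbabilityMeasure hκ ht
    have h2 : ∀ᵐ y ∂η t, π k y =
        π k 0 - ∑ m ∈ Finset.range (k + 1), c m * ∫ x in (0 : ℝ)..y, π (k - m) x := by
      filter_upwards [h.ae_pos ht] with y hy using hπ k y hy.le
    have h3 := fun i => h.integral_primitive hκ hf (hm i) (h0 i) (h1 i) ht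
    rw [hp k t ht, integral_congr_ae h2, integral_sub (integrable_const _)
      (integrable_finsetSum _ fun m _ => (h3 (k - m)).1.const_mul _),
      integral_finsetSum _ fun m _ => (h3 (k - m)).1.const_mul _]
    simp_rw [integral_const_mul, (h3 _).2]
    rw [integral_const, probReal_univ, one_smul]
  have hcont : ∀ k, ContinuousOn (p k) (Ioi 0) := by
    intro k
    refine ContinuousOn.congr ?_ fun t ht => hpV k t ht
    exact continuousOn_const.sub (continuousOn_finsetSum _ fun m _ =>
      (continuousOn_potential_Iic hκ hF (hχ _) (hχ1 _)).const_mul _)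
  choose u hum huV hu using fun k => h.exists_density hκ hF (hχ k) (hχ1 k)
    ((hcont k).congr fun t ht => hpχ k t ht)
  set q : ℝ → ℝ := fun t => ∑ m ∈ Finset.range (k + 1), c m * u (k - m) t with hq
  have hqi : ∀ T, 0 ≤ T → IntervalIntegrable q volume 0 T := by
    intro T hT
    have := IntervalIntegrable.sum (μ := volume) (a := 0) (b := T) (Finset.range (k + 1))
      (f := fun m t => c m * u (k - m) t) fun m _ => ((huV (k - m) T hT).1.const_mul (c m))
    rwa [Finset.sum_fn] at this
  have hpq : ∀ t, 0 ≤ t → p k t = π k 0 - ∫ s in (0 : ℝ)..t, q s := by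
    intro t ht
    rcases ht.eq_or_lt with rfl | ht
    · rw [hp0, intervalIntegral.integral_same, sub_zero]
    · rw [hpV k t ht, hq, intervalIntegral.integral_finsetSum fun m _ =>
        ((huV (k - m) t ht.le).1.const_mul (c m))]
      simp_rw [intervalIntegral.integral_const_mul]
      congr 1
      exact Finset.sum_congr rfl fun m _ => by rw [(huV (k - m) t ht.le).2]
  have hderiv : ∀ᵐ s : ℝ, s ∈ Ioo 0 t → deriv (p k) s = -q s := by
    filter_upwards [(hqi t ht.le).ae_hasDerivAt_integral] with s hs hst
    have h2 := hs (by rw [uIcc_of_le ht.le]; exact Ioo_subset_Icc_self hst) 0 left_mem_uIcc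
    have h3 : HasDerivAt (p k) (-q s) s := by
      refine (h2.const_sub (π k 0)).congr_of_eventuallyEq ?_
      filter_upwards [Ioi_mem_nhds hst.1] with r hr using hpq r (mem_Ioi.1 hr).le
    exact h3.deriv
  -- An almost-everywhere derivative does not suffice for the term b p_k'(t); with a drift the
  -- densities are continuous at t, so the fundamental theorem applies at t itself.
  have hb : F.b ≠ 0 → HasDerivAt (p k) (-q t) t := by
    intro hb
    have hqc : ContinuousAt q t := by
      simp only [hq]
      exact tendsto_finsetSum _ fun m _ => ((hu (k - m) t ht).2.2 hb).const_mul (c m)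
    have hqm : AEStronglyMeasurable q volume :=
      Finset.aestronglyMeasurable_fun_sum _ fun m _ => (hum (k - m)).const_mul (c m)
    have h2 := intervalIntegral.integral_hasDerivAt_right (hqi t ht.le)
      hqm.stronglyMeasurableAtFilter hqc
    refine (h2.const_sub (π k 0)).congr_of_eventuallyEq ?_
    filter_upwards [Ioi_mem_nhds ht] with r hr using hpq r (mem_Ioi.1 hr).le
  have hconv : ∀ᵐ s : ℝ, s ∈ Ioo 0 t → deriv (p k) (t - s) * F.tail s =
      ∑ m ∈ Finset.range (k + 1), -c m * (u (k - m) (t - s) * F.tail s) := by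
    have hmp := Measure.measurePreserving_sub_left (volume : Measure ℝ) t
    filter_upwards [hmp.quasiMeasurePreserving.ae hderiv] with s hs hst
    rw [hs ⟨by linarith [hst.2], by linarith [hst.1]⟩, hq, neg_mul, Finset.sum_mul,
      ← Finset.sum_neg_distrib]
    exact Finset.sum_congr rfl fun m _ => by ring
  have hconv' : ∀ᵐ s : ℝ, s ∈ uIoc 0 t → deriv (p k) (t - s) * F.tail s =
      ∑ m ∈ Finset.range (k + 1), -c m * (u (k - m) (t - s) * F.tail s) := by
    have h2 : ∀ᵐ s : ℝ, s ≠ t := by simp [ae_iff, measure_singleton]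
    filter_upwards [hconv, h2] with s hs hst hs0
    rw [uIoc_of_le ht.le] at hs0
    exact hs ⟨hs0.1, lt_of_le_of_ne hs0.2 hst⟩
  have hsum : IntervalIntegrable (fun s => ∑ m ∈ Finset.range (k + 1),
      -c m * (u (k - m) (t - s) * F.tail s)) volume 0 t := by
    have := IntervalIntegrable.sum (μ := volume) (a := 0) (b := t) (Finset.range (k + 1))
      (f := fun m s => -c m * (u (k - m) (t - s) * F.tail s))
      fun m _ => ((hu (k - m) t ht).1.const_mul (-c m))
    rwa [Finset.sum_fn] at this
  refine ⟨⟨fun T hT => ?_, fun hb0 => (hb hb0).differentiableAt, ?_⟩, ?_⟩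
  · have h2 := (((hqi T hT.le).absolutelyContinuousOnInterval_intervalIntegral
      left_mem_uIcc).neg)
    have h3 : AbsolutelyContinuousOnInterval (fun _ : ℝ => π k 0) 0 T :=
      (LipschitzWith.const (π k 0)).lipschitzOnWith.absolutelyContinuousOnInterval
    refine (h3.add h2).congr fun s hs => ?_
    rw [uIcc_of_le hT.le] at hs
    simp only [Pi.add_apply, Pi.neg_apply]
    rw [hpq s hs.1, sub_eq_add_neg]
  · refine hsum.congr_ae ?_
    rw [Filter.EventuallyEq, ae_restrict_iff' measurableSet_uIoc]
    filter_upwards [hconv'] with s hs hst using (hs hst).symm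
  -- Term by term in m, drift and convolution parts combine to b u + ν ∗ u for the weight π_{k-m},
  -- which is p_{k-m}(t).
  · rw [LevyTriple.cdDeriv, intervalIntegral.integral_congr_ae hconv',
      intervalIntegral.integral_finsetSum fun m _ => ((hu (k - m) t ht).1.const_mul (-c m))]
    have h2 : F.b * deriv (p k) t = ∑ m ∈ Finset.range (k + 1), -c m * (F.b * u (k - m) t) := by
      by_cases hb0 : F.b = 0
      · simp [hb0]
      · rw [(hb hb0).deriv, hq, mul_neg, Finset.mul_sum, ← Finset.sum_neg_distrib]
        exact Finset.sum_congr rfl fun m _ => by ring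
    simp_rw [intervalIntegral.integral_const_mul]
    rw [h2, ← Finset.sum_add_distrib, ← Finset.sum_neg_distrib]
    refine Finset.sum_congr rfl fun m _ => ?_
    rw [← mul_add, (hu (k - m) t ht).2.1, hpχ _ _ ht, neg_mul]

end IsInverseLaw

/-! ### Poisson mixtures and their differential system. -/

/-- The Poisson weight `e^{-λ s} (λ s)^k / k!`. -/
noncomputable def poissonWeight (lam : ℝ) (k : ℕ) (s : ℝ) : ℝ :=
  Real.exp (-(lam * s)) * (lam * s) ^ k / (k.factorial : ℝ)

theorem measurable_poissonWeight (lam : ℝ) (k : ℕ) : Measurable (poissonWeight lam k) := by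
  unfold poissonWeight; fun_prop

theorem poissonWeight_nonneg {lam s : ℝ} (hlam : 0 ≤ lam) (hs : 0 ≤ s) (k : ℕ) :
    0 ≤ poissonWeight lam k s := by
  unfold poissonWeight; positivity

theorem poissonWeight_le_one {lam s : ℝ} (hlam : 0 ≤ lam) (hs : 0 ≤ s) (k : ℕ) :
    poissonWeight lam k s ≤ 1 := by
  have h := Real.pow_div_factorial_le_exp (lam * s) (by positivity) k
  calc poissonWeight lam k s = Real.exp (-(lam * s)) * ((lam * s) ^ k / (k.factorial : ℝ)) := by
        unfold poissonWeight; ring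
    _ ≤ Real.exp (-(lam * s)) * Real.exp (lam * s) := by gcongr
    _ = 1 := by rw [← Real.exp_add]; simp

theorem contDiffAt_of_laplace {α : Measure ℝ} {G : ℝ → ℝ} (hfin : ∀ s > 0, laplace α s ≠ ∞)
    (hG : ∀ s > 0, (laplace α s).toReal = G s) {s : ℝ} (hs : 0 < s) :
    ContDiffAt ℝ (⊤ : ℕ∞) G s := by
  have h1 := (analyticAt_mgf (neg_mem_interior_integrableExpSet hfin hs)).contDiffAt
    (n := (⊤ : ℕ∞))
  have h2 : ContDiffAt ℝ (⊤ : ℕ∞) (fun r => mgf id α (-r)) s :=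
    h1.comp s contDiff_neg.contDiffAt
  refine h2.congr_of_eventuallyEq ?_
  filter_upwards [Ioi_mem_nhds hs] with r hr
  rw [mgf_id_neg_eq_laplace, hG r hr]

/-- Poisson mixtures in terms of the derivatives of the Laplace transform of the mixing measure. -/
theorem integral_poissonWeight {α : Measure ℝ} {G : ℝ → ℝ} (hfin : ∀ s > 0, laplace α s ≠ ∞)
    (hG : ∀ s > 0, (laplace α s).toReal = G s) {lam : ℝ} (hlam : 0 < lam) (k : ℕ) :
    ∫ s, poissonWeight lam k s ∂α = (-lam) ^ k / (k.factorial : ℝ) * iteratedDeriv k G lam := by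
  have h1 : G =ᶠ[nhds lam] fun r => mgf id α (-r) := by
    filter_upwards [Ioi_mem_nhds hlam] with r hr
    rw [mgf_id_neg_eq_laplace, hG r hr]
  rw [h1.iteratedDeriv_eq, iteratedDeriv_comp_neg,
    iteratedDeriv_mgf (neg_mem_interior_integrableExpSet hfin hlam), smul_eq_mul, ← mul_assoc,
    ← integral_const_mul]
  refine integral_congr_ae (ae_of_all _ fun s => ?_)
  simp only [poissonWeight, id, mul_pow, neg_mul]
  have h2 : (-lam) ^ k * (-1) ^ k = lam ^ k := by rw [← mul_pow]; simp
  rw [← h2]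
  ring

/-- The derivatives in the rate of `e^{-y ψ}` commute with the derivative in `y`. -/
theorem hasDerivAt_iteratedDeriv_exp {ψ : ℝ → ℝ} (hψ : ∀ s > 0, ContDiffAt ℝ (⊤ : ℕ∞) ψ s)
    {lam : ℝ} (hlam : 0 < lam) (k : ℕ) (y : ℝ) :
    HasDerivAt (fun y => iteratedDeriv k (fun r => Real.exp (-(y * ψ r))) lam)
      (-iteratedDeriv k (fun r => ψ r * Real.exp (-(y * ψ r))) lam) y := by
  -- The exchange of derivatives is reduced to lower orders: the first derivative in the rate is -y
  -- ψ' e^{-yψ}, and the Leibniz rule writes the remaining k derivatives through derivatives of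
  -- e^{-yψ} of order at most k, to which the hypothesis applies.
  induction k using Nat.strong_induction_on generalizing y with
  | _ k ih =>
  have hn : ∀ (n : ℕ) {g : ℝ → ℝ} {s : ℝ}, ContDiffAt ℝ (⊤ : ℕ∞) g s → ContDiffAt ℝ n g s :=
    fun n g s h => h.of_le (by exact_mod_cast le_top)
  have hE : ∀ y, ∀ s > 0, ContDiffAt ℝ (⊤ : ℕ∞) (fun r => Real.exp (-(y * ψ r))) s :=
    fun y s hs => ((contDiffAt_const.mul (hψ s hs)).neg).exp
  have hψ' : ∀ s > 0, ContDiffAt ℝ (⊤ : ℕ∞) (deriv ψ) s := by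
    intro s hs
    have h1 : ContDiffOn ℝ (⊤ : ℕ∞) ψ (Ioi 0) := fun r hr => (hψ r hr).contDiffWithinAt
    exact (h1.deriv_of_isOpen (m := (⊤ : ℕ∞)) isOpen_Ioi (by simp)).contDiffAt (Ioi_mem_nhds hs)
  have hdψ : ∀ s > 0, HasDerivAt ψ (deriv ψ s) s := fun s hs =>
    ((hψ s hs).differentiableAt (by simp)).hasDerivAt
  have hdE : ∀ y, ∀ s > 0, HasDerivAt (fun r => Real.exp (-(y * ψ r)))
      (-y * (deriv ψ s * Real.exp (-(y * ψ s)))) s := fun y s hs =>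
    (((hdψ s hs).const_mul y).neg.exp).congr_deriv (by simp only [Pi.neg_apply]; ring)
  rcases k with _ | k
  · simp only [iteratedDeriv_zero]
    have h := LevyTriple.hasDerivAt_exp_neg_mul (ψ lam) y
    simpa only [mul_comm (ψ lam), neg_mul] using! h
  · have hfirst : ∀ y, iteratedDeriv (k + 1) (fun r => Real.exp (-(y * ψ r))) lam =
        -y * ∑ i ∈ Finset.range (k + 1), (k.choose i : ℝ) * iteratedDeriv i (deriv ψ) lam *
          iteratedDeriv (k - i) (fun r => Real.exp (-(y * ψ r))) lam := by
      intro y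
      rw [iteratedDeriv_succ']
      have h1 : deriv (fun r => Real.exp (-(y * ψ r))) =ᶠ[nhds lam]
          fun r => -y * (deriv ψ r * Real.exp (-(y * ψ r))) := by
        filter_upwards [Ioi_mem_nhds hlam] with r hr using (hdE y r hr).deriv
      rw [h1.iteratedDeriv_eq, iteratedDeriv_const_mul_field,
        iteratedDeriv_fun_mul (hn _ (hψ' lam hlam)) (hn _ (hE y lam hlam))]
    have hsecond : iteratedDeriv (k + 1) (fun r => ψ r * Real.exp (-(y * ψ r))) lam =
        (∑ i ∈ Finset.range (k + 1), (k.choose i : ℝ) * iteratedDeriv i (deriv ψ) lam *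
          iteratedDeriv (k - i) (fun r => Real.exp (-(y * ψ r))) lam) +
        -y * ∑ i ∈ Finset.range (k + 1), (k.choose i : ℝ) * iteratedDeriv i (deriv ψ) lam *
          iteratedDeriv (k - i) (fun r => ψ r * Real.exp (-(y * ψ r))) lam := by
      rw [iteratedDeriv_succ']
      have h1 : deriv (fun r => ψ r * Real.exp (-(y * ψ r))) =ᶠ[nhds lam]
          fun r => deriv ψ r * Real.exp (-(y * ψ r)) +
            -y * (deriv ψ r * (ψ r * Real.exp (-(y * ψ r)))) := by
        filter_upwards [Ioi_mem_nhds hlam] with r hr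
        rw [((hdψ r hr).fun_mul (hdE y r hr)).deriv]
        ring
      have h2 := hψ' lam hlam
      have h3 := hE y lam hlam
      have h4 := hψ lam hlam
      rw [h1.iteratedDeriv_eq, iteratedDeriv_fun_add (hn _ (h2.mul h3))
        (hn _ (contDiffAt_const.mul (h2.mul (h4.mul h3)))), iteratedDeriv_const_mul_field,
        iteratedDeriv_fun_mul (hn _ h2) (hn _ h3), iteratedDeriv_fun_mul (hn _ h2)
          (hn _ (h4.mul h3))]
    have hsum : HasDerivAt (fun y => ∑ i ∈ Finset.range (k + 1),
        (k.choose i : ℝ) * iteratedDeriv i (deriv ψ) lam *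
          iteratedDeriv (k - i) (fun r => Real.exp (-(y * ψ r))) lam)
        (∑ i ∈ Finset.range (k + 1), (k.choose i : ℝ) * iteratedDeriv i (deriv ψ) lam *
          -iteratedDeriv (k - i) (fun r => ψ r * Real.exp (-(y * ψ r))) lam) y :=
      HasDerivAt.fun_sum fun i _ => (ih (k - i) (by omega) y).const_mul _
    simp_rw [hfirst]
    rw [hsecond]
    refine ((hasDerivAt_neg y).fun_mul hsum).congr_deriv ?_
    simp_rw [mul_neg, Finset.sum_neg_distrib]
    ring

namespace IsLaplaceSemigroup

variable {σ : Kernel ℝ ℝ} {ψ : ℝ → ℝ}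

theorem laplace_ne_top (h : IsLaplaceSemigroup σ ψ) {y : ℝ} (hy : 0 ≤ y) :
    ∀ s > 0, laplace (σ y) s ≠ ∞ := fun s hs => by
  rw [h.laplace_eq y hy s hs]; exact ENNReal.ofReal_ne_top

theorem toReal_laplace (h : IsLaplaceSemigroup σ ψ) {y : ℝ} (hy : 0 ≤ y) :
    ∀ s > 0, (laplace (σ y) s).toReal = Real.exp (-(y * ψ s)) := fun s hs => by
  rw [h.laplace_eq y hy s hs, ENNReal.toReal_ofReal (Real.exp_pos _).le]

/-- The exponent is minus the logarithm of the transform of the law at time 1, which is smooth and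
positive. -/
theorem contDiffAt_exponent (h : IsLaplaceSemigroup σ ψ) {s : ℝ} (hs : 0 < s) :
    ContDiffAt ℝ (⊤ : ℕ∞) ψ s := by
  have h1 := contDiffAt_of_laplace (h.laplace_ne_top zero_le_one) (h.toReal_laplace zero_le_one) hs
  have h2 := (h1.log (Real.exp_pos _).ne').neg
  refine h2.congr_of_eventuallyEq (Filter.Eventually.of_forall fun r => ?_)
  simp

/-- The probability that a Poisson process with rate `λ`, evaluated at an independent variable with
law `σ_y`, equals `k`. -/
noncomputable def poissonMixture (σ : Kernel ℝ ℝ) (lam : ℝ) (k : ℕ) (y : ℝ) : ℝ :=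
  ∫ s, poissonWeight lam k s ∂σ y

theorem measurable_poissonMixture (h : IsLaplaceSemigroup σ ψ) (lam : ℝ) (k : ℕ) :
    Measurable (poissonMixture σ lam k) := by
  have := h.isFiniteKernel
  exact ((measurable_poissonWeight lam k).stronglyMeasurable.integral_kernel).measurable

theorem poissonMixture_nonneg (h : IsLaplaceSemigroup σ ψ) {lam : ℝ} (hlam : 0 ≤ lam) (k : ℕ)
    (y : ℝ) : 0 ≤ poissonMixture σ lam k y := by
  refine integral_nonneg_of_ae ?_
  filter_upwards [h.ae_nonneg y] with s hs using poissonWeight_nonneg hlam hs k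

theorem poissonMixture_le_one (h : IsLaplaceSemigroup σ ψ) {lam : ℝ} (hlam : 0 ≤ lam) (k : ℕ)
    (y : ℝ) : poissonMixture σ lam k y ≤ 1 := by
  have := h.isFiniteKernel
  calc poissonMixture σ lam k y ≤ ∫ _, (1 : ℝ) ∂σ y := by
        refine integral_mono_of_nonneg ?_ (integrable_const _) ?_
        · filter_upwards [h.ae_nonneg y] with s hs using poissonWeight_nonneg hlam hs k
        · filter_upwards [h.ae_nonneg y] with s hs using poissonWeight_le_one hlam hs k
    _ ≤ 1 := by
        rw [integral_const, smul_eq_mul, mul_one, measureReal_def]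
        exact ENNReal.toReal_le_of_le_ofReal zero_le_one (by simpa using h.le_one y)

theorem poissonMixture_zero (h : IsLaplaceSemigroup σ ψ) (lam : ℝ) (k : ℕ) :
    poissonMixture σ lam k 0 = if k = 0 then 1 else 0 := by
  rw [poissonMixture, h.apply_zero, integral_dirac]
  rcases eq_or_ne k 0 with rfl | hk <;> simp [poissonWeight, *]

theorem poissonMixture_eq (h : IsLaplaceSemigroup σ ψ) {lam : ℝ} (hlam : 0 < lam) (k : ℕ) {y : ℝ}
    (hy : 0 ≤ y) : poissonMixture σ lam k y = (-lam) ^ k / (k.factorial : ℝ) *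
      iteratedDeriv k (fun r => Real.exp (-(y * ψ r))) lam :=
  integral_poissonWeight (h.laplace_ne_top hy) (h.toReal_laplace hy) hlam k

/-- The y-derivative of e^{-yψ} is -ψ e^{-yψ}; its k-th derivative in the rate expands by Leibniz,
and the binomial coefficients cancel against the factorials to leave a discrete convolution.
Integrating over [0, y] gives the stated form. -/
theorem poissonMixture_eq_sub (h : IsLaplaceSemigroup σ ψ) {lam : ℝ} (hlam : 0 < lam) (k : ℕ)
    {y : ℝ} (hy : 0 ≤ y) : poissonMixture σ lam k y = poissonMixture σ lam k 0 -
      ∑ m ∈ Finset.range (k + 1), iteratedDeriv m ψ lam * (-lam) ^ m / (m.factorial : ℝ) *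
        ∫ x in (0 : ℝ)..y, poissonMixture σ lam (k - m) x := by
  -- This formula agrees with the mixture for y ≥ 0 but is differentiable on the whole line, so the
  -- endpoint 0 needs no one-sided derivative.
  set e : ℕ → ℝ → ℝ := fun k y => (-lam) ^ k / (k.factorial : ℝ) *
    iteratedDeriv k (fun r => Real.exp (-(y * ψ r))) lam with he
  have hψ : ∀ s > 0, ContDiffAt ℝ (⊤ : ℕ∞) ψ s := fun s hs => h.contDiffAt_exponent hs
  have hn : ∀ (n : ℕ) {g : ℝ → ℝ} {s : ℝ}, ContDiffAt ℝ (⊤ : ℕ∞) g s → ContDiffAt ℝ n g s :=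
    fun n g s h => h.of_le (by exact_mod_cast le_top)
  have hd : ∀ k y, HasDerivAt (e k) (-∑ m ∈ Finset.range (k + 1),
      iteratedDeriv m ψ lam * (-lam) ^ m / (m.factorial : ℝ) * e (k - m) y) y := by
    intro k y
    refine ((hasDerivAt_iteratedDeriv_exp hψ hlam k y).const_mul _).congr_deriv ?_
    have hE : ContDiffAt ℝ (⊤ : ℕ∞) (fun r => Real.exp (-(y * ψ r))) lam :=
      ((contDiffAt_const.mul (hψ lam hlam)).neg).exp
    rw [iteratedDeriv_fun_mul (hn _ (hψ lam hlam)) (hn _ hE), mul_neg, Finset.mul_sum]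
    congr 1
    refine Finset.sum_congr rfl fun m hm => ?_
    have hmk : m ≤ k := Nat.lt_succ_iff.1 (Finset.mem_range.1 hm)
    rw [he, Nat.cast_choose ℝ hmk, ← Nat.add_sub_cancel' hmk, pow_add, Nat.add_sub_cancel_left]
    have h1 : ((m + (k - m)).factorial : ℝ) ≠ 0 := by positivity
    field_simp
  have hec : ∀ k, Continuous (e k) := fun k =>
    continuous_iff_continuousAt.2 fun y => (hd k y).continuousAt
  have hint := intervalIntegral.integral_eq_sub_of_hasDerivAt (a := 0) (b := y)
    (fun x _ => hd k x) ((continuous_finsetSum _ fun m _ =>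
      (hec (k - m)).const_mul _).neg.intervalIntegrable _ _)
  rw [intervalIntegral.integral_neg, intervalIntegral.integral_finsetSum
    fun m _ => ((hec (k - m)).const_mul _).intervalIntegrable _ _] at hint
  simp_rw [intervalIntegral.integral_const_mul] at hint
  have h2 : ∀ m, ∫ x in (0 : ℝ)..y, poissonMixture σ lam (k - m) x = ∫ x in (0 : ℝ)..y, e (k - m) x := by
    intro m
    refine intervalIntegral.integral_congr fun x hx => ?_
    rw [uIcc_of_le hy] at hx
    exact h.poissonMixture_eq hlam _ hx.1
  simp_rw [h2]
  rw [h.poissonMixture_eq hlam k hy, h.poissonMixture_eq hlam k le_rfl]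
  linarith

end IsLaplaceSemigroup

/-! ### Measurable versions of path evaluation and first passage. -/

/-- A regularisation of a path that depends on its values on a countable set only. -/
noncomputable def rightLimPath (w : ℝ≥0 → ℝ≥0∞) (s : ℝ≥0) : ℝ≥0∞ :=
  ⨅ i, if s < TopologicalSpace.denseSeq ℝ≥0 i then w (TopologicalSpace.denseSeq ℝ≥0 i) else ⊤

/-- Evaluation at a random time needs joint measurability in time and path. Plain evaluation on an
uncountable product lacks it; a countable infimum has it and returns the same value on monotone
right-continuous paths. -/
theorem measurable_rightLimPath :
    Measurable fun z : ℝ≥0 × (ℝ≥0 → ℝ≥0∞) => rightLimPath z.2 z.1 :=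
  .iInf fun _ => .ite (measurableSet_lt measurable_fst measurable_const)
    ((measurable_pi_apply _).comp measurable_snd) measurable_const

theorem exists_denseSeq_mem_Ioo {a b : ℝ≥0} (h : a < b) :
    ∃ i, TopologicalSpace.denseSeq ℝ≥0 i ∈ Ioo a b :=
  (TopologicalSpace.denseRange_denseSeq ℝ≥0).exists_mem_open isOpen_Ioo (nonempty_Ioo.2 h)

theorem rightLimPath_eq {w : ℝ≥0 → ℝ≥0∞} (hm : Monotone w) {s : ℝ≥0}
    (hs : ContinuousWithinAt w (Ici s) s) : rightLimPath w s = w s := by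
  refine le_antisymm (le_of_forall_gt fun c hc => ?_) (le_iInf fun i => ?_)
  · obtain ⟨u, hu, hsub⟩ := mem_nhdsGE_iff_exists_Ico_subset.1 (hs.eventually_lt_const hc)
    obtain ⟨i, hi⟩ := exists_denseSeq_mem_Ioo (mem_Ioi.1 hu)
    refine (iInf_le _ i).trans_lt ?_
    rw [if_pos hi.1]
    exact hsub ⟨hi.1.le, hi.2⟩
  · split_ifs with h
    · exact hm h.le
    · exact le_top

/-- The first passage time of a path strictly above a level, over a countable set of times. -/
noncomputable def inversePath (w : ℝ≥0 → ℝ≥0∞) (t : ℝ) : ℝ≥0∞ :=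
  ⨅ i, if ENNReal.ofReal t < w (TopologicalSpace.denseSeq ℝ≥0 i) then
    (TopologicalSpace.denseSeq ℝ≥0 i : ℝ≥0∞) else ⊤

theorem measurable_inversePath : Measurable fun z : ℝ × (ℝ≥0 → ℝ≥0∞) => inversePath z.2 z.1 :=
  .iInf fun _ => .ite (measurableSet_lt (by fun_prop)
    ((measurable_pi_apply _).comp measurable_snd)) measurable_const measurable_const

section Inverse

variable {Ω : Type*} {X : ℝ≥0 → Ω → ℝ≥0∞} {t : ℝ} {ω : Ω}

theorem inverseProcess_lt_iff {c : ℝ≥0∞} :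
    inverseProcess X t ω < c ↔ ∃ s : ℝ≥0, ENNReal.ofReal t < X s ω ∧ (s : ℝ≥0∞) < c := by
  simp [inverseProcess, iInf_lt_iff]

theorem inverseProcess_le {s : ℝ≥0} (h : ENNReal.ofReal t < X s ω) :
    inverseProcess X t ω ≤ s := iInf₂_le s h

theorem inversePath_eq (hm : Monotone fun s => X s ω) :
    inversePath (fun s => X s ω) t = inverseProcess X t ω := by
  refine le_antisymm (le_iInf₂ fun s hs => le_of_forall_gt fun c hc => ?_) (le_iInf fun i => ?_)
  · obtain ⟨u, hsu, huc⟩ := ENNReal.lt_iff_exists_nnreal_btwn.1 hc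
    obtain ⟨i, hi⟩ := exists_denseSeq_mem_Ioo (ENNReal.coe_lt_coe.1 hsu)
    refine (iInf_le _ i).trans_lt ?_
    rw [if_pos (hs.trans_le (hm hi.1.le))]
    exact (ENNReal.coe_lt_coe.2 hi.2).trans huc
  · split_ifs with h
    · exact inverseProcess_le h
    · exact le_top

/-- A path strictly below the level at time x stays below it for a while by right-continuity, and
then the passage time exceeds x. -/
theorem le_of_inverseProcess_le (hm : Monotone fun s => X s ω) {x : ℝ≥0}
    (hc : ContinuousWithinAt (fun s => X s ω) (Ici x) x) (h : inverseProcess X t ω ≤ x) :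
    ENNReal.ofReal t ≤ X x ω := by
  by_contra! hlt
  obtain ⟨u, hu, hsub⟩ := mem_nhdsGE_iff_exists_Ico_subset.1 (hc.eventually_lt_const hlt)
  obtain ⟨s, hs, hsu⟩ := inverseProcess_lt_iff.1
    (h.trans_lt (ENNReal.coe_lt_coe.2 (mem_Ioi.1 hu)))
  rcases le_or_gt x s with h1 | h1
  · exact (hs.trans (hsub ⟨h1, ENNReal.coe_lt_coe.1 hsu⟩)).false
  · exact (hs.trans_le (hm h1.le)).not_gt hlt

end Inverse

/-! ### Laws with a cemetery state, and freezing of independent variables. -/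

section Alive

variable {Ω : Type*} [MeasurableSpace Ω] {P : Measure Ω}

/-- The law on the real line of a random variable with values in `[0, ∞]`, where `∞` is a cemetery
state that carries no mass. -/
noncomputable def aliveLaw (P : Measure Ω) (Z : Ω → ℝ≥0∞) : Measure ℝ :=
  (P.restrict {ω | Z ω < ∞}).map fun ω => (Z ω).toReal

theorem aliveLaw_apply {Z : Ω → ℝ≥0∞} (hZ : Measurable Z) {E : Set ℝ} (hE : MeasurableSet E) :
    aliveLaw P Z E = P {ω | Z ω < ∞ ∧ (Z ω).toReal ∈ E} := by
  rw [aliveLaw, Measure.map_apply hZ.ennreal_toReal hE, Measure.restrict_apply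
    (hZ.ennreal_toReal hE)]
  congr 1; ext ω; simp [and_comm]

theorem lintegral_aliveLaw {Z : Ω → ℝ≥0∞} (hZ : Measurable Z) {g : ℝ → ℝ≥0∞} (hg : Measurable g) :
    ∫⁻ z, g z ∂aliveLaw P Z = ∫⁻ ω, (if Z ω < ∞ then g (Z ω).toReal else 0) ∂P := by
  rw [aliveLaw, lintegral_map hg hZ.ennreal_toReal, ← lintegral_indicator (measurableSet_lt hZ measurable_const)]
  simp only [indicator_apply, mem_ofPred_eq]

theorem aliveLaw_congr {Z Z' : Ω → ℝ≥0∞} (h : Z =ᵐ[P] Z') : aliveLaw P Z = aliveLaw P Z' := by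
  have h1 : ({ω | Z ω < ∞} : Set Ω) =ᵐ[P] {ω | Z' ω < ∞} := by
    filter_upwards [h] with ω hω
    exact congrArg (· < ∞) hω
  rw [aliveLaw, aliveLaw, Measure.restrict_congr_set h1]
  refine Measure.map_congr (ae_restrict_of_ae ?_)
  filter_upwards [h] with ω hω using by rw [hω]

theorem aliveLaw_eq_map {Z : Ω → ℝ≥0∞} (h : ∀ᵐ ω ∂P, Z ω < ∞) :
    aliveLaw P Z = P.map fun ω => (Z ω).toReal := by
  rw [aliveLaw, Measure.restrict_eq_self_of_ae_mem (s := {ω | Z ω < ∞}) h]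

theorem aliveLaw_Iio_zero {Z : Ω → ℝ≥0∞} (hZ : Measurable Z) : aliveLaw P Z (Iio 0) = 0 := by
  rw [aliveLaw_apply hZ measurableSet_Iio]
  simp [not_lt.2 ENNReal.toReal_nonneg]

theorem aliveLaw_univ_le [IsProbabilityMeasure P] {Z : Ω → ℝ≥0∞} (hZ : Measurable Z) :
    aliveLaw P Z univ ≤ 1 := by
  rw [aliveLaw_apply hZ MeasurableSet.univ]
  exact prob_le_one

theorem laplace_aliveLaw [IsFiniteMeasure P] {Z : Ω → ℝ≥0∞} (hZ : Measurable Z) {s : ℝ}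
    (hs : 0 ≤ s) : laplace (aliveLaw P Z) s =
      ENNReal.ofReal (∫ ω in {ω | Z ω < ∞}, Real.exp (-(s * (Z ω).toReal)) ∂P) := by
  have hm : Measurable fun ω => Real.exp (-(s * (Z ω).toReal)) := by fun_prop
  rw [laplace, aliveLaw, lintegral_map (measurable_ofReal_exp s) hZ.ennreal_toReal,
    ofReal_integral_eq_lintegral_ofReal _ (ae_of_all _ fun ω => (Real.exp_pos _).le)]
  refine Integrable.of_bound hm.aestronglyMeasurable 1 (ae_of_all _ fun ω => ?_)
  rw [Real.norm_of_nonneg (Real.exp_pos _).le, Real.exp_le_one_iff]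
  have := @ENNReal.toReal_nonneg (Z ω)
  nlinarith

/-- The kernel formed by the laws of a jointly measurable process. -/
noncomputable def aliveKernel (P : Measure Ω) [SFinite P] (Z : ℝ → Ω → ℝ≥0∞)
    (hZ : Measurable (Function.uncurry Z)) : Kernel ℝ ℝ where
  toFun y := aliveLaw P (Z y)
  measurable' := by
    refine Measure.measurable_of_measurable_coe _ fun E hE => ?_
    simp_rw [fun y => aliveLaw_apply (P := P) (hZ.of_uncurry_left (x := y)) hE]
    exact measurable_measure_prodMk_left (ν := P)
      ((hZ measurableSet_Iio).inter (hZ.ennreal_toReal hE))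

theorem isLaplaceSemigroup_aliveKernel [IsProbabilityMeasure P] {Z : ℝ → Ω → ℝ≥0∞}
    (hZ : Measurable (Function.uncurry Z)) {f : ℝ → ℝ}
    (h : ∀ x, 0 ≤ x → ∀ s, 0 < s →
      laplace (aliveLaw P (Z x)) s = ENNReal.ofReal (Real.exp (-(x * f s)))) :
    IsLaplaceSemigroup (aliveKernel P Z hZ) f where
  measure_Iio_zero _ := aliveLaw_Iio_zero hZ.of_uncurry_left
  le_one _ := aliveLaw_univ_le hZ.of_uncurry_left
  laplace_eq := h

theorem lintegral_comp_of_indepFun [IsFiniteMeasure P] {α β : Type*} [MeasurableSpace α]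
    [MeasurableSpace β] {U : Ω → α} {V : Ω → β} (h : IndepFun U V P) (hU : Measurable U)
    (hV : Measurable V) {Φ : α → β → ℝ≥0∞} (hΦ : Measurable (Function.uncurry Φ)) :
    ∫⁻ ω, Φ (U ω) (V ω) ∂P = ∫⁻ ω, (∫⁻ ω', Φ (U ω) (V ω') ∂P) ∂P := by
  have h1 := (indepFun_iff_map_prod_eq_prod_map_map hU.aemeasurable hV.aemeasurable).1 h
  calc ∫⁻ ω, Φ (U ω) (V ω) ∂P
      = ∫⁻ z, Function.uncurry Φ z ∂P.map fun ω => (U ω, V ω) :=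
        (lintegral_map hΦ (hU.prodMk hV)).symm
    _ = ∫⁻ ω, (∫⁻ v, Φ (U ω) v ∂P.map V) ∂P := by
        rw [h1, lintegral_prod _ hΦ.aemeasurable,
          lintegral_map hΦ.lintegral_prod_right' hU]
        rfl
    _ = _ := by
        refine lintegral_congr fun ω => ?_
        rw [lintegral_map (hΦ.of_uncurry_left) hV]

theorem measure_setOf_of_indepFun [IsFiniteMeasure P] {α β : Type*} [MeasurableSpace α]
    [MeasurableSpace β] {U : Ω → α} {V : Ω → β} (h : IndepFun U V P) (hU : Measurable U)
    (hV : Measurable V) {S : Set (α × β)} (hS : MeasurableSet S) :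
    P {ω | (U ω, V ω) ∈ S} = ∫⁻ ω, P {ω' | (U ω, V ω') ∈ S} ∂P := by
  have h1 := lintegral_comp_of_indepFun h hU hV (Φ := fun u v => S.indicator 1 (u, v))
    (measurable_one.indicator hS)
  calc P {ω | (U ω, V ω) ∈ S} = ∫⁻ ω, S.indicator 1 (U ω, V ω) ∂P :=
        (lintegral_indicator_one (hS.preimage (hU.prodMk hV))).symm
    _ = _ := h1.trans (lintegral_congr fun ω =>
        lintegral_indicator_one (hS.preimage (measurable_const.prodMk hV)))

end Alive

/-! ### Subordinators, their inverses and their sums. -/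

section Subordinators

variable {Ω : Type*} [MeasurableSpace Ω] {P : Measure Ω}

/-- With the convention e^{-∞} = 0 the exponential is multiplicative on [0, ∞], since a sum is
infinite exactly when a summand is; independence then factorises the expectation even for killed
processes. -/
theorem laplace_aliveLaw_sum [IsProbabilityMeasure P] {n : ℕ} {V : Fin n → Ω → ℝ≥0∞}
    (hV : ∀ j, Measurable (V j)) (hi : iIndepFun V P) (s : ℝ) :
    laplace (aliveLaw P fun ω => ∑ j, V j ω) s = ∏ j, laplace (aliveLaw P (V j)) s := by
  set e : ℝ≥0∞ → ℝ≥0∞ := fun v =>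
    if v < ∞ then ENNReal.ofReal (Real.exp (-(s * v.toReal))) else 0 with he
  have hem : Measurable e := .ite measurableSet_Iio (by fun_prop) measurable_const
  have h1 : ∀ Z : Ω → ℝ≥0∞, Measurable Z → laplace (aliveLaw P Z) s = ∫⁻ ω, e (Z ω) ∂P :=
    fun Z hZ => lintegral_aliveLaw hZ (measurable_ofReal_exp s)
  rw [h1 _ (Finset.measurable_fun_sum _ fun j _ => hV j)]
  simp_rw [fun j => h1 (V j) (hV j)]
  rw [← lintegral_prod_eq_prod_lintegral_of_indepFun Finset.univ (fun j ω => e (V j ω))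
    (hi.comp (fun _ => e) fun _ => hem) fun j => hem.comp (hV j)]
  refine lintegral_congr fun ω => ?_
  by_cases h : ∀ j, V j ω < ∞
  · have h2 : ∑ j, V j ω < ∞ := ENNReal.sum_lt_top.2 fun j _ => h j
    simp only [he, h2, h, if_true]
    rw [ENNReal.toReal_sum fun j _ => (h j).ne, Finset.mul_sum, ← Finset.sum_neg_distrib,
      Real.exp_sum, ENNReal.ofReal_prod_of_nonneg fun j _ => (Real.exp_pos _).le]
  · push Not at h
    obtain ⟨j, hj⟩ := h
    have h2 : ¬ ∑ j, V j ω < ∞ := by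
      rw [ENNReal.sum_lt_top]
      exact fun h => (h j (Finset.mem_univ j)).not_ge hj
    simp only [he, h2, if_false]
    exact (Finset.prod_eq_zero (Finset.mem_univ j) (if_neg hj.not_gt)).symm

theorem HasLaplaceExponent.laplace_aliveLaw [IsProbabilityMeasure P] {X : ℝ≥0 → Ω → ℝ≥0∞}
    {f : ℝ → ℝ} (h : HasLaplaceExponent X f P) (hX : ∀ t, Measurable (X t)) (t : ℝ≥0) {s : ℝ}
    (hs : 0 < s) : laplace (aliveLaw P (X t)) s = ENNReal.ofReal (Real.exp (-(t * f s))) := by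
  rw [_root_.laplace_aliveLaw (hX t) hs.le, h t s hs]

theorem measurable_uncurry_rightLimPath {X : ℝ≥0 → Ω → ℝ≥0∞} (hX : ∀ t, Measurable (X t)) :
    Measurable (Function.uncurry fun (x : ℝ) ω => rightLimPath (fun s => X s ω) x.toNNReal) :=
  measurable_rightLimPath.comp ((measurable_real_toNNReal.comp measurable_fst).prodMk
    (measurable_pi_lambda _ fun s => (hX s).comp measurable_snd))

theorem measurable_uncurry_inversePath {X : ℝ≥0 → Ω → ℝ≥0∞} (hX : ∀ t, Measurable (X t)) :
    Measurable (Function.uncurry fun (t : ℝ) ω => inversePath (fun s => X s ω) t) :=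
  measurable_inversePath.comp (measurable_fst.prodMk
    (measurable_pi_lambda _ fun s => (hX s).comp measurable_snd))

namespace IsSubordinator

variable {X : ℝ≥0 → Ω → ℝ≥0∞}

theorem ae_rightLimPath_eq (hX : IsSubordinator X P) :
    ∀ᵐ ω ∂P, ∀ s, rightLimPath (fun u => X u ω) s = X s ω := by
  filter_upwards [hX.mono, hX.rightCont] with ω h1 h2 s using rightLimPath_eq h1 (h2 s)

theorem aliveLaw_rightLimPath (hX : IsSubordinator X P) (s : ℝ≥0) :
    aliveLaw P (fun ω => rightLimPath (fun u => X u ω) s) = aliveLaw P (X s) :=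
  aliveLaw_congr (hX.ae_rightLimPath_eq.mono fun _ h => h s)

theorem ae_inversePath_eq (hX : IsSubordinator X P) (t : ℝ) :
    ∀ᵐ ω ∂P, inversePath (fun u => X u ω) t = inverseProcess X t ω := by
  filter_upwards [hX.mono] with ω h1 using inversePath_eq h1

theorem aemeasurable_inverseProcess (hX : IsSubordinator X P) (t : ℝ) :
    AEMeasurable (inverseProcess X t) P :=
  ⟨_, (measurable_uncurry_inversePath hX.measurable).of_uncurry_left,
    (hX.ae_inversePath_eq t).mono fun _ h => h.symm⟩

variable [IsProbabilityMeasure P]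

/-- The laws of a subordinator. -/
noncomputable def kernel (hX : IsSubordinator X P) : Kernel ℝ ℝ :=
  aliveKernel P _ (measurable_uncurry_rightLimPath hX.measurable)

theorem kernel_apply (hX : IsSubordinator X P) (x : ℝ) :
    hX.kernel x = aliveLaw P (X x.toNNReal) := hX.aliveLaw_rightLimPath _

theorem isLaplaceSemigroup_kernel (hX : IsSubordinator X P) {f : ℝ → ℝ}
    (h : HasLaplaceExponent X f P) : IsLaplaceSemigroup hX.kernel f :=
  isLaplaceSemigroup_aliveKernel _ fun x hx s hs => by
    rw [hX.aliveLaw_rightLimPath, h.laplace_aliveLaw hX.measurable _ hs, Real.coe_toNNReal x hx]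

/-- The laws of the inverse of a subordinator. -/
noncomputable def inverseKernel (hX : IsSubordinator X P) : Kernel ℝ ℝ :=
  aliveKernel P _ (measurable_uncurry_inversePath hX.measurable)

theorem kernel_Iic (hX : IsSubordinator X P) {t : ℝ} (ht : 0 ≤ t) (x : ℝ) :
    hX.kernel x (Iic t) = P {ω | X x.toNNReal ω ≤ ENNReal.ofReal t} := by
  rw [hX.kernel_apply, aliveLaw_apply (hX.measurable _) measurableSet_Iic]
  congr 1; ext ω
  simp only [mem_ofPred_eq, mem_Iic]
  constructor
  · rintro ⟨h1, h2⟩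
    exact (ENNReal.le_ofReal_iff_toReal_le h1.ne ht).2 h2
  · intro h
    have h1 := h.trans_lt ENNReal.ofReal_lt_top
    exact ⟨h1, (ENNReal.le_ofReal_iff_toReal_le h1.ne ht).1 h⟩

variable {F : LevyTriple}

/-- Chernoff bound: an infinite passage time forces X_x ≤ r for every x, r being the positive part
of t, an event of probability at most e^{r - x f(1)}, which tends to 0. -/
theorem ae_inverseProcess_lt_top (hX : IsSubordinator X P)
    (hXexp : HasLaplaceExponent X F.bernstein P) (hF : F.ConditionI) (t : ℝ) :
    ∀ᵐ ω ∂P, inverseProcess X t ω < ∞ := by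
  have hκ := hX.isLaplaceSemigroup_kernel hXexp
  have hf := F.bernstein_pos hF.1 one_pos
  set r := max t 0
  have hr : ENNReal.ofReal t = ENNReal.ofReal r := by rw [ENNReal.ofReal_max, ENNReal.ofReal_zero, max_eq_left (zero_le)]
  have h1 : ∀ x : ℝ, 0 ≤ x → P {ω | ¬ inverseProcess X t ω < ∞} ≤
      ENNReal.ofReal (Real.exp (r - x * F.bernstein 1)) := by
    intro x hx
    calc P {ω | ¬ inverseProcess X t ω < ∞}
        ≤ P {ω | X x.toNNReal ω ≤ ENNReal.ofReal r} := by
          refine measure_mono fun ω hω => mem_ofPred_eq ▸ not_lt.1 fun h => hω ?_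
          exact (inverseProcess_le (hr ▸ h)).trans_lt ENNReal.coe_lt_top
      _ = ∫⁻ z in Iic r, 1 ∂hX.kernel x := by
          rw [setLIntegral_one, hX.kernel_Iic (le_max_right _ _)]
      _ ≤ ∫⁻ z, ENNReal.ofReal (Real.exp r) * ENNReal.ofReal (Real.exp (-(1 * z)))
            ∂hX.kernel x := by
          refine (setLIntegral_mono (by fun_prop) fun z hz => ?_).trans (setLIntegral_le_lintegral _ _)
          rw [← ENNReal.ofReal_mul (Real.exp_pos _).le, ← Real.exp_add, ENNReal.one_le_ofReal,
            Real.one_le_exp_iff]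
          have := mem_Iic.1 hz
          linarith
      _ = _ := by
          rw [lintegral_const_mul _ (measurable_ofReal_exp 1)]
          change _ * laplace _ _ = _
          rw [hκ.laplace_eq x hx 1 one_pos, ← ENNReal.ofReal_mul (Real.exp_pos _).le,
            ← Real.exp_add, sub_eq_add_neg]
  have h2 : Filter.Tendsto (fun x : ℝ => ENNReal.ofReal (Real.exp (r - x * F.bernstein 1)))
      Filter.atTop (nhds 0) := by
    rw [← ENNReal.ofReal_zero]
    refine ENNReal.tendsto_ofReal (Real.tendsto_exp_atBot.comp ?_)
    exact Filter.tendsto_atBot_add_const_left _ r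
      (Filter.tendsto_neg_atTop_atBot.comp (Filter.tendsto_id.atTop_mul_const hf))
  rw [ae_iff]
  refine le_antisymm (ge_of_tendsto h2 ?_) bot_le
  filter_upwards [Filter.eventually_ge_atTop 0] with x hx using h1 x hx

theorem inverseKernel_apply (hX : IsSubordinator X P)
    (hXexp : HasLaplaceExponent X F.bernstein P) (hF : F.ConditionI) (t : ℝ) :
    hX.inverseKernel t = inverseLaw X P t :=
  (aliveLaw_congr (hX.ae_inversePath_eq t)).trans
    (aliveLaw_eq_map (hX.ae_inverseProcess_lt_top hXexp hF t))

/-- The events {Y(t) > x} and {X_x ≤ t} differ only where X_x = t, which is null: for x > 0 the law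
of X_x is absolutely continuous, and X_0 = 0 < t. Right-continuity at 0 makes Y(t) positive. -/
theorem isInverseLaw (hX : IsSubordinator X P)
    (hXexp : HasLaplaceExponent X F.bernstein P) (hF : F.ConditionI) :
    IsInverseLaw hX.inverseKernel hX.kernel where
  le_one t := aliveLaw_univ_le (measurable_uncurry_inversePath hX.measurable).of_uncurry_left
  measure_Iic_zero t ht := by
    rw [hX.inverseKernel_apply hXexp hF, inverseLaw, Measure.map_apply_of_aemeasurable
      (hX.aemeasurable_inverseProcess t).ennreal_toReal measurableSet_Iic, ← nonpos_iff_eq_zero]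
    refine (measure_mono_ae ?_).trans (measure_empty (μ := P)).le
    filter_upwards [hX.mono, hX.rightCont, hX.zero, hX.ae_inverseProcess_lt_top hXexp hF t]
      with ω h1 h2 h3 h4 h5
    have h6 : inverseProcess X t ω = 0 :=
      ((ENNReal.toReal_eq_zero_iff _).1 (le_antisymm h5 ENNReal.toReal_nonneg)).resolve_right h4.ne
    have h7 := le_of_inverseProcess_le h1 (h2 0) h6.le
    rw [h3, nonpos_iff_eq_zero, ENNReal.ofReal_eq_zero] at h7
    exact absurd h7 ht.not_ge
  measure_Ioi t ht x hx := by
    have hnull : ∀ᵐ ω ∂P, X x.toNNReal ω ≠ ENNReal.ofReal t := by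
      rcases hx.eq_or_lt with rfl | hx
      · filter_upwards [hX.zero] with ω h1
        rw [Real.toNNReal_zero, h1]
        exact (ENNReal.ofReal_pos.2 ht).ne
      · have h1 := (hX.isLaplaceSemigroup_kernel hXexp).absolutelyContinuous hF hx
          (measure_singleton t)
        rw [hX.kernel_apply, aliveLaw_apply (hX.measurable _) (measurableSet_singleton t)] at h1
        rw [ae_iff]
        refine measure_mono_null (fun ω hω => ?_) h1
        have hω' := not_not.1 hω
        refine ⟨hω' ▸ ENNReal.ofReal_lt_top, ?_⟩
        rw [hω', mem_singleton_iff, ENNReal.toReal_ofReal ht.le]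
    rw [hX.inverseKernel_apply hXexp hF, inverseLaw, Measure.map_apply_of_aemeasurable
      (hX.aemeasurable_inverseProcess t).ennreal_toReal measurableSet_Ioi, hX.kernel_Iic ht.le]
    refine measure_congr ?_
    filter_upwards [hX.mono, hX.rightCont, hX.ae_inverseProcess_lt_top hXexp hF t, hnull]
      with ω h1 h2 h3 h4
    refine propext ?_
    change x < (inverseProcess X t ω).toReal ↔ X x.toNNReal ω ≤ ENNReal.ofReal t
    rw [← ENNReal.ofReal_lt_iff_lt_toReal hx h3.ne]
    constructor
    · intro h
      by_contra! h5
      exact (inverseProcess_le h5).not_gt h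
    · intro h
      by_contra! h5
      exact h4 (le_antisymm h (le_of_inverseProcess_le h1 (h2 _) h5))

/-- Almost surely X is nonzero at every time 1/(i+1), because its law there has no atom at 0; hence
the passage above level 0 is immediate. -/
theorem ae_inverseProcess_zero (hX : IsSubordinator X P)
    (hXexp : HasLaplaceExponent X F.bernstein P) (hF : F.ConditionI) :
    ∀ᵐ ω ∂P, inverseProcess X 0 ω = 0 := by
  have h1 : ∀ i : ℕ, ∀ᵐ ω ∂P, X (Real.toNNReal (1 / ((i : ℝ) + 1))) ω ≠ 0 := by
    intro i
    have h1 := (hX.isLaplaceSemigroup_kernel hXexp).absolutelyContinuous hF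
      (by positivity : (0 : ℝ) < 1 / ((i : ℝ) + 1)) (measure_singleton 0)
    rw [hX.kernel_apply, aliveLaw_apply (hX.measurable _) (measurableSet_singleton 0)] at h1
    rw [ae_iff]
    refine measure_mono_null (fun ω hω => ?_) h1
    have hω' := not_not.1 hω
    refine ⟨hω' ▸ ENNReal.zero_lt_top, ?_⟩
    rw [hω', mem_singleton_iff, ENNReal.toReal_zero]
  filter_upwards [ae_all_iff.2 h1] with ω hω
  have h2 : Filter.Tendsto (fun i : ℕ => ENNReal.ofReal (1 / ((i : ℝ) + 1))) Filter.atTop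
      (nhds 0) := by
    rw [← ENNReal.ofReal_zero]
    exact ENNReal.tendsto_ofReal tendsto_one_div_add_atTop_nhds_zero_nat
  refine le_antisymm (ge_of_tendsto' h2 fun i => inverseProcess_le ?_) bot_le
  simpa using bot_lt_iff_ne_bot.2 (hω i)

theorem inverseLaw_zero (hX : IsSubordinator X P)
    (hXexp : HasLaplaceExponent X F.bernstein P) (hF : F.ConditionI) :
    inverseLaw X P 0 = Measure.dirac 0 := by
  rw [inverseLaw, Measure.map_congr (g := fun _ => (0 : ℝ)) ?_, Measure.map_const, measure_univ,
    one_smul]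
  filter_upwards [hX.ae_inverseProcess_zero hXexp hF] with ω hω
  simp [hω]

end IsSubordinator

/-- The laws of the sum of independent subordinators. -/
noncomputable def sumKernel {n : ℕ} (P : Measure Ω) [SFinite P] (H : Fin n → ℝ≥0 → Ω → ℝ≥0∞)
    (hm : ∀ j t, Measurable (H j t)) : Kernel ℝ ℝ :=
  aliveKernel P (fun y ω => ∑ j, rightLimPath (fun s => H j s ω) y.toNNReal)
    (Finset.measurable_fun_sum _ fun j _ => measurable_uncurry_rightLimPath (hm j))

theorem isLaplaceSemigroup_sumKernel [IsProbabilityMeasure P] {n : ℕ}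
    {H : Fin n → ℝ≥0 → Ω → ℝ≥0∞} {f : Fin n → ℝ → ℝ} (hH : ∀ j, IsSubordinator (H j) P)
    (hHexp : ∀ j, HasLaplaceExponent (H j) (f j) P)
    (hi : iIndepFun (fun (j : Fin n) (ω : Ω) (s : ℝ≥0) => H j s ω) P) :
    IsLaplaceSemigroup (sumKernel P H fun j => (hH j).measurable) fun s => ∑ j, f j s := by
  refine isLaplaceSemigroup_aliveKernel _ fun y hy s hs => ?_
  rw [laplace_aliveLaw_sum (V := fun j ω => rightLimPath (fun s => H j s ω) y.toNNReal)
    (fun j => (measurable_uncurry_rightLimPath (hH j).measurable).of_uncurry_left (x := y))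
    (hi.comp (fun _ w => rightLimPath w y.toNNReal) fun _ =>
      measurable_rightLimPath.comp measurable_prodMk_left)]
  simp_rw [fun j => (hH j).aliveLaw_rightLimPath y.toNNReal,
    fun j => (hHexp j).laplace_aliveLaw (hH j).measurable y.toNNReal hs]
  rw [← ENNReal.ofReal_prod_of_nonneg fun j _ => (Real.exp_pos _).le, ← Real.exp_sum,
    Finset.sum_neg_distrib, ← Finset.mul_sum, Real.coe_toNNReal y hy]

end Subordinators

/-! ### The Poisson process at the time-changed sum. -/

section TimeChange

variable {Ω : Type*} [MeasurableSpace Ω] {P : Measure Ω} {n : ℕ}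

/-- The sum of the paths `h` at the first passage time of the path `w` above the level `t`. -/
noncomputable def timeChange (t : ℝ) (w : ℝ≥0 → ℝ≥0∞) (h : Fin n → ℝ≥0 → ℝ≥0∞) : ℝ≥0∞ :=
  -- A level that is never passed is sent to the cemetery, so it contributes nothing to `aliveLaw`.
  if inversePath w t < ∞ then ∑ j, rightLimPath (h j) (inversePath w t).toReal.toNNReal else ⊤

theorem measurable_timeChange (t : ℝ) :
    Measurable (Function.uncurry (timeChange (n := n) t)) := by
  have h1 : Measurable fun z : (ℝ≥0 → ℝ≥0∞) × (Fin n → ℝ≥0 → ℝ≥0∞) => inversePath z.1 t :=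
    measurable_inversePath.comp (measurable_const.prodMk measurable_fst)
  refine .ite (h1 measurableSet_Iio) (Finset.measurable_fun_sum _ fun j _ => ?_) measurable_const
  exact measurable_rightLimPath.comp (h1.ennreal_toReal.real_toNNReal.prodMk
    ((measurable_pi_apply j).comp measurable_snd))

theorem measurable_path {β ι : Type*} [MeasurableSpace β] {X : ι → Ω → β}
    (hX : ∀ t, Measurable (X t)) : Measurable fun ω s => X s ω :=
  measurable_pi_lambda _ hX

theorem measurable_paths {H : Fin n → ℝ≥0 → Ω → ℝ≥0∞} (hH : ∀ j t, Measurable (H j t)) :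
    Measurable fun ω j s => H j s ω :=
  measurable_pi_lambda _ fun j => measurable_path (hH j)

/-- The law of a sum of independent subordinators at an independent inverse time is a mixture. -/
theorem aliveLaw_timeChange [IsProbabilityMeasure P] {H : Fin n → ℝ≥0 → Ω → ℝ≥0∞}
    (hH : ∀ j t, Measurable (H j t)) {X : ℝ≥0 → Ω → ℝ≥0∞} (hX : IsSubordinator X P)
    (hXH : IndepFun (fun (ω : Ω) (s : ℝ≥0) => X s ω)
      (fun (ω : Ω) (j : Fin n) (s : ℝ≥0) => H j s ω) P) (t : ℝ) :
    aliveLaw P (fun ω => timeChange t (fun s => X s ω) fun j s => H j s ω) =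
      (hX.inverseKernel t).bind (sumKernel P H hH) := by
  refine Measure.ext fun E hE => ?_
  have hXm := measurable_path hX.measurable
  have hHm := measurable_paths hH
  have hT : Measurable fun ω => timeChange t (fun s => X s ω) fun j s => H j s ω :=
    (measurable_timeChange t).comp (hXm.prodMk hHm)
  have hg : Measurable (E.indicator (1 : ℝ → ℝ≥0∞)) := measurable_one.indicator hE
  rw [Measure.bind_apply hE (sumKernel P H hH).measurable.aemeasurable, ← lintegral_indicator_one hE,
    lintegral_aliveLaw hT hg, lintegral_comp_of_indepFun hXH hXm hHm
      (Φ := fun u v => if timeChange t u v < ∞ then E.indicator 1 (timeChange t u v).toReal else 0)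
      (.ite (measurable_timeChange t measurableSet_Iio)
        (hg.comp (measurable_timeChange t).ennreal_toReal) measurable_const)]
  have hY := (measurable_uncurry_inversePath hX.measurable).of_uncurry_left (x := t)
  have hσ : Measurable fun y => sumKernel P H hH y E := Kernel.measurable_coe _ hE
  refine Eq.trans ?_ (lintegral_aliveLaw hY hσ).symm
  refine lintegral_congr fun ω => ?_
  by_cases hω : inversePath (fun s => X s ω) t < ∞
  · simp only [timeChange, hω, if_true]
    rw [← lintegral_indicator_one hE]
    exact (lintegral_aliveLaw (Finset.measurable_fun_sum _ fun j _ =>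
      (measurable_uncurry_rightLimPath (hH j)).of_uncurry_left) hg).symm
  · simp [timeChange, hω]

theorem IsPoissonProcess.measure_eq {N : ℝ≥0 → Ω → ℕ} {lam : ℝ≥0} (hN : IsPoissonProcess N lam P)
    (k : ℕ) (s : ℝ≥0) : P {ω | N s ω = k} = ENNReal.ofReal (poissonWeight lam k s) := by
  have h1 := congrArg (fun μ => μ {k}) (hN.law 0 s bot_le)
  simp only [tsub_zero] at h1
  have hm : Measurable fun ω => N s ω - N 0 ω := (hN.measurable s).sub (hN.measurable 0)
  rw [Measure.map_apply hm (measurableSet_singleton k),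
    poissonMeasure_singleton] at h1
  rw [poissonWeight, ← NNReal.coe_mul, ← h1]
  refine measure_congr ?_
  filter_upwards [hN.zero] with ω hω
  refine propext ?_
  change N s ω = k ↔ N s ω - N 0 ω = k
  rw [hω, tsub_zero]

theorem IsPoissonProcess.ae_rightLimPath_eq {N : ℝ≥0 → Ω → ℕ} {lam : ℝ≥0}
    (hN : IsPoissonProcess N lam P) :
    ∀ᵐ ω ∂P, ∀ s, rightLimPath (fun u => (N u ω : ℝ≥0∞)) s = N s ω := by
  filter_upwards [hN.mono, hN.rightCont] with ω h1 h2 s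
  refine rightLimPath_eq (fun a b hab => Nat.cast_le.2 (h1 hab)) ?_
  exact (continuous_of_discreteTopology (f := fun m : ℕ => (m : ℝ≥0∞))).continuousAt
    |>.comp_continuousWithinAt (h2 s)

/-- A Poisson process at an independent random time. -/
theorem timeChangedProb_eq [IsProbabilityMeasure P] {lam : ℝ≥0}
    {N : ℝ≥0 → Ω → ℕ} {H : Fin n → ℝ≥0 → Ω → ℝ≥0∞} {X : ℝ≥0 → Ω → ℝ≥0∞}
    (hN : IsPoissonProcess N lam P) (hH : ∀ j, IsSubordinator (H j) P) (hX : IsSubordinator X P)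
    (hNXH : IndepFun (fun (ω : Ω) (s : ℝ≥0) => N s ω)
      (fun ω : Ω => ((fun s : ℝ≥0 => X s ω), (fun (j : Fin n) (s : ℝ≥0) => H j s ω))) P)
    (k : ℕ) (t : ℝ) : timeChangedProb N H X P k t =
      ∫ s, poissonWeight lam k s
        ∂aliveLaw P (fun ω => timeChange t (fun s => X s ω) fun j s => H j s ω) := by
  have hNm := measurable_path hN.measurable
  have hXm := measurable_path hX.measurable
  have hHm := measurable_paths fun j => (hH j).measurable
  have hT : Measurable fun ω => timeChange t (fun s => X s ω) fun j s => H j s ω :=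
    (measurable_timeChange t).comp (hXm.prodMk hHm)
  have hg : Measurable fun s => ENNReal.ofReal (poissonWeight lam k s) :=
    (measurable_poissonWeight lam k).ennreal_ofReal
  set R : ((ℝ≥0 → ℝ≥0∞) × (Fin n → ℝ≥0 → ℝ≥0∞)) → (ℝ≥0 → ℕ) → Prop := fun u v =>
    timeChange t u.1 u.2 < ∞ ∧
      rightLimPath (fun s => (v s : ℝ≥0∞)) (timeChange t u.1 u.2).toReal.toNNReal = k with hR
  have hRm : MeasurableSet {z | Function.uncurry R z} := by
    have h1 : Measurable fun z : ((ℝ≥0 → ℝ≥0∞) × (Fin n → ℝ≥0 → ℝ≥0∞)) × (ℝ≥0 → ℕ) =>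
        timeChange t z.1.1 z.1.2 := (measurable_timeChange t).comp measurable_fst
    refine (h1 measurableSet_Iio).inter (measurableSet_eq_fun ?_ measurable_const)
    have h2 : Measurable fun z : ((ℝ≥0 → ℝ≥0∞) × (Fin n → ℝ≥0 → ℝ≥0∞)) × (ℝ≥0 → ℕ) =>
        fun s => (z.2 s : ℝ≥0∞) := measurable_pi_lambda _ fun s =>
      (measurable_from_top (f := fun m : ℕ => (m : ℝ≥0∞))).comp
        ((measurable_pi_apply s).comp measurable_snd)
    exact measurable_rightLimPath.comp (h1.ennreal_toReal.real_toNNReal.prodMk h2)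
  -- The event need not be measurable as written; it agrees almost surely with one expressed through
  -- the jointly measurable path functionals.
  have hset : P {ω | ∃ y s : ℝ≥0, inverseProcess X t ω = y ∧ ∑ j, H j y ω = s ∧ N s ω = k} =
      P {ω | R ((fun s => X s ω), fun j s => H j s ω) fun s => N s ω} := by
    refine measure_congr ?_
    filter_upwards [hX.ae_inversePath_eq t, hN.ae_rightLimPath_eq,
      ae_all_iff.2 fun j => (hH j).ae_rightLimPath_eq] with ω h1 h2 h3
    refine propext ?_
    change (∃ y s : ℝ≥0, inverseProcess X t ω = y ∧ ∑ j, H j y ω = s ∧ N s ω = k) ↔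
      timeChange t _ _ < ∞ ∧ rightLimPath _ _ = (k : ℝ≥0∞)
    simp only [h2, Nat.cast_inj]
    simp only [timeChange, h1, h3]
    constructor
    · rintro ⟨y, s, hy, hs, hk⟩
      simp [hy, hs, hk]
    · rintro ⟨h4, h5⟩
      have h6 : inverseProcess X t ω < ∞ := by
        by_contra h
        simp [h] at h4
      rw [if_pos h6] at h4 h5
      refine ⟨(inverseProcess X t ω).toReal.toNNReal, _, ?_, ?_, h5⟩
      · exact (ENNReal.ofReal_toReal h6.ne).symm
      · exact (ENNReal.ofReal_toReal h4.ne).symm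
  have hnonneg : 0 ≤ᵐ[aliveLaw P fun ω => timeChange t (fun s => X s ω) fun j s => H j s ω]
      poissonWeight lam k := by
    have h1 : ∀ᵐ s ∂aliveLaw P fun ω => timeChange t (fun s => X s ω) fun j s => H j s ω, 0 ≤ s := by
      rw [ae_iff]
      simpa [Iio_def] using aliveLaw_Iio_zero (P := P) hT
    filter_upwards [h1] with s hs using poissonWeight_nonneg lam.2 hs k
  rw [timeChangedProb, measureReal_def, hset, integral_eq_lintegral_of_nonneg_ae hnonneg
    (measurable_poissonWeight lam k).aestronglyMeasurable, lintegral_aliveLaw hT hg]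
  congr 1
  -- Independence freezes the random time; N at the frozen time has the Poisson law.
  refine (measure_setOf_of_indepFun hNXH.symm (hXm.prodMk hHm) hNm hRm).trans
    (lintegral_congr fun ω => ?_)
  change P {ω' | R ((fun s => X s ω), fun j s => H j s ω) fun s => N s ω'} = _
  simp only [hR]
  split_ifs with h
  · rw [← Real.coe_toNNReal _ ENNReal.toReal_nonneg, ← hN.measure_eq]
    refine measure_congr ?_
    filter_upwards [hN.ae_rightLimPath_eq] with ω' h3
    refine propext ?_
    change (_ ∧ _) ↔ N _ ω' = k
    simp [h, h3]
  · simp [h]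

end TimeChange

/-! ### Mixing over the inverse and conclusion. -/

section Mixtures

variable {η κ σ : Kernel ℝ ℝ} {f ψ : ℝ → ℝ}

/-- Given that the inverse equals y, the transform is e^{-yψ(s)}; averaging over y is the transform
of η_t at ψ(s). -/
theorem IsInverseLaw.laplace_bind (h : IsInverseLaw η κ) (hσ : IsLaplaceSemigroup σ ψ) {t s : ℝ}
    (ht : 0 < t) (hs : 0 < s) : laplace ((η t).bind σ) s = laplace (η t) (ψ s) := by
  rw [laplace, Measure.lintegral_bind σ.measurable.aemeasurable
    (measurable_ofReal_exp s).aemeasurable, laplace]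
  refine lintegral_congr_ae ?_
  filter_upwards [h.ae_pos ht] with y hy
  rw [mul_comm (ψ s)]
  exact hσ.laplace_eq y hy.le s hs

theorem IsLaplaceSemigroup.integral_bind_poissonWeight (hσ : IsLaplaceSemigroup σ ψ)
    (α : Measure ℝ) [IsFiniteMeasure α] {lam : ℝ} (hlam : 0 ≤ lam) (k : ℕ) :
    ∫ s, poissonWeight lam k s ∂α.bind σ = ∫ y, poissonMixture σ lam k y ∂α := by
  have := hσ.isFiniteKernel
  have h0 : ∀ᵐ s ∂α.bind σ, 0 ≤ s := by
    have h1 : (α.bind σ) (Iio 0) = 0 := by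
      rw [Measure.bind_apply measurableSet_Iio σ.measurable.aemeasurable]
      simp [hσ.measure_Iio_zero]
    rw [ae_iff]
    simpa [Iio_def] using h1
  refine Kernel.integral_comp (κ := Kernel.const Unit α) (a := ()) (Integrable.of_bound
    (measurable_poissonWeight lam k).aestronglyMeasurable 1 ?_)
  filter_upwards [h0] with s hs
  rw [Real.norm_of_nonneg (poissonWeight_nonneg hlam hs k)]
  exact poissonWeight_le_one hlam hs k

end Mixtures

theorem inverseDensityLaplace_eq {Ω : Type*} [MeasurableSpace Ω] {P : Measure Ω}
    {X : ℝ≥0 → Ω → ℝ≥0∞} [IsFiniteMeasure P] {t : ℝ}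
    (hac : inverseLaw X P t ≪ volume) (h0 : inverseLaw X P t (Iic 0) = 0) (μ : ℝ) :
    inverseDensityLaplace X P t μ = (laplace (inverseLaw X P t) μ).toReal := by
  have : IsFiniteMeasure (inverseLaw X P t) := by unfold inverseLaw; infer_instance
  have h1 : ∀ x, Real.exp (-(μ * x)) * inverseDensity X P t x =
      ((inverseLaw X P t).rnDeriv volume x).toReal • Real.exp (-(μ * x)) := fun x => mul_comm _ _
  rw [inverseDensityLaplace]
  simp_rw [h1]
  rw [setIntegral_rnDeriv_smul hac measurableSet_Ioi, ← integral_exp_eq_laplace,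
    Measure.restrict_eq_self_of_ae_mem]
  rw [ae_iff]
  simpa [Iic_def] using h0

theorem mainTheorem4 {Ω : Type*} [MeasurableSpace Ω] (P : Measure Ω) [IsProbabilityMeasure P]
    {n : ℕ} (lam : ℝ≥0) (hlam : 0 < lam)
    (F : LevyTriple) (hF : F.ConditionI) (Ψ : Fin n → LevyTriple)
    (N : ℝ≥0 → Ω → ℕ) (H : Fin n → ℝ≥0 → Ω → ℝ≥0∞) (X : ℝ≥0 → Ω → ℝ≥0∞)
    (hN : IsPoissonProcess N lam P)
    (hH : ∀ j, IsSubordinator (H j) P)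
    (hHexp : ∀ j, HasLaplaceExponent (H j) (Ψ j).bernstein P)
    (hX : IsSubordinator X P)
    (hXexp : HasLaplaceExponent X F.bernstein P)
    (hHindep : iIndepFun (fun (j : Fin n) (ω : Ω) (s : ℝ≥0) => H j s ω) P)
    (hXH : IndepFun (fun (ω : Ω) (s : ℝ≥0) => X s ω)
      (fun (ω : Ω) (j : Fin n) (s : ℝ≥0) => H j s ω) P)
    (hNXH : IndepFun (fun (ω : Ω) (s : ℝ≥0) => N s ω)
      (fun ω : Ω => ((fun s : ℝ≥0 => X s ω), (fun (j : Fin n) (s : ℝ≥0) => H j s ω))) P) :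
    -- existence of the density of the inverse subordinator, smoothness in the rate, and
    -- the formula for the probabilities
    (∀ t : ℝ, 0 < t →
      inverseLaw X P t ≪ volume ∧
      ContDiffOn ℝ (⊤ : ℕ∞)
        (fun μ : ℝ => inverseDensityLaplace X P t (∑ j, (Ψ j).bernstein μ)) (Ioi 0) ∧
      ∀ k : ℕ, timeChangedProb N H X P k t =
        (-(lam : ℝ)) ^ k / (k.factorial : ℝ) *
          iteratedDeriv k
            (fun μ : ℝ => inverseDensityLaplace X P t (∑ j, (Ψ j).bernstein μ)) lam) ∧
    -- the governing equation
    (∀ (k : ℕ) (t : ℝ), 0 < t →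
      F.CDDifferentiableAt (timeChangedProb N H X P k) t ∧
      F.cdDeriv (timeChangedProb N H X P k) t =
        -∑ j, shiftOperator (Ψ j).bernstein lam (fun i => timeChangedProb N H X P i t) k) ∧
    -- the initial conditions
    (∀ k : ℕ, timeChangedProb N H X P k 0 = if k = 0 then 1 else 0) := by
  have hσ := isLaplaceSemigroup_sumKernel hH hHexp hHindep
  have hκ := hX.isLaplaceSemigroup_kernel hXexp
  have hη := hX.isInverseLaw hXexp hF
  have hlam' : (0 : ℝ) < lam := NNReal.coe_pos.2 hlam
  set σ := sumKernel P H fun j => (hH j).measurable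
  set ψ : ℝ → ℝ := fun s => ∑ j, (Ψ j).bernstein s with hψ
  have hlaw := hX.inverseKernel_apply hXexp hF
  have hp : ∀ k t, timeChangedProb N H X P k t =
      ∫ s, poissonWeight lam k s ∂(inverseLaw X P t).bind σ := by
    intro k t
    rw [timeChangedProb_eq hN hH hX hNXH, aliveLaw_timeChange _ hX hXH, hlaw]
  have hp' : ∀ k t, timeChangedProb N H X P k t =
      ∫ y, IsLaplaceSemigroup.poissonMixture σ lam k y ∂inverseLaw X P t := fun k t => by
    have : IsFiniteMeasure (inverseLaw X P t) := by unfold inverseLaw; infer_instance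
    rw [hp, hσ.integral_bind_poissonWeight _ hlam'.le]
  have hp0 : ∀ k, timeChangedProb N H X P k 0 = IsLaplaceSemigroup.poissonMixture σ lam k 0 := by
    intro k
    rw [hp', hX.inverseLaw_zero hXexp hF, integral_dirac]
  refine ⟨fun t ht => ?_, fun k t ht => ?_, fun k => ?_⟩
  · have hac : inverseLaw X P t ≪ volume := hlaw t ▸ hη.absolutelyContinuous hκ
      (fun x hx => hκ.absolutelyContinuous hF hx) (F.bernstein_pos hF.1 one_pos) ht
    have hL : ∀ s > 0, laplace ((inverseLaw X P t).bind σ) s = laplace (inverseLaw X P t) (ψ s) :=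
      fun s hs => by rw [← hlaw]; exact hη.laplace_bind hσ ht hs
    have hG : ∀ s > 0, (laplace ((inverseLaw X P t).bind σ) s).toReal =
        inverseDensityLaplace X P t (∑ j, (Ψ j).bernstein s) := fun s hs => by
      rw [hL s hs, inverseDensityLaplace_eq hac (hlaw t ▸ hη.measure_Iic_zero t ht)]
    have hfin : ∀ s > 0, laplace ((inverseLaw X P t).bind σ) s ≠ ∞ := fun s hs => by
      rw [hL s hs, ← hlaw]
      have := hη.isFiniteKernel
      -- The sum ψ(s) may vanish, so finiteness is taken from ψ(s) ≥ 0 and the finite mass of the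
      -- inverse law.
      refine ((lintegral_mono_ae ?_).trans_lt
        (lintegral_const_lt_top (μ := hX.inverseKernel t) ENNReal.one_ne_top)).ne
      filter_upwards [hη.ae_pos ht] with y hy
      rw [ENNReal.ofReal_le_one, Real.exp_le_one_iff, neg_nonpos]
      exact mul_nonneg (Finset.sum_nonneg fun j _ => (Ψ j).bernstein_nonneg hs.le) hy.le
    refine ⟨hac, fun s hs => (contDiffAt_of_laplace hfin hG hs).contDiffWithinAt, fun k => ?_⟩
    rw [← integral_poissonWeight hfin hG hlam' k, hp]
  · have h1 := hη.cdDeriv_eq hκ hF (fun k => hσ.measurable_poissonMixture lam k)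
      (fun k y => hσ.poissonMixture_nonneg hlam'.le k y)
      (fun k y => hσ.poissonMixture_le_one hlam'.le k y)
      (fun k y hy => hσ.poissonMixture_eq_sub hlam' k hy) hp0
      (fun k t _ => by rw [hp', hlaw]) k ht
    refine ⟨h1.1, h1.2.trans ?_⟩
    simp only [shiftOperator]
    rw [Finset.sum_comm]
    refine congrArg _ (Finset.sum_congr rfl fun m _ => ?_)
    -- The system carries the derivatives of the sum ψ; each ψ_j is smooth at λ as the exponent of
    -- its own semigroup, so they split over j.
    rw [iteratedDeriv_fun_sum fun j _ =>
      (((hH j).isLaplaceSemigroup_kernel (hHexp j)).contDiffAt_exponent hlam').of_le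
        (by exact_mod_cast le_top), Finset.sum_mul, Finset.sum_div, Finset.sum_mul]
  · rw [hp0, hσ.poissonMixture_zero]
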